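/- **Setting.** Let $n\ge 1$ and let $1\to S\to T\to H\to 1$ be an exact sequence of complex algebraic tori with $T=(\mathbb{C}^\times)^n$, $S\cong(\mathbb{C}^\times)^r$, $H\cong(\mathbb{C}^\times)^d$. Let $\mathfrak a:\mathbb{X}_*(T)=\mathbb{Z}^n\to\mathbb{X}_*(H)$ and $\mathfrak b:\mathbb{X}^*(T)=\mathbb{Z}^n\to\mathbb{X}^*(S)$ be the induced surjections, $\mathfrak a_i,\mathfrak b_i$ the images of the standard basis vectors. Assume that all $\mathfrak a_i$ and $\mathfrak b_i$ are nonzero and that $\mathfrak a$ is unimodular: any $d$ linearly independent $\mathfrak a_i$ generate $\mathbb{X}_*(H)$. Let $\mathbb{B}$ be the set of $I\subset\{1,\dots,n\}$ such that $(\mathfrak a_i)_{i\in I}$ is a basis of $\mathbb{X}_*(H)$. A signed circuit is $C=C_+\sqcup C_-$ with $(\mathfrak a_i)_{i\in C}$ minimally linearly dependent and $\sum_{C_+}\mathfrak a_i=\sum_{C_-}\mathfrak a_i$; let $\beta_C\in\mathbb{X}_*(S)=\ker\mathfrak a$ be the vector equal to $\pm1$ on $C_\pm$ and to $0$ elsewhere.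 For $I\in\mathbb{B}$, $j\notin I$, let $\beta^I_j=\beta_C$ for the signed circuit $C\subset I\cup\{j\}$ with $j\in C_+$. Signed cocircuits and $\alpha_{C^\vee}\in\mathbb{X}^*(H)$, $\alpha^I_i$ ($i\in I$, using $I^c\cup\{i\}$) are defined in the same way from the $\mathfrak b_i$. Fix $\eta\in\mathbb{X}^*(S)$ and $\xi\in\mathbb{X}_*(H)$ with $\langle\eta,\beta_C\rangle\neq0$ for all signed circuits and $\langle\xi,\alpha_{C^\vee}\rangle\ne0$ for all signed cocircuits. **The manifold $X$.** Let $T\times\mathbb{S}$, $\mathbb{S}=\mathbb{C}^\times$, act on $T^*\mathbb{C}^n$ by $(t,\sigma)(x,y)=(\sigma^{-1}tx,\sigma^{-1}t^{-1}y)$, let $\mu(x,y)=\sum_i x_iy_i\mathfrak b_i$, and let $X=\mu^{-1}(0)^{\eta\text{-ss}}/S$, where a point is $\eta$-semistable if some polynomial of $S$-weight $-m\eta$ (with $(s\cdot f)(z)=f(s^{-1}z)$), $m>0$, does not vanish at it. The torus $\mathbb{T}=H\times\mathbb{S}$ acts on $X$. For $w\in\mathbb{X}^*(T)$ let $\mathcal{L}(w)$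 be the $\mathbb{T}$-equivariant line bundle on $X$ obtained by descent from the trivial bundle with fibre the representation $w$ of $T\times \mathbb S$ ($\mathbb{S}$ acting trivially on it). For $I\in\mathbb{B}$ let $U_I\subset X$ be the image of the set of points with $x_j\ne0$ whenever $j\notin I$, $\langle\eta,\beta^I_j\rangle>0$, and $y_j\neq0$ whenever $j\notin I$, $\langle\eta,\beta^I_j\rangle<0$. It contains a unique $H$-fixed point $p_I$, and $I\mapsto p_I$ is a bijection $\mathbb{B}\cong X^H$; the map $w\mapsto\mathcal{L}(w)$ induces an isomorphism $\mathbb{X}^*(S)\cong\mathrm{Pic}(X)=:P$. The data on $X$ are: the multiset $\Phi(p)$ of $H$-weights of $T_pX$ for $p\in X^H$; the chamber $\mathfrak{C}\subset\mathbb{X}_*(H)\otimes\mathbb{R}$, i.e. the connected component containing $\xi$ of the complement of the hyperplanes orthogonal to the weights in $\bigcup_p\Phi(p)$; the ample cone $\mathfrak{A}\subset P\otimes\mathbb{R}$; the Kähler roots $\Psi(p_I)=\{\pm\beta^I_j\}_{j\notin I}\subset P^\vee\cong\mathbb{X}_*(S)$; and the lift $\mathfrak{L}:P\to\mathrm{Pic}^{\mathbb{T}}(X)$,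 $\mathfrak{L}(l)=\mathcal{L}(\iota(l))$, where $\iota:\mathbb{X}^*(S)\to\mathbb{X}^*(T)$ is a splitting of $\mathfrak b$. Let $\mathrm{Attr}_{\mathfrak C}(p)$ be the set of $x$ with $\lim_{t\to0}\xi'(t)x=p$ for a cocharacter $\xi'\in\mathfrak{C}$, let $\preceq_{\mathfrak{C}}$ be the order on $X^H$ generated by $p\preceq p'$ if $p\in\overline{\mathrm{Attr}_{\mathfrak{C}}(p')}$, and let $N_{p,-}\subset T_pX$ be the sum of the weight spaces whose $H$-weight is negative on $\mathfrak{C}$. **The dual $X^!$.** Let $X^!$ be the manifold obtained in the same way from the dual sequence $1\to H^\vee\to T^\vee\to S^\vee\to1$ (so the roles of $\mathfrak a$ and $\mathfrak b$ are exchanged, and $H^!=S^\vee$) with GIT parameter $\xi\in\mathbb{X}^*(H^\vee)=\mathbb{X}_*(H)$, with the chamber $\mathfrak{C}^!$ containing $\eta$, the Kähler roots $\Psi^!(p^!_I)=\{\pm\alpha^I_i\}_{i\in I}$, and the lift $\mathfrak{L}^!(m)=\mathcal{L}^!(\iota^!(m))$, where $\iota^!:\mathbb{X}_*(H)\to\mathbb{X}_*(T)$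 is a splitting of $\mathfrak a$ with $\langle\iota(l),\iota^!(m)\rangle=0$ for all $l,m$. Here $p^!_I$ is the fixed point of $X^!$ in the chart indexed by $I^c$. **Proposition.** The two sets of data form a dual pair. That is, the actions are algebraic with finitely many $H$- (resp. $H^!$-) fixed points, $\mathfrak{C}$ and $\mathfrak{C}^!$ are chambers, $\mathfrak{L}$ and $\mathfrak{L}^!$ are sections of the homomorphisms forgetting the equivariant structure, and with the bijection $p_I\mapsto p_I^!$ and the natural identifications $\mathbb{X}_*(H)\cong\mathrm{Pic}(X^!)=:P^!$, $P\cong\mathbb{X}_*(H^!)$: 1. (order reversal) $p\preceq_{\mathfrak{C}}q$ if and only if $q^!\preceq_{\mathfrak{C}^!}p^!$, for all $p,q\in X^H$; 2. $\mathfrak{C}=\mathfrak{A}^!$, $\mathfrak{A}=\mathfrak{C}^!$, and $\Phi(p)=\Psi^!(p^!)$, $\Psi(p)=\Phi^!(p^!)$ as multisets for all $p\in X^H$; 3. for all $l\in P$, $m\in P^!$, $p\in X^H$: $$\langle\mathrm{wt}_H i_p^*\mathfrak{L}(l),m\rangle=-\langle\mathrm{wt}_{H^!}i_{p^!}^*\mathfrak{L}^!(m),l\rangle,$$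 $$\mathrm{wt}_{\mathbb{S}}i_p^*\mathfrak{L}(l)=-\langle\mathrm{wt}_{H^!}\det N^!_{p^!,-},l\rangle,\qquad \mathrm{wt}_{\mathbb{S}}i_{p^!}^*\mathfrak{L}^!(m)=-\langle\mathrm{wt}_H\det N_{p,-},m\rangle;$$ 4. for all $p\in X^H$: $\ \mathrm{wt}_{\mathbb{S}}\det N_{p,-}+\tfrac12\dim X=-\bigl(\mathrm{wt}_{\mathbb{S}}\det N^!_{p^!,-}+\tfrac12\dim X^!\bigr)$. -/

import Mathlib

open Topology Filter

open scoped Matrix TensorProduct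

noncomputable section

namespace ToricDual

/-! ## Algebraic tori and their characters -/

/-- The algebraic torus `(ℂˣ)^e`.  Its cocharacter lattice and its character lattice are both
written as `Fin e → ℤ`, the pairing between them being the dot product. -/
abbrev Torus (e : ℕ) : Type := Fin e → ℂˣ

/-- The torus `H × 𝕊` with `H = (ℂˣ)^e` and `𝕊 = ℂˣ`. -/
abbrev BigTorus (e : ℕ) : Type := Torus e × ℂˣ

/-- The homomorphism of tori given by an integer matrix (acting on cocharacters). -/
def torusHom {k m : ℕ} (M : Matrix (Fin m) (Fin k) ℤ) : Torus k →* Torus m where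
  toFun u := fun i => ∏ j, u j ^ M i j
  map_one' := by ext; simp
  map_mul' u v := by
    funext i
    simp [mul_zpow, Finset.prod_mul_distrib]

/-- The character of `(ℂˣ)^e` with weight `w`. -/
def torusChar {e : ℕ} (w : Fin e → ℤ) (h : Torus e) : ℂˣ := ∏ i, h i ^ w i

/-- The character of `H × 𝕊` with weight `(w.1, w.2)`. -/
def bigChar {e : ℕ} (w : (Fin e → ℤ) × ℤ) (t : BigTorus e) : ℂˣ := torusChar w.1 t.1 * t.2 ^ w.2

/-- The one-parameter subgroup of `(ℂˣ)^e` given by a cocharacter. -/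
def oneParam {e : ℕ} (ξ : Fin e → ℤ) (s : ℂˣ) : Torus e := fun i => s ^ ξ i

/-! ## Spaces with functions -/

/-- A space with functions over `ℂ`: a (Zariski) topological space together with, at each point,
the functions that are regular in a neighbourhood of the point.  Only the germ of a function at the
point matters.  A complex algebraic variety is such a space: its closed points with the Zariski
topology and the regular functions. -/
class SpaceWithFunctions (X : Type) extends TopologicalSpace X where
  RegularAt : (X → ℂ) → X → Prop
  regularAt_const : ∀ (c : ℂ) (x : X), RegularAt (fun _ => c) x
  regularAt_add : ∀ (f g : X → ℂ) (x : X), RegularAt f x → RegularAt g x →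
    RegularAt (fun y => f y + g y) x
  regularAt_mul : ∀ (f g : X → ℂ) (x : X), RegularAt f x → RegularAt g x →
    RegularAt (fun y => f y * g y) x
  regularAt_inv : ∀ (f : X → ℂ) (x : X), RegularAt f x → f x ≠ 0 → RegularAt (fun y => (f y)⁻¹) x
  regularAt_congr : ∀ (f g : X → ℂ) (x : X), RegularAt f x → (∀ᶠ y in 𝓝 x, f y = g y) →
    RegularAt g x
  regularAt_eventually : ∀ (f : X → ℂ) (x : X), RegularAt f x → ∀ᶠ y in 𝓝 x, RegularAt f y
  regularAt_ne_zero : ∀ (f : X → ℂ) (x : X), RegularAt f x → f x ≠ 0 → ∀ᶠ y in 𝓝 x, f y ≠ 0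

open SpaceWithFunctions

/-- A space with functions on which the torus `H × 𝕊`, `H = (ℂˣ)^e`, acts by automorphisms. -/
class TorusSpace (e : ℕ) (X : Type) [SpaceWithFunctions X] extends MulAction (BigTorus e) X where
  regularAt_smul : ∀ (f : X → ℂ) (t : BigTorus e) (x : X), RegularAt f (t • x) →
    RegularAt (fun y => f (t • y)) x

section General

variable (e : ℕ) (X : Type) [SpaceWithFunctions X]

/-- A nowhere vanishing function that is regular, with its inverse, near `x`. -/
def UnitRegularAt {X : Type} [SpaceWithFunctions X] (φ : X → ℂˣ) (x : X) : Prop :=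
  RegularAt (fun y => (φ y : ℂ)) x

theorem UnitRegularAt.one {X : Type} [SpaceWithFunctions X] (x : X) :
    UnitRegularAt (1 : X → ℂˣ) x := regularAt_const 1 x

theorem UnitRegularAt.mul {X : Type} [SpaceWithFunctions X] {φ ψ : X → ℂˣ} {x : X}
    (h : UnitRegularAt φ x) (h₂ : UnitRegularAt ψ x) : UnitRegularAt (φ * ψ) x := by
  simpa [UnitRegularAt] using regularAt_mul _ _ x h h₂

theorem UnitRegularAt.inv {X : Type} [SpaceWithFunctions X] {φ : X → ℂˣ} {x : X}
    (h : UnitRegularAt φ x) : UnitRegularAt φ⁻¹ x := by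
  simpa [UnitRegularAt] using regularAt_inv _ x h (φ x).ne_zero

/-! ### Line bundles

Choosing a basis in each fibre (with no regularity requirement), a line bundle on `X` has fibre `ℂ`
over every point, and is given by its local frames: `f x` is a frame near `x`, and any two frames
differ by an invertible regular function where both are frames.  A regular section near `y` is a
function whose quotient by `f y` is regular at `y`.  An isomorphism of line bundles is a family
`φ : X → ℂˣ` of isomorphisms of the fibres that turns frames into frames; the tensor product
multiplies frames.  So the line bundles form a group, and `Pic X` is its quotient by the subgroup of
line bundles isomorphic to the trivial one. -/

/-- The group of line bundles on `X`, each given by its local frames. -/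
def lineBundles : Subgroup (X → X → ℂˣ) where
  carrier := {f | ∀ x, ∀ᶠ y in 𝓝 x, UnitRegularAt (f x / f y) y}
  one_mem' := fun x => Eventually.of_forall fun y => by
    simpa using UnitRegularAt.one y
  mul_mem' := by
    intro f g hf hg x
    filter_upwards [hf x, hg x] with y h₁ h₂
    have := h₁.mul h₂
    rwa [div_mul_div_comm] at this
  inv_mem' := by
    intro f hf x
    filter_upwards [hf x] with y h₁
    have := h₁.inv
    rw [inv_div, ← inv_div_inv] at this
    exact this

/-- The line bundles isomorphic to the trivial line bundle. -/
def trivialBundles : Subgroup (lineBundles X) where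
  carrier := {f | ∃ φ : X → ℂˣ, ∀ x, UnitRegularAt (φ / f.1 x) x}
  one_mem' := ⟨1, fun x => by simpa using UnitRegularAt.one x⟩
  mul_mem' := by
    rintro f g ⟨φ, hφ⟩ ⟨ψ, hψ⟩
    refine ⟨φ * ψ, fun x => ?_⟩
    have := (hφ x).mul (hψ x)
    rwa [div_mul_div_comm] at this
  inv_mem' := by
    rintro f ⟨φ, hφ⟩
    refine ⟨φ⁻¹, fun x => ?_⟩
    have := (hφ x).inv
    rw [inv_div, ← inv_div_inv] at this
    exact this

/-- The Picard group of `X`: isomorphism classes of line bundles under the tensor product. -/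
def Pic : Type := Additive (lineBundles X ⧸ trivialBundles X)

instance : AddCommGroup (Pic X) :=
  inferInstanceAs (AddCommGroup (Additive (lineBundles X ⧸ trivialBundles X)))

/-- The class in `Pic X` of a line bundle. -/
def picMk {X : Type} [SpaceWithFunctions X] (L : lineBundles X) : Pic X :=
  Additive.ofMul (QuotientGroup.mk L)

/-- A global regular section of the `m`-th tensor power of a line bundle. -/
def IsGlobalSection {X : Type} [SpaceWithFunctions X] (L : lineBundles X) (m : ℕ) (g : X → ℂ) :
    Prop := ∀ x, RegularAt (fun y => g y / (L.1 x y : ℂ) ^ m) x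

/-- A line bundle `L` is ample if the sets `X_g = {g ≠ 0}`, for the global sections `g` of the
positive tensor powers of `L`, form a base of the topology of `X`. -/
def IsAmpleBundle {X : Type} [SpaceWithFunctions X] (L : lineBundles X) : Prop :=
  ∀ (U : Set X) (x : X), IsOpen U → x ∈ U →
    ∃ m : ℕ, 0 < m ∧ ∃ g : X → ℂ, IsGlobalSection L m g ∧ g x ≠ 0 ∧ ∀ y, g y ≠ 0 → y ∈ U

/-- The ample cone in `Pic(X) ⊗ ℝ`: the convex cone generated by the classes of ample bundles. -/
def ampleCone : Set (ℝ ⊗[ℤ] Pic X) :=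
  ConvexCone.hull ℝ {v | ∃ L : lineBundles X, IsAmpleBundle L ∧ v = (1 : ℝ) ⊗ₜ[ℤ] picMk L}

/-! ### Tangent spaces -/

/-- The algebra of the functions that are regular near `p`. -/
def regularAlg {X : Type} [SpaceWithFunctions X] (p : X) : Subalgebra ℂ (X → ℂ) where
  carrier := {f | RegularAt f p}
  mul_mem' := fun {f g} hf hg => regularAt_mul f g p hf hg
  add_mem' := fun {f g} hf hg => regularAt_add f g p hf hg
  algebraMap_mem' := fun c => regularAt_const c p

/-- The tangent space at `p`: the point derivations at `p` of the regular functions near `p`.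
(Such a derivation only depends on the germ of the function at `p`.) -/
def tangentSpace {X : Type} [SpaceWithFunctions X] (p : X) :
    Submodule ℂ (regularAlg p →ₗ[ℂ] ℂ) where
  carrier := {D | ∀ f g : regularAlg p, D (f * g) = f.1 p * D g + g.1 p * D f}
  zero_mem' := by intro f g; simp
  add_mem' := by
    intro D E hD hE f g
    simp only [LinearMap.add_apply, hD f g, hE f g]; ring
  smul_mem' := by
    intro c D hD f g
    simp only [LinearMap.smul_apply, hD f g, smul_eq_mul]; ring

variable [TorusSpace e X]

/-- The set `X^H` of the points that are fixed by `H`. -/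
abbrev FixedPts : Type := {x : X // ∀ h : Torus e, ((h, 1) : BigTorus e) • x = x}

/-- The weight space of weight `α` for the action of `H` on the tangent space at `p`.  A group
element `t` fixing `p` sends a tangent vector `D` to `f ↦ D (f ∘ t)`. -/
def rootSpace {X : Type} [SpaceWithFunctions X] [TorusSpace e X] (p : X) (α : Fin e → ℤ) :
    Submodule ℂ (regularAlg p →ₗ[ℂ] ℂ) where
  carrier := {D | D ∈ tangentSpace p ∧ ∀ (h : Torus e) (f g : regularAlg p),
    (∀ y, g.1 y = f.1 (((h, 1) : BigTorus e) • y)) → D g = (torusChar α h : ℂ) * D f}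
  zero_mem' := ⟨zero_mem _, by intros; simp⟩
  add_mem' := by
    rintro D E ⟨hD, hD₂⟩ ⟨hE, hE₂⟩
    refine ⟨add_mem hD hE, fun h f g hfg => ?_⟩
    simp only [LinearMap.add_apply, hD₂ h f g hfg, hE₂ h f g hfg]; ring
  smul_mem' := by
    rintro c D ⟨hD, hD₂⟩
    refine ⟨Submodule.smul_mem _ _ hD, fun h f g hfg => ?_⟩
    simp only [LinearMap.smul_apply, hD₂ h f g hfg, smul_eq_mul]; ring

/-- The weight space of weight `w` for the action of `H × 𝕊` on the tangent space at `p`. -/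
def bigWeightSpace {X : Type} [SpaceWithFunctions X] [TorusSpace e X] (p : X)
    (w : (Fin e → ℤ) × ℤ) : Submodule ℂ (regularAlg p →ₗ[ℂ] ℂ) where
  carrier := {D | D ∈ tangentSpace p ∧ ∀ (t : BigTorus e) (f g : regularAlg p),
    (∀ y, g.1 y = f.1 (t • y)) → D g = (bigChar w t : ℂ) * D f}
  zero_mem' := ⟨zero_mem _, by intros; simp⟩
  add_mem' := by
    rintro D E ⟨hD, hD₂⟩ ⟨hE, hE₂⟩
    refine ⟨add_mem hD hE, fun h f g hfg => ?_⟩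
    simp only [LinearMap.add_apply, hD₂ h f g hfg, hE₂ h f g hfg]; ring
  smul_mem' := by
    rintro c D ⟨hD, hD₂⟩
    refine ⟨Submodule.smul_mem _ _ hD, fun h f g hfg => ?_⟩
    simp only [LinearMap.smul_apply, hD₂ h f g hfg, smul_eq_mul]; ring

/-- The multiplicity of `α` in the multiset `Φ(p)` of the `H`-weights of the tangent space. -/
def rootMult {X : Type} [SpaceWithFunctions X] [TorusSpace e X] (p : X) (α : Fin e → ℤ) : ℕ :=
  Module.finrank ℂ (rootSpace e p α)

/-- The set of all equivariant roots. -/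
def equivariantRoots : Set (Fin e → ℤ) := {α | ∃ p : FixedPts e X, rootMult e p.1 α ≠ 0}

/-- The pairing of a point of `𝔥_ℝ` with an integral weight. -/
def realPairing {e : ℕ} (x : Fin e → ℝ) (α : Fin e → ℤ) : ℝ := ∑ i, x i * (α i : ℝ)

/-- A cocharacter as a point of `𝔥_ℝ`. -/
def realPt {e : ℕ} (ξ : Fin e → ℤ) : Fin e → ℝ := fun i => (ξ i : ℝ)

/-- The complement in `𝔥_ℝ` of the hyperplanes defined by the equivariant roots. -/
def rootComplement : Set (Fin e → ℝ) := {x | ∀ α ∈ equivariantRoots e X, realPairing x α ≠ 0}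

/-- A chamber: a connected component of the complement of the root hyperplanes. -/
def IsChamber (C : Set (Fin e → ℝ)) : Prop :=
  ∃ x ∈ rootComplement e X, C = connectedComponentIn (rootComplement e X) x

variable {X}

/-- The attracting set of `p`: the points `x` with `lim_{s → 0} ξ(s) • x = p` for a one-parameter
subgroup `ξ` in the chamber `C`.  The limit is taken in the analytic topology, whose neighbourhoods
of `p` are described by the functions that are regular near `p`. -/
def attr (C : Set (Fin e → ℝ)) (p : X) : Set X :=
  {x | ∃ ξ : Fin e → ℤ, realPt ξ ∈ C ∧ ∀ f : X → ℂ, RegularAt f p →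
    Tendsto (fun s : ℂˣ => f (((oneParam ξ s, 1) : BigTorus e) • x))
      (comap (fun s : ℂˣ => (s : ℂ)) (𝓝 0)) (𝓝 (f p))}

/-- The order `p ≼ p₂` on the fixed points, generated by `p ∈ closure (attr p₂)`. -/
def fixedLE (C : Set (Fin e → ℝ)) : FixedPts e X → FixedPts e X → Prop :=
  Relation.ReflTransGen fun p p₂ => p.1 ∈ closure (attr e C p₂.1)

open Classical in
/-- The weight of `H × 𝕊` on `det N_{p,-}`, where `N_{p,-}` is the repelling part of the tangent
space at `p`: the sum of the weights of the tangent space that are negative on `C`, counted with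
multiplicity. -/
def wtDetNeg (C : Set (Fin e → ℝ)) (p : X) : (Fin e → ℤ) × ℤ :=
  ∑ᶠ w : (Fin e → ℤ) × ℤ, if ∀ x ∈ C, realPairing x w.1 < 0 then
    Module.finrank ℂ (bigWeightSpace e p w) • w else 0

/-- The dimension of (the smooth variety) `X` at `p`. -/
def dimAt {X : Type} [SpaceWithFunctions X] (p : X) : ℕ := Module.finrank ℂ (tangentSpace p)

/-! ### Equivariant line bundles -/

variable (X)

/-- Products and sums of characters of `H × 𝕊` and of functions on `X` regular near `x₀`, i.e. the
functions on `(H × 𝕊) × X` given by `ℂ[H × 𝕊] ⊗ (regular functions near x₀)`. -/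
def productAlg {X : Type} [SpaceWithFunctions X] (x₀ : X) : Subalgebra ℂ (BigTorus e → X → ℂ) :=
  Algebra.adjoin ℂ ({F | ∃ w, F = fun t _ => (bigChar w t : ℂ)} ∪
    {F | ∃ f, RegularAt f x₀ ∧ F = fun _ x => f x})

/-- The function `F` on the product variety `(H × 𝕊) × X` is regular near `(t₀, x₀)`. -/
def JointlyRegularAt {X : Type} [SpaceWithFunctions X] (F : BigTorus e → X → ℂ)
    (t₀ : BigTorus e) (x₀ : X) : Prop :=
  ∃ A ∈ productAlg e x₀, ∃ B ∈ productAlg e x₀, B t₀ x₀ ≠ 0 ∧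
    ∀ᶠ x in 𝓝 x₀, ∀ t, B t x ≠ 0 → F t x = A t x / B t x

theorem JointlyRegularAt.one {X : Type} [SpaceWithFunctions X] (t₀ : BigTorus e) (x₀ : X) :
    JointlyRegularAt e (fun _ _ => (1 : ℂ)) t₀ x₀ :=
  ⟨1, one_mem _, 1, one_mem _, by simp, Eventually.of_forall fun _ _ _ => by simp⟩

theorem JointlyRegularAt.mul {X : Type} [SpaceWithFunctions X] {F G : BigTorus e → X → ℂ}
    {t₀ : BigTorus e} {x₀ : X} (hF : JointlyRegularAt e F t₀ x₀)
    (hG : JointlyRegularAt e G t₀ x₀) :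
    JointlyRegularAt e (fun t x => F t x * G t x) t₀ x₀ := by
  obtain ⟨A, hA, B, hB, h0, h⟩ := hF
  obtain ⟨A₂, hA₂, B₂, hB₂, h0₂, h₂⟩ := hG
  refine ⟨A * A₂, mul_mem hA hA₂, B * B₂, mul_mem hB hB₂, mul_ne_zero h0 h0₂, ?_⟩
  filter_upwards [h, h₂] with x hx hx₂ t ht
  have ht₂ : B t x * B₂ t x ≠ 0 := ht
  rw [hx t (left_ne_zero_of_mul ht₂), hx₂ t (right_ne_zero_of_mul ht₂), div_mul_div_comm]
  rfl

theorem JointlyRegularAt.inv {X : Type} [SpaceWithFunctions X] {F : BigTorus e → X → ℂ}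
    {t₀ : BigTorus e} {x₀ : X} (hF : JointlyRegularAt e F t₀ x₀) (h0F : F t₀ x₀ ≠ 0) :
    JointlyRegularAt e (fun t x => (F t x)⁻¹) t₀ x₀ := by
  obtain ⟨A, hA, B, hB, h0, h⟩ := hF
  have hA0 : A t₀ x₀ ≠ 0 := by
    intro hz
    exact h0F (by rw [h.self_of_nhds t₀ h0, hz, zero_div])
  refine ⟨B * B, mul_mem hB hB, A * B, mul_mem hA hB, mul_ne_zero hA0 h0, ?_⟩
  filter_upwards [h] with x hx t ht
  have ht₂ : A t x * B t x ≠ 0 := ht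
  have h1 := left_ne_zero_of_mul ht₂
  have h2 := right_ne_zero_of_mul ht₂
  rw [hx t h2]
  change (A t x / B t x)⁻¹ = (B t x * B t x) / (A t x * B t x)
  field_simp

/-- The group of `H × 𝕊`-equivariant line bundles: a line bundle `f` together with an action, where
`c t x` is the linear map from the fibre over `x` to the fibre over `t • x`.  In local frames it has
to be a regular function on `(H × 𝕊) × X`. -/
def eqLineBundles : Subgroup ((X → X → ℂˣ) × (BigTorus e → X → ℂˣ)) where
  carrier := {E | E.1 ∈ lineBundles X ∧
    (∀ s t x, E.2 (s * t) x = E.2 s (t • x) * E.2 t x) ∧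
    ∀ t₀ x₀, JointlyRegularAt e
      (fun t x => ((E.2 t x * E.1 x₀ x / E.1 (t₀ • x₀) (t • x) : ℂˣ) : ℂ)) t₀ x₀}
  one_mem' := ⟨one_mem _, fun _ _ _ => by simp, fun t₀ x₀ => by
    simpa using JointlyRegularAt.one e t₀ x₀⟩
  mul_mem' := by
    rintro E F ⟨hE₁, hE₂, hE₃⟩ ⟨hF₁, hF₂, hF₃⟩
    refine ⟨mul_mem hE₁ hF₁, fun s t x => ?_, fun t₀ x₀ => ?_⟩
    · simp only [Prod.snd_mul, Pi.mul_apply, hE₂ s t x, hF₂ s t x]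
      exact mul_mul_mul_comm _ _ _ _
    · have := (hE₃ t₀ x₀).mul e (hF₃ t₀ x₀)
      convert this using 3 with t x
      rw [← Units.val_mul]
      congr 1
      simp only [Prod.fst_mul, Prod.snd_mul, Pi.mul_apply]
      rw [div_mul_div_comm, mul_mul_mul_comm]
  inv_mem' := by
    rintro E ⟨hE₁, hE₂, hE₃⟩
    refine ⟨inv_mem hE₁, fun s t x => ?_, fun t₀ x₀ => ?_⟩
    · simp only [Prod.snd_inv, Pi.inv_apply, hE₂ s t x]
      exact mul_inv _ _
    · have := (hE₃ t₀ x₀).inv e (Units.ne_zero _)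
      convert this using 3 with t x
      rw [← Units.val_inv_eq_inv_val]
      congr 1
      simp only [Prod.fst_inv, Prod.snd_inv, Pi.inv_apply]
      rw [div_eq_mul_inv, div_eq_mul_inv, mul_inv, mul_inv]

/-- The equivariant line bundles that are equivariantly isomorphic to the trivial one. -/
def eqTrivialBundles : Subgroup (eqLineBundles e X) where
  carrier := {E | ∃ φ : X → ℂˣ, (∀ x, UnitRegularAt (φ / E.1.1 x) x) ∧
    ∀ t x, E.1.2 t x = φ (t • x) / φ x}
  one_mem' := ⟨1, fun x => by simpa using UnitRegularAt.one x, fun t x => by simp⟩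
  mul_mem' := by
    rintro f g ⟨φ, hφ, hφ₂⟩ ⟨ψ, hψ, hψ₂⟩
    refine ⟨φ * ψ, fun x => ?_, fun t x => ?_⟩
    · have := (hφ x).mul (hψ x)
      rwa [div_mul_div_comm] at this
    · change f.1.2 t x * g.1.2 t x = (φ (t • x) * ψ (t • x)) / (φ x * ψ x)
      rw [hφ₂, hψ₂, div_mul_div_comm]
  inv_mem' := by
    rintro f ⟨φ, hφ, hφ₂⟩
    refine ⟨φ⁻¹, fun x => ?_, fun t x => ?_⟩
    · have := (hφ x).inv
      rw [inv_div, ← inv_div_inv] at this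
      exact this
    · change (f.1.2 t x)⁻¹ = (φ (t • x))⁻¹ / (φ x)⁻¹
      rw [hφ₂, inv_div, inv_div_inv]

/-- The equivariant Picard group of `X` with respect to `H × 𝕊`. -/
def EqPic : Type := Additive (eqLineBundles e X ⧸ eqTrivialBundles e X)

instance : AddCommGroup (EqPic e X) :=
  inferInstanceAs (AddCommGroup (Additive (eqLineBundles e X ⧸ eqTrivialBundles e X)))

variable {X}

/-- The class in `EqPic` of an equivariant line bundle. -/
def eqPicMk (E : eqLineBundles e X) : EqPic e X := Additive.ofMul (QuotientGroup.mk E)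

/-- The line bundle that underlies an equivariant line bundle. -/
def underlying : eqLineBundles e X →* lineBundles X where
  toFun E := ⟨E.1.1, E.2.1⟩
  map_one' := rfl
  map_mul' _ _ := rfl

/-- The natural homomorphism that forgets the equivariant structure. -/
def forget : EqPic e X →+ Pic X :=
  MonoidHom.toAdditive (QuotientGroup.map (eqTrivialBundles e X) (trivialBundles X)
    (underlying e) (by rintro E ⟨φ, hφ, -⟩; exact ⟨φ, hφ⟩))

/-- `H × 𝕊` acts by the character of weight `w` on the fibre at `p` of the class `l`. -/
def HasFibreWeight (l : EqPic e X) (p : X) (w : (Fin e → ℤ) × ℤ) : Prop :=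
  ∃ E : eqLineBundles e X, eqPicMk e E = l ∧ ∀ t, E.1.2 t p = bigChar w t

/-- The weight `(wt_H, wt_𝕊)` of `H × 𝕊` on the fibre at a fixed point `p` of the class `l`. -/
def fibreWt (l : EqPic e X) (p : X) : (Fin e → ℤ) × ℤ :=
  Classical.epsilon (HasFibreWeight e l p)

variable (X)

/-- The action of `H × 𝕊` on `X` is algebraic. -/
def IsAlgebraicAction : Prop :=
  ∀ (f : X → ℂ) (t₀ : BigTorus e) (x₀ : X), RegularAt f (t₀ • x₀) →
    JointlyRegularAt e (fun t x => f (t • x)) t₀ x₀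

/-! ### Dual pairs -/

/-- The additional data on `X`: a chamber `C`, a multiset `Ψ p` of Kähler roots in the dual of the
Picard group for each fixed point `p`, and a lift `lift` of line bundles to equivariant ones.  (The
ample cone and the equivariant roots are determined by `X`.) -/
structure DualityData where
  C : Set (Fin e → ℝ)
  Ψ : FixedPts e X → Multiset (Pic X →+ ℤ)
  lift : Pic X →+ EqPic e X

/-- The conditions on the additional data: the action is algebraic with finitely many `H`-fixed
points, `C` is a chamber, and `lift` is a section of the forgetful homomorphism. -/
structure DualityData.IsAdmissible {e : ℕ} {X : Type} [SpaceWithFunctions X] [TorusSpace e X]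
    (D : DualityData e X) : Prop where
  algebraic : IsAlgebraicAction e X
  finite : Finite (FixedPts e X)
  chamber : IsChamber e X D.C
  isSection : ∀ l, forget e (D.lift l) = l

end General

/-- The real extension `ℝ^e → P ⊗ ℝ` of a homomorphism `ℤ^e → P`. -/
def realExt {e : ℕ} {P : Type} [AddCommGroup P] (κ : (Fin e → ℤ) →+ P) (x : Fin e → ℝ) :
    ℝ ⊗[ℤ] P := ∑ i, x i ⊗ₜ[ℤ] κ (Pi.single i 1)

/-- The data on `X` and `Y` form a dual pair by way of the bijection `σ` of the fixed points and the
identifications `κ : 𝕏_*(H) ≅ Pic Y` and `κ₂ : 𝕏_*(H_Y) ≅ Pic X`. -/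
structure IsDualPair {e e₂ : ℕ} {X Y : Type} [SpaceWithFunctions X] [TorusSpace e X]
    [SpaceWithFunctions Y] [TorusSpace e₂ Y] (D : DualityData e X) (D₂ : DualityData e₂ Y)
    (σ : FixedPts e X ≃ FixedPts e₂ Y) (κ : (Fin e → ℤ) ≃+ Pic Y) (κ₂ : (Fin e₂ → ℤ) ≃+ Pic X) :
    Prop where
  admissible : D.IsAdmissible
  admissible_dual : D₂.IsAdmissible
  /-- The bijection is order reversing. -/
  order_reversing : ∀ p q, fixedLE e D.C p q ↔ fixedLE e₂ D₂.C (σ q) (σ p)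
  /-- Chambers and ample cones are exchanged. -/
  chamber_eq : ∀ x, x ∈ D.C ↔ realExt κ.toAddMonoidHom x ∈ ampleCone Y
  chamber_eq_dual : ∀ x, x ∈ D₂.C ↔ realExt κ₂.toAddMonoidHom x ∈ ampleCone X
  /-- Equivariant roots and Kähler roots are exchanged, as multisets. -/
  roots_eq : ∀ p (θ : Pic Y →+ ℤ),
    rootMult e p.1 (fun i => θ (κ (Pi.single i 1))) = @Multiset.count _ (Classical.decEq _) θ
      (D₂.Ψ (σ p))
  roots_eq_dual : ∀ p (θ : Pic X →+ ℤ),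
    rootMult e₂ (σ p).1 (fun i => θ (κ₂ (Pi.single i 1))) = @Multiset.count _ (Classical.decEq _) θ
      (D.Ψ p)
  /-- The `H`-weights of the lifts. -/
  wt_H : ∀ p (l : Pic X) (m : Pic Y),
    (fibreWt e (D.lift l) p.1).1 ⬝ᵥ κ.symm m =
      -((fibreWt e₂ (D₂.lift m) (σ p).1).1 ⬝ᵥ κ₂.symm l)
  /-- The `𝕊`-weights of the lifts. -/
  wt_S : ∀ p (l : Pic X),
    (fibreWt e (D.lift l) p.1).2 = -((wtDetNeg e₂ D₂.C (σ p).1).1 ⬝ᵥ κ₂.symm l)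
  wt_S_dual : ∀ p (m : Pic Y),
    (fibreWt e₂ (D₂.lift m) (σ p).1).2 = -((wtDetNeg e D.C p.1).1 ⬝ᵥ κ.symm m)
  /-- The `𝕊`-weights of the repelling parts. -/
  wt_S_det : ∀ p,
    ((wtDetNeg e D.C p.1).2 : ℚ) + (dimAt p.1 : ℚ) / 2 =
      -(((wtDetNeg e₂ D₂.C (σ p).1).2 : ℚ) + (dimAt (σ p).1 : ℚ) / 2)

/-! ## Toric hyper-Kähler manifolds -/

/-- A short exact sequence of tori `1 → S → T → H → 1` with `S = (ℂˣ)^r`, `T = (ℂˣ)^n`,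
`H = (ℂˣ)^d`, given by the exact sequence `0 → ℤ^r → ℤ^n → ℤ^d → 0` of cocharacter lattices with
maps `bᵀ` and `a`.  So `b` is the map `𝕏^*(T) → 𝕏^*(S)` of character lattices. -/
structure TorusSequence (n r d : ℕ) where
  a : Matrix (Fin d) (Fin n) ℤ
  b : Matrix (Fin r) (Fin n) ℤ
  injective : Function.Injective fun y : Fin r → ℤ => bᵀ *ᵥ y
  exact : ∀ x : Fin n → ℤ, a *ᵥ x = 0 ↔ ∃ y : Fin r → ℤ, bᵀ *ᵥ y = x
  surjective : Function.Surjective fun x : Fin n → ℤ => a *ᵥ x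

namespace TorusSequence

variable {n r d : ℕ} (τ : TorusSequence n r d)

theorem exists_section : ∃ σ : Matrix (Fin n) (Fin d) ℤ, τ.a * σ = 1 := by
  choose g hg using τ.surjective
  refine ⟨Matrix.of fun i k => g (Pi.single k 1) i, ?_⟩
  ext k l
  have := congrFun (hg (Pi.single l 1)) k
  simp only [Matrix.mulVec, dotProduct] at this
  rw [Matrix.mul_apply, Matrix.one_apply, Pi.single_apply] at *
  simpa [Matrix.of_apply] using this

/-- A section of `a`. -/
def sec : Matrix (Fin n) (Fin d) ℤ := τ.exists_section.choose

theorem a_mul_sec : τ.a * τ.sec = 1 := τ.exists_section.choose_spec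

theorem exists_retraction : ∃ R : Matrix (Fin r) (Fin n) ℤ, τ.sec * τ.a + τ.bᵀ * R = 1 := by
  have h : ∀ x : Fin n → ℤ, ∃ y : Fin r → ℤ, τ.bᵀ *ᵥ y = x - (τ.sec * τ.a) *ᵥ x := by
    intro x
    rw [← τ.exact, Matrix.mulVec_sub, Matrix.mulVec_mulVec, ← Matrix.mul_assoc, τ.a_mul_sec,
      Matrix.one_mul, sub_self]
  choose g hg using h
  refine ⟨Matrix.of fun k i => g (Pi.single i 1) k, ?_⟩
  ext i j
  have := congrFun (hg (Pi.single j 1)) i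
  rw [Matrix.mulVec_single_one, Pi.sub_apply, Pi.single_apply] at this
  rw [Matrix.add_apply, Matrix.mul_apply (M := τ.bᵀ), Matrix.one_apply]
  simp only [Matrix.mulVec, dotProduct] at this
  simp only [Matrix.of_apply, this, Matrix.col_apply]
  ring

/-- A retraction of `bᵀ`, compatible with the section of `a`. -/
def ret : Matrix (Fin r) (Fin n) ℤ := τ.exists_retraction.choose

theorem sec_mul_a_add : τ.sec * τ.a + τ.bᵀ * τ.ret = 1 := τ.exists_retraction.choose_spec

theorem a_mul_b : τ.a * τ.bᵀ = 0 := by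
  ext k l
  have := congrFun ((τ.exact (τ.bᵀ *ᵥ Pi.single l 1)).2 ⟨_, rfl⟩) k
  rw [Matrix.mulVec_mulVec, Matrix.mulVec_single_one] at this
  simpa using this

theorem ret_mul_b : τ.ret * τ.bᵀ = 1 := by
  have h : τ.bᵀ * (τ.ret * τ.bᵀ) = τ.bᵀ := by
    have := congrArg (· * τ.bᵀ) τ.sec_mul_a_add
    simpa [Matrix.add_mul, Matrix.mul_assoc, τ.a_mul_b] using this
  ext k l
  have h2 := @τ.injective ((τ.ret * τ.bᵀ) *ᵥ Pi.single l 1) (Pi.single l 1) (by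
    simp only [Matrix.mulVec_mulVec, h])
  have := congrFun h2 k
  rw [Matrix.mulVec_single_one] at this
  simpa [Matrix.one_apply, Pi.single_apply] using this

/-- The dual exact sequence of tori `1 → H^∨ → T^∨ → S^∨ → 1`.  Its cocharacter lattices are the
character lattices of the given sequence, so that the roles of `a` and `b` are exchanged. -/
def dual : TorusSequence n d r where
  a := τ.b
  b := τ.a
  injective := by
    have h : τ.secᵀ * τ.aᵀ = 1 := by rw [← Matrix.transpose_mul, τ.a_mul_sec, Matrix.transpose_one]
    intro x y hxy
    have := congrArg (τ.secᵀ *ᵥ ·) hxy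
    simpa [Matrix.mulVec_mulVec, h] using this
  exact := by
    intro x
    constructor
    · intro hx
      refine ⟨τ.secᵀ *ᵥ x, ?_⟩
      have h := congrArg Matrix.transpose τ.sec_mul_a_add
      rw [Matrix.transpose_add, Matrix.transpose_mul, Matrix.transpose_mul, Matrix.transpose_one,
        Matrix.transpose_transpose] at h
      have h2 := congrArg (· *ᵥ x) h
      simpa [Matrix.add_mulVec, ← Matrix.mulVec_mulVec, hx] using h2
    · rintro ⟨y, rfl⟩
      have h := congrArg Matrix.transpose τ.a_mul_b
      rw [Matrix.transpose_mul, Matrix.transpose_transpose, Matrix.transpose_zero] at h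
      simp [Matrix.mulVec_mulVec, h]
  surjective := by
    have h := congrArg Matrix.transpose τ.ret_mul_b
    rw [Matrix.transpose_mul, Matrix.transpose_transpose, Matrix.transpose_one] at h
    intro y
    exact ⟨τ.retᵀ *ᵥ y, by simp [Matrix.mulVec_mulVec, h]⟩

/-- The cocharacter `a_i` of `H`. -/
def aVec (i : Fin n) : Fin d → ℤ := fun k => τ.a k i

/-- The character `b_i` of `S`. -/
def bVec (i : Fin n) : Fin r → ℤ := fun k => τ.b k i

/-- `d` linearly independent vectors among the `a_i` always generate the lattice. -/
def IsUnimodular : Prop :=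
  ∀ I : Finset (Fin n), LinearIndependent ℤ (fun i : I => τ.aVec i) → I.card = d →
    Submodule.span ℤ (Set.range fun i : I => τ.aVec i) = ⊤

/-- The set `𝔹` of the `I ⊆ {1, …, n}` such that the `a_i`, `i ∈ I`, form a basis. -/
def Bases : Type :=
  {I : Finset (Fin n) // LinearIndependent ℤ (fun i : I => τ.aVec i) ∧
    Submodule.span ℤ (Set.range fun i : I => τ.aVec i) = ⊤}

/-- The pair `(C₊, C₋)` is a signed circuit for the vectors `a_i`. -/
def IsSignedCircuit (Cp Cm : Finset (Fin n)) : Prop :=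
  Disjoint Cp Cm ∧ ¬ LinearIndependent ℤ (fun i : ↥(Cp ∪ Cm) => τ.aVec i) ∧
    (∀ D : Finset (Fin n), D ⊂ Cp ∪ Cm → LinearIndependent ℤ (fun i : D => τ.aVec i)) ∧
    ∑ i ∈ Cp, τ.aVec i - ∑ i ∈ Cm, τ.aVec i = 0

/-- `y` is the cocharacter `β_C` of `S` that belongs to `C = (C₊, C₋)`: its image in `𝕏_*(T)` is `1`
on `C₊`, `-1` on `C₋`, and `0` elsewhere. -/
def IsCircuitVector (Cp Cm : Finset (Fin n)) (y : Fin r → ℤ) : Prop :=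
  τ.bᵀ *ᵥ y = fun i => if i ∈ Cp then 1 else if i ∈ Cm then -1 else 0

/-- `η` is generic: it does not vanish on any `β_C`. -/
def IsGeneric (η : Fin r → ℤ) : Prop :=
  ∀ Cp Cm y, τ.IsSignedCircuit Cp Cm → τ.IsCircuitVector Cp Cm y → η ⬝ᵥ y ≠ 0

/-- `β^I_j`: the vector of the signed circuit in `I ∪ {j}` with `j ∈ C₊`. -/
def beta (I : Finset (Fin n)) (j : Fin n) : Fin r → ℤ :=
  Classical.epsilon fun y => ∃ Cp Cm, τ.IsSignedCircuit Cp Cm ∧ Cp ∪ Cm ⊆ insert j I ∧ j ∈ Cp ∧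
    τ.IsCircuitVector Cp Cm y

end TorusSequence

/-- The space `T^*ℂ^n`; the coordinates are `x_i = z (inl i)` and `y_i = z (inr i)`. -/
abbrev Pt (n : ℕ) : Type := Fin n ⊕ Fin n → ℂ

/-- The factors by which `(t, σ) ∈ T × 𝕊` scales the coordinates of `T^*ℂ^n`. -/
def scale {n : ℕ} : BigTorus n →* (Fin n ⊕ Fin n → ℂˣ) where
  toFun t := Sum.elim (fun i => t.2⁻¹ * t.1 i) (fun i => t.2⁻¹ * (t.1 i)⁻¹)
  map_one' := by ext i; rcases i with i | i <;> simp
  map_mul' s t := by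
    funext i
    rcases i with i | i
    · simp only [Prod.snd_mul, Prod.fst_mul, Sum.elim_inl, Pi.mul_apply, mul_inv]
      exact mul_mul_mul_comm _ _ _ _
    · simp only [Prod.snd_mul, Prod.fst_mul, Sum.elim_inr, Pi.mul_apply, mul_inv]
      exact mul_mul_mul_comm _ _ _ _

/-- The action `(t, σ) • (x, y) = (σ⁻¹ t x, σ⁻¹ t⁻¹ y)` of `T × 𝕊` on `T^*ℂ^n`. -/
def ptAct {n : ℕ} (t : BigTorus n) (z : Pt n) : Pt n := fun i => (scale t i : ℂ) * z i

theorem ptAct_one {n : ℕ} (z : Pt n) : ptAct 1 z = z := by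
  funext i; simp [ptAct]

theorem ptAct_mul {n : ℕ} (s t : BigTorus n) (z : Pt n) : ptAct (s * t) z = ptAct s (ptAct t z) := by
  funext i; simp [ptAct, mul_assoc]

theorem exists_pullback {n : ℕ} (t : BigTorus n) (f : MvPolynomial (Fin n ⊕ Fin n) ℂ) :
    ∃ g : MvPolynomial (Fin n ⊕ Fin n) ℂ, ∀ z, g.eval z = f.eval (ptAct t z) := by
  refine ⟨MvPolynomial.aeval (fun i => MvPolynomial.C (scale t i : ℂ) * MvPolynomial.X i) f, ?_⟩
  intro z
  induction f using MvPolynomial.induction_on with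
  | C c => simp
  | add p q hp hq => rw [map_add, map_add, map_add, hp, hq]
  | mul_X p i hp => rw [map_mul, map_mul, map_mul, hp]; simp [ptAct]

section Construction

variable {n r d : ℕ} (τ : TorusSequence n r d) (η : Fin r → ℤ)

/-- The inclusion `S → T → T × 𝕊`. -/
def inS : Torus r →* BigTorus n := (MonoidHom.inl (Torus n) ℂˣ).comp (torusHom τ.bᵀ)

/-- The moment map `μ(x, y) = ∑ x_i y_i b_i` of the action of `S`. -/
def moment (z : Pt n) : Fin r → ℂ :=
  fun k => ∑ i, z (Sum.inl i) * z (Sum.inr i) * (τ.bVec i k : ℂ)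

/-- The `η`-semistable points: some polynomial `f` of `S`-weight `-m η`, `m > 0`, does not vanish
at the point.  Here `S` acts on functions by `(s • f)(z) = f (s⁻¹ • z)`. -/
def IsSemistable (z : Pt n) : Prop :=
  ∃ m : ℕ, 0 < m ∧ ∃ f : MvPolynomial (Fin n ⊕ Fin n) ℂ,
    (∀ (s : Torus r) (w : Pt n),
      f.eval (ptAct (inS τ s⁻¹) w) = ((torusChar η s)⁻¹ ^ m : ℂˣ) * f.eval w) ∧ f.eval z ≠ 0

/-- The semistable part of the zero level `μ⁻¹(0)`. -/
def Level : Type := {z : Pt n // moment τ z = 0 ∧ IsSemistable τ η z}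

variable {τ η}

theorem scale_mul_scale (t : BigTorus n) (i : Fin n) :
    scale t (Sum.inl i) * scale t (Sum.inr i) = t.2⁻¹ ^ 2 := by
  change (t.2⁻¹ * t.1 i) * (t.2⁻¹ * (t.1 i)⁻¹) = _
  rw [mul_mul_mul_comm, mul_inv_cancel, mul_one, sq]

theorem moment_act (t : BigTorus n) {z : Pt n} (hz : moment τ z = 0) :
    moment τ (ptAct t z) = 0 := by
  funext k
  have h : moment τ (ptAct t z) k = ((t.2⁻¹ ^ 2 : ℂˣ) : ℂ) * moment τ z k := by
    simp only [moment, Finset.mul_sum]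
    refine Finset.sum_congr rfl fun i _ => ?_
    rw [← scale_mul_scale t i, Units.val_mul]
    simp only [ptAct]
    ring
  rw [h, hz]; simp

theorem semistable_act (t : BigTorus n) {z : Pt n} (hz : IsSemistable τ η z) :
    IsSemistable τ η (ptAct t z) := by
  obtain ⟨m, hm, f, hf, h0⟩ := hz
  obtain ⟨g, hg⟩ := exists_pullback t⁻¹ f
  refine ⟨m, hm, g, fun s w => ?_, ?_⟩
  · rw [hg, hg, ← ptAct_mul, mul_comm, ptAct_mul, hf]
  · rw [hg, ← ptAct_mul, inv_mul_cancel, ptAct_one]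
    exact h0

/-- The action of `T × 𝕊` on the semistable part of `μ⁻¹(0)`. -/
def levelAct (t : BigTorus n) (z : Level τ η) : Level τ η :=
  ⟨ptAct t z.1, moment_act t z.2.1, semistable_act t z.2.2⟩

theorem levelAct_one (z : Level τ η) : levelAct 1 z = z := Subtype.ext (ptAct_one z.1)

theorem levelAct_mul (s t : BigTorus n) (z : Level τ η) :
    levelAct (s * t) z = levelAct s (levelAct t z) := Subtype.ext (ptAct_mul s t z.1)

variable (τ η)

/-- The orbits of `S`. -/
def orbitSetoid : Setoid (Level τ η) where
  r z w := ∃ s : Torus r, levelAct (inS τ s) z = w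
  iseqv := by
    refine ⟨fun z => ⟨1, by rw [map_one, levelAct_one]⟩, ?_, ?_⟩
    · rintro z w ⟨s, rfl⟩
      exact ⟨s⁻¹, by rw [← levelAct_mul, ← map_mul, inv_mul_cancel, map_one, levelAct_one]⟩
    · rintro z w v ⟨s, rfl⟩ ⟨t, rfl⟩
      exact ⟨t * s, by rw [map_mul, levelAct_mul]⟩

/-- The toric hyper-Kähler manifold `X = μ⁻¹(0)^{η-ss} / S`. -/
def ToricSpace : Type := Quotient (orbitSetoid τ η)

variable {τ η}

/-- The quotient map. -/
def proj (z : Level τ η) : ToricSpace τ η := Quotient.mk (orbitSetoid τ η) z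

theorem proj_surjective : Function.Surjective (proj : Level τ η → ToricSpace τ η) :=
  Quotient.mk_surjective

theorem proj_eq_iff {z w : Level τ η} : proj z = proj w ↔ ∃ s, levelAct (inS τ s) z = w :=
  Quotient.eq (r := orbitSetoid τ η)

/-- A function on the semistable part of `μ⁻¹(0)` is regular near `z`: it is a quotient of
polynomials. -/
def LevelRegularAt (g : Level τ η → ℂ) (z : Level τ η) : Prop :=
  ∃ P Q : MvPolynomial (Fin n ⊕ Fin n) ℂ, Q.eval z.1 ≠ 0 ∧
    ∀ w : Level τ η, Q.eval w.1 ≠ 0 → g w = P.eval w.1 / Q.eval w.1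

theorem LevelRegularAt.comp {g : Level τ η → ℂ} {z : Level τ η} (t : BigTorus n)
    (h : LevelRegularAt g (levelAct t z)) : LevelRegularAt (fun w => g (levelAct t w)) z := by
  obtain ⟨P, Q, h0, h⟩ := h
  obtain ⟨P₂, hP⟩ := exists_pullback t P
  obtain ⟨Q₂, hQ⟩ := exists_pullback t Q
  refine ⟨P₂, Q₂, by rw [hQ]; exact h0, fun w hw => ?_⟩
  rw [hQ] at hw
  rw [hP, hQ]
  exact h _ hw

theorem proj_act (s : Torus r) (z : Level τ η) : proj (levelAct (inS τ s) z) = proj z :=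
  (proj_eq_iff.2 ⟨s, rfl⟩).symm

theorem LevelRegularAt.of_proj_eq {f : ToricSpace τ η → ℂ} {z w : Level τ η}
    (h : LevelRegularAt (fun v => f (proj v)) z) (hzw : proj w = proj z) :
    LevelRegularAt (fun v => f (proj v)) w := by
  obtain ⟨s, rfl⟩ := proj_eq_iff.1 hzw
  simpa only [proj_act] using h.comp

/-- The quotient of the Zariski topology. -/
instance : TopologicalSpace (ToricSpace τ η) where
  IsOpen U := ∀ z : Level τ η, proj z ∈ U → ∃ Q : MvPolynomial (Fin n ⊕ Fin n) ℂ,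
    Q.eval z.1 ≠ 0 ∧ ∀ w : Level τ η, Q.eval w.1 ≠ 0 → proj w ∈ U
  isOpen_univ := fun _ _ => ⟨1, by simp, fun _ _ => trivial⟩
  isOpen_inter := by
    intro U V hU hV z hz
    obtain ⟨Q, h0, h⟩ := hU z hz.1
    obtain ⟨R, h1, h2⟩ := hV z hz.2
    refine ⟨Q * R, by simp [h0, h1], fun w hw => ?_⟩
    rw [map_mul] at hw
    exact ⟨h w (left_ne_zero_of_mul hw), h2 w (right_ne_zero_of_mul hw)⟩
  isOpen_sUnion := by
    rintro 𝒰 h𝒰 z ⟨U, hU, hz⟩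
    obtain ⟨Q, h0, h⟩ := h𝒰 U hU z hz
    exact ⟨Q, h0, fun w hw => ⟨U, hU, h w hw⟩⟩

theorem toric_isOpen_iff {U : Set (ToricSpace τ η)} : IsOpen U ↔ ∀ z : Level τ η, proj z ∈ U →
    ∃ Q : MvPolynomial (Fin n ⊕ Fin n) ℂ,
      Q.eval z.1 ≠ 0 ∧ ∀ w : Level τ η, Q.eval w.1 ≠ 0 → proj w ∈ U := Iff.rfl

/-- A function on `X` is regular if its pull-back to `μ⁻¹(0)` is. -/
def ToricRegularAt (f : ToricSpace τ η → ℂ) (x : ToricSpace τ η) : Prop :=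
  ∀ z : Level τ η, proj z = x → LevelRegularAt (fun w => f (proj w)) z

theorem toricRegularAt_proj {f : ToricSpace τ η → ℂ} {z : Level τ η} :
    ToricRegularAt f (proj z) ↔ LevelRegularAt (fun w => f (proj w)) z :=
  ⟨fun h => h z rfl, fun h _ hw => h.of_proj_eq hw⟩

theorem isOpen_toricRegularAt (f : ToricSpace τ η → ℂ) : IsOpen {x | ToricRegularAt f x} := by
  rw [toric_isOpen_iff]
  intro z hz
  obtain ⟨P, Q, h0, h⟩ := toricRegularAt_proj.1 hz
  exact ⟨Q, h0, fun w hw => toricRegularAt_proj.2 ⟨P, Q, hw, h⟩⟩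

theorem isOpen_toricRegularAt_ne_zero (f : ToricSpace τ η → ℂ) :
    IsOpen {x | ToricRegularAt f x ∧ f x ≠ 0} := by
  rw [toric_isOpen_iff]
  rintro z ⟨hz, hz0⟩
  obtain ⟨P, Q, h0, h⟩ := toricRegularAt_proj.1 hz
  refine ⟨P * Q, ?_, fun w hw => ?_⟩
  · rw [map_mul]
    refine mul_ne_zero (fun hP => hz0 ?_) h0
    exact (h z h0).trans (by rw [hP, zero_div])
  · rw [map_mul] at hw
    have hQ := right_ne_zero_of_mul hw
    refine ⟨toricRegularAt_proj.2 ⟨P, Q, hQ, h⟩, ?_⟩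
    exact (h w hQ).trans_ne (div_ne_zero (left_ne_zero_of_mul hw) hQ)

instance : SpaceWithFunctions (ToricSpace τ η) where
  RegularAt := ToricRegularAt
  regularAt_const c x z _ := ⟨MvPolynomial.C c, 1, by simp, fun w _ => by simp⟩
  regularAt_add f g x hf hg z hz := by
    obtain ⟨P, Q, h0, h⟩ := hf z hz
    obtain ⟨P₂, Q₂, h0₂, h₂⟩ := hg z hz
    refine ⟨P * Q₂ + Q * P₂, Q * Q₂, by simp [h0, h0₂], fun w hw => ?_⟩
    rw [map_mul] at hw
    have h1 := left_ne_zero_of_mul hw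
    have h2 := right_ne_zero_of_mul hw
    simp only [h w h1, h₂ w h2, map_add, map_mul, div_add_div _ _ h1 h2]
  regularAt_mul f g x hf hg z hz := by
    obtain ⟨P, Q, h0, h⟩ := hf z hz
    obtain ⟨P₂, Q₂, h0₂, h₂⟩ := hg z hz
    refine ⟨P * P₂, Q * Q₂, by simp [h0, h0₂], fun w hw => ?_⟩
    rw [map_mul] at hw
    simp only [h w (left_ne_zero_of_mul hw), h₂ w (right_ne_zero_of_mul hw), map_mul,
      div_mul_div_comm]
  regularAt_inv f x hf hx z hz := by
    obtain ⟨P, Q, h0, h⟩ := hf z hz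
    have hP : P.eval z.1 ≠ 0 := by
      intro hP
      apply hx
      rw [← hz]
      exact (h z h0).trans (by rw [hP, zero_div])
    refine ⟨Q * Q, P * Q, by simp [h0, hP], fun w hw => ?_⟩
    rw [map_mul] at hw
    have h1 := left_ne_zero_of_mul hw
    have h2 := right_ne_zero_of_mul hw
    simp only [h w h2, map_mul]
    field_simp
  regularAt_congr f g x hf hfg z hz := by
    obtain ⟨P, Q, h0, h⟩ := hf z hz
    obtain ⟨U, hU, hUo, hxU⟩ := mem_nhds_iff.1 hfg
    obtain ⟨R, hR, hR₂⟩ := toric_isOpen_iff.1 hUo z (hz ▸ hxU)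
    refine ⟨P * R, Q * R, by simp [h0, hR], fun w hw => ?_⟩
    rw [map_mul] at hw
    have h1 := left_ne_zero_of_mul hw
    have h2 := right_ne_zero_of_mul hw
    have h3 : f (proj w) = g (proj w) := hU (hR₂ w h2)
    rw [map_mul, map_mul, mul_div_mul_right _ _ h2, ← h w h1]
    exact h3.symm
  regularAt_eventually f x hf := (isOpen_toricRegularAt f).mem_nhds hf
  regularAt_ne_zero f x hf hx :=
    Filter.mem_of_superset ((isOpen_toricRegularAt_ne_zero f).mem_nhds ⟨hf, hx⟩) fun _ h => h.2

/-- The lift `H × 𝕊 → T × 𝕊` given by a section of `T → H`. -/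
def liftTorus (τ : TorusSequence n r d) : BigTorus d →* BigTorus n :=
  (torusHom τ.sec).prodMap (MonoidHom.id ℂˣ)

/-- The homomorphism `T × 𝕊 → H × 𝕊`. -/
def toH (τ : TorusSequence n r d) : BigTorus n →* BigTorus d :=
  (torusHom τ.a).prodMap (MonoidHom.id ℂˣ)

/-- The action of `T × 𝕊` on `X`. -/
def toricAct (t : BigTorus n) : ToricSpace τ η → ToricSpace τ η :=
  Quotient.map (levelAct t) (by
    rintro z w ⟨s, rfl⟩
    exact ⟨s, by rw [← levelAct_mul, ← levelAct_mul, mul_comm]⟩)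

theorem toricAct_proj (t : BigTorus n) (z : Level τ η) :
    toricAct t (proj z) = proj (levelAct t z) := rfl

/-- `H × 𝕊 = (T × 𝕊) / S` acts on `X`. -/
instance : TorusSpace d (ToricSpace τ η) where
  smul t x := toricAct (liftTorus τ t) x
  one_smul x := by
    obtain ⟨z, rfl⟩ := proj_surjective x
    change toricAct (liftTorus τ 1) (proj z) = _
    rw [map_one, toricAct_proj, levelAct_one]
  mul_smul s t x := by
    obtain ⟨z, rfl⟩ := proj_surjective x
    change toricAct (liftTorus τ (s * t)) (proj z) =
      toricAct (liftTorus τ s) (toricAct (liftTorus τ t) (proj z))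
    rw [map_mul, toricAct_proj, toricAct_proj, toricAct_proj, levelAct_mul]
  regularAt_smul f t x hf := by
    intro z hz
    subst hz
    exact LevelRegularAt.comp (g := fun w => f (proj w)) (liftTorus τ t) (hf _ rfl)

theorem prod_zpow_index {κ : Type*} (s : Finset κ) (u : ℂˣ) (g : κ → ℤ) :
    ∏ q ∈ s, u ^ g q = u ^ ∑ q ∈ s, g q := by
  classical
  induction s using Finset.induction_on with
  | empty => simp
  | insert a s ha ih => rw [Finset.prod_insert ha, Finset.sum_insert ha, zpow_add, ih]

theorem torusHom_mul {k l m : ℕ} (M : Matrix (Fin m) (Fin l) ℤ) (N : Matrix (Fin l) (Fin k) ℤ)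
    (u : Torus k) : torusHom (M * N) u = torusHom M (torusHom N u) := by
  funext i
  change ∏ j, u j ^ (M * N) i j = ∏ q, (∏ j, u j ^ N q j) ^ M i q
  simp only [← Finset.prod_zpow, Matrix.mul_apply]
  rw [Finset.prod_comm]
  refine Finset.prod_congr rfl fun j _ => ?_
  simp only [← zpow_mul, mul_comm (N _ _)]
  exact (prod_zpow_index _ _ _).symm

theorem torusHom_add {k m : ℕ} (M N : Matrix (Fin m) (Fin k) ℤ) (u : Torus k) :
    torusHom (M + N) u = torusHom M u * torusHom N u := by
  funext i
  change ∏ j, u j ^ (M + N) i j = (∏ j, u j ^ M i j) * ∏ j, u j ^ N i j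
  simp [zpow_add, Finset.prod_mul_distrib]

theorem torusHom_one {k : ℕ} (u : Torus k) : torusHom (1 : Matrix (Fin k) (Fin k) ℤ) u = u := by
  funext i
  change ∏ j, u j ^ (1 : Matrix (Fin k) (Fin k) ℤ) i j = u i
  rw [Finset.prod_eq_single i] <;> simp +contextual [eq_comm]

/-- The action of `H × 𝕊` on `X` is the one induced by the action of `T × 𝕊`. -/
theorem toH_smul_proj (t : BigTorus n) (z : Level τ η) :
    toH τ t • proj z = proj (levelAct t z) := by
  have h : t = liftTorus τ (toH τ t) * inS τ (torusHom τ.ret t.1) := by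
    refine Prod.ext ?_ ?_
    · change t.1 = torusHom τ.sec (torusHom τ.a t.1) * torusHom τ.bᵀ (torusHom τ.ret t.1)
      rw [← torusHom_mul, ← torusHom_mul, ← torusHom_add, τ.sec_mul_a_add, torusHom_one]
    · change t.2 = t.2 * 1
      rw [mul_one]
  conv_rhs => rw [h, levelAct_mul]
  change toricAct (liftTorus τ (toH τ t)) (proj z) = _
  rw [← toricAct_proj, proj_act]

/-- The open subset `U_I` of `X`. -/
def chart (τ : TorusSequence n r d) (η : Fin r → ℤ) (I : Finset (Fin n)) :
    Set (ToricSpace τ η) :=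
  {x | ∃ z : Level τ η, proj z = x ∧ ∀ j ∉ I,
    (0 < η ⬝ᵥ τ.beta I j → z.1 (Sum.inl j) ≠ 0) ∧ (η ⬝ᵥ τ.beta I j < 0 → z.1 (Sum.inr j) ≠ 0)}

/-- The class `l` in the equivariant Picard group is that of the line bundle `ℒ(w)` associated with
the character `w` of `T`, on which `𝕊` acts trivially.  That is, the pull-back of the line bundle to
`μ⁻¹(0)^{ss}` is `T × 𝕊`-equivariantly isomorphic to the trivial bundle with fibre `ℂ_w`, by way of
a nowhere vanishing function `u` that sends the fibre `ℂ_w` over `z` to the fibre over `proj z`. -/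
def IsAssociated (w : Fin n → ℤ) (l : EqPic d (ToricSpace τ η)) : Prop :=
  ∃ E : eqLineBundles d (ToricSpace τ η), eqPicMk d E = l ∧ ∃ u : Level τ η → ℂˣ,
    (∀ z₀, LevelRegularAt (fun z => ((u z / E.1.1 (proj z₀) (proj z) : ℂˣ) : ℂ)) z₀) ∧
    ∀ (t : BigTorus n) (z : Level τ η),
      u (levelAct t z) * torusChar w t.1 = E.1.2 (toH τ t) (proj z) * u z

/-- The standard identifications for a toric hyper-Kähler manifold `X`: the bijection `I ↦ p_I` of
`𝔹` with `X^H`, `p_I` being the fixed point in `U_I`; the homomorphism `w ↦ ℒ(w)` from the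
characters of `T` to the equivariant Picard group; the isomorphism of the characters of `S` with the
Picard group that is induced by it. -/
structure ToricMarking (τ : TorusSequence n r d) (η : Fin r → ℤ) where
  pt : τ.Bases ≃ FixedPts d (ToricSpace τ η)
  mem_chart_iff : ∀ I p, p.1 ∈ chart τ η I.1 ↔ p = pt I
  bundle : (Fin n → ℤ) →+ EqPic d (ToricSpace τ η)
  isAssociated : ∀ w, IsAssociated w (bundle w)
  pic : (Fin r → ℤ) ≃+ Pic (ToricSpace τ η)
  pic_apply : ∀ w, pic (τ.b *ᵥ w) = forget d (bundle w)

/-- The element of the dual of `Pic X ≅ 𝕏^*(S)` given by a cocharacter `y` of `S`. -/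
def ToricMarking.functional (M : ToricMarking τ η) (y : Fin r → ℤ) :
    Pic (ToricSpace τ η) →+ ℤ where
  toFun l := M.pic.symm l ⬝ᵥ y
  map_zero' := by simp
  map_add' l m := by simp [add_dotProduct]

/-- The additional data on `X`: the chamber that contains `ξ`, the Kähler roots
`Ψ(p_I) = {± β^I_j : j ∉ I}`, and the lift `l ↦ ℒ(ι(l))` given by a homomorphism `ι` from the
characters of `S` to those of `T`. -/
def ToricMarking.data (M : ToricMarking τ η) (ξ : Fin d → ℤ) (ι : (Fin r → ℤ) →+ (Fin n → ℤ)) :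
    DualityData d (ToricSpace τ η) where
  C := connectedComponentIn (rootComplement d (ToricSpace τ η)) (realPt ξ)
  Ψ p := ∑ j ∈ ((M.pt.symm p).1)ᶜ,
    {M.functional (τ.beta (M.pt.symm p).1 j), -M.functional (τ.beta (M.pt.symm p).1 j)}
  lift := M.bundle.comp (ι.comp M.pic.symm.toAddMonoidHom)

end Construction

end ToricDual

end

open ToricDual

open scoped Matrix

/-!
The fixed points, the order, the tangent weights, the ample cone and the weights of line bundles are
all read off from the arrangement of coordinate hyperplanes in the affine space `{v | b v = η}`, on
which `ξ` is a generic linear function. Everything then reduces to statements about this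
arrangement and its Gale dual.

*Combinatorics.* A basis `I ∈ 𝔹` gives the vertex `slack I η` of the arrangement. The vectors
`α^I_i`, `β^I_j` are encoded by the cocircuit vectors `rho I i` and the circuit vectors `circ I j`,
whose nontrivial entries are negative transposes of each other; complementing `I` exchanges them
(`alpha_compl`, `bet_compl`). A vertex `J` has an attached region, on which `ξ` is minimal at `J`,
and `Feas η ξ I J` says that this region contains the vertex `I`. The order generated by `Feas` is
also generated by the exchanges that decrease `ξ`: one direction is the simplex method, the other
subdivides a line of the arrangement into edges (`line_induction`). An exchange decreases `ξ` if and
only if the reverse exchange of the complements decreases `η`, which gives the order reversal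
(`reflTransGen_feas_compl_iff`).

*Geometry.* Over the chart of `I` one coordinate from each pair `x_j`, `y_j` with `j ∉ I` is
invertible, and the slice on which these coordinates are `1` identifies the chart with an affine
space of dimension `2d` (`param`, `coord`). Every semistable point lies over a chart, by
Carathéodory's theorem (`exists_inChart`). The torus acts diagonally in the coordinates of the
chart, with `H`-weights `± α^I_i`; this gives the fixed points, the roots, the chambers and the
repelling weights. The attracting sets are coordinate subspaces, and their closures are described by
`Feas` (`param_mem_closure_attr_iff`).

*Line bundles.* A Laurent monomial in the invertible coordinates is a frame over a chart of the line
bundle of a character (`frame`), and its exponents give the weights in the fibres. Each edge of the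
arrangement gives a projective line joining two fixed points (`IsEdge.exists_curve`), on which the
bundle of `θ` has a degree that is up to sign the value of `θ` on a circuit vector. By Liouville's
theorem a trivial bundle has degree zero on all these lines, and an ample one has positive degree.
So `𝕏^*(S) → Pic X` is injective, and ample bundles have the same signs as `η` on all circuit
vectors; conversely, such characters are ample, because large powers of the frame monomials clear
all denominators (`isAmpleBundle_lineB_iff`). For the surjectivity, a line bundle is trivial on each
chart, since polynomial rings are factorial (`exists_affine_frame`). Two such frames over charts
joined by an edge differ by a Laurent monomial; evaluated along the `H`-orbit of a generic point
these monomials are differences of characters that come from a single character `w` of `T`, and after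
twisting by the bundle of `w` the frames agree up to constants (`exists_weight`,
`picHom_surjective`).
-/

open SpaceWithFunctions

noncomputable section

namespace ToricDual

/-! ### Bases, circuits and exchange -/

namespace TorusSequence

variable {n r d : ℕ} (τ : TorusSequence n r d)

theorem a_mulVec_eq_sum (f : Fin n → ℤ) : τ.a *ᵥ f = ∑ k, f k • τ.aVec k := by
  funext l
  simp [Matrix.mulVec, dotProduct, aVec, mul_comm]

theorem transpose_a_mulVec (x : Fin d → ℤ) (k : Fin n) : (τ.aᵀ *ᵥ x) k = x ⬝ᵥ τ.aVec k := by
  simp [Matrix.mulVec, dotProduct, aVec, mul_comm]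

theorem transpose_b_mulVec (x : Fin r → ℤ) (k : Fin n) : (τ.bᵀ *ᵥ x) k = x ⬝ᵥ τ.bVec k := by
  simp [Matrix.mulVec, dotProduct, bVec, mul_comm]

theorem dotProduct_b_mulVec (x : Fin r → ℤ) (w : Fin n → ℤ) :
    (τ.b *ᵥ w) ⬝ᵥ x = w ⬝ᵥ (τ.bᵀ *ᵥ x) := by
  rw [Matrix.mulVec_transpose, dotProduct_comm, Matrix.dotProduct_mulVec, dotProduct_comm]

theorem dotProduct_a_mulVec (x : Fin d → ℤ) (w : Fin n → ℤ) :
    (τ.a *ᵥ w) ⬝ᵥ x = w ⬝ᵥ (τ.aᵀ *ᵥ x) := by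
  rw [Matrix.mulVec_transpose, dotProduct_comm, Matrix.dotProduct_mulVec, dotProduct_comm]

theorem a_mulVec_b (y : Fin r → ℤ) : τ.a *ᵥ (τ.bᵀ *ᵥ y) = 0 := by
  rw [Matrix.mulVec_mulVec, τ.a_mul_b, Matrix.zero_mulVec]

theorem b_mulVec_a (x : Fin d → ℤ) : τ.b *ᵥ (τ.aᵀ *ᵥ x) = 0 := τ.dual.a_mulVec_b x

theorem linearIndependent_iff_mulVec (I : Finset (Fin n)) :
    LinearIndependent ℤ (fun i : I => τ.aVec i) ↔
      ∀ f : Fin n → ℤ, (∀ k ∉ I, f k = 0) → τ.a *ᵥ f = 0 → f = 0 := by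
  have h : LinearIndependent ℤ (fun i : I => τ.aVec i) ↔
      LinearIndepOn ℤ τ.aVec (I : Set (Fin n)) := Iff.rfl
  rw [h, linearIndepOn_finset_iff]
  constructor
  · intro h f hf h0
    have := h f (by
      rw [← h0, a_mulVec_eq_sum]
      exact Finset.sum_subset (Finset.subset_univ _) fun k _ hk => by rw [hf k hk, zero_smul])
    funext k
    by_cases hk : k ∈ I
    · exact this k hk
    · exact hf k hk
  · intro h f hf k hk
    have := h (fun k => if k ∈ I then f k else 0) (fun k hk => by simp [hk]) (by
      rw [a_mulVec_eq_sum, ← hf]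
      simp [ite_smul, Finset.sum_ite_mem])
    simpa [hk] using congrFun this k

theorem span_eq_top_iff_mulVec (I : Finset (Fin n)) :
    Submodule.span ℤ (Set.range fun i : I => τ.aVec i) = ⊤ ↔
      ∀ v : Fin d → ℤ, ∃ f : Fin n → ℤ, (∀ k ∉ I, f k = 0) ∧ τ.a *ᵥ f = v := by
  rw [Submodule.eq_top_iff']
  refine forall_congr' fun v => ?_
  rw [Submodule.mem_span_range_iff_exists_fun]
  constructor
  · rintro ⟨c, hc⟩
    refine ⟨fun k => if hk : k ∈ I then c ⟨k, hk⟩ else 0, fun k hk => by simp [hk], ?_⟩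
    rw [a_mulVec_eq_sum, ← hc, ← Finset.sum_subset (Finset.subset_univ I)
      (fun k _ hk => by simp [hk]), ← Finset.sum_coe_sort I]
    simp
  · rintro ⟨f, hf, rfl⟩
    refine ⟨fun i => f i, ?_⟩
    rw [a_mulVec_eq_sum, ← Finset.sum_subset (Finset.subset_univ I)
      (fun k _ hk => by simp [hf k hk]), ← Finset.sum_coe_sort I]

/-- Builds a member of `𝔹` from the two defining conditions, phrased with vectors supported on
`I`. -/
def Bases.ofMulVec (I : Finset (Fin n))
    (h₁ : ∀ f : Fin n → ℤ, (∀ k ∉ I, f k = 0) → τ.a *ᵥ f = 0 → f = 0)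
    (h₂ : ∀ v : Fin d → ℤ, ∃ f : Fin n → ℤ, (∀ k ∉ I, f k = 0) ∧ τ.a *ᵥ f = v) : τ.Bases :=
  ⟨I, (τ.linearIndependent_iff_mulVec I).2 h₁, (τ.span_eq_top_iff_mulVec I).2 h₂⟩

variable {τ}

theorem Bases.ext {I J : τ.Bases} (h : I.1 = J.1) : I = J := Subtype.ext h

theorem Bases.eq_zero (I : τ.Bases) {f : Fin n → ℤ} (hf : ∀ k ∉ I.1, f k = 0)
    (h : τ.a *ᵥ f = 0) : f = 0 := (τ.linearIndependent_iff_mulVec I.1).1 I.2.1 f hf h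

theorem Bases.exists_eq (I : τ.Bases) (v : Fin d → ℤ) :
    ∃ f : Fin n → ℤ, (∀ k ∉ I.1, f k = 0) ∧ τ.a *ᵥ f = v :=
  (τ.span_eq_top_iff_mulVec I.1).1 I.2.2 v

/-- The basis of `𝕏_*(H)` formed by the `a_i`, `i ∈ I`. -/
def Bases.basis (I : τ.Bases) : Module.Basis I.1 ℤ (Fin d → ℤ) :=
  Module.Basis.mk I.2.1 I.2.2.ge

theorem Bases.card (I : τ.Bases) : I.1.card = d := by
  have := Module.finrank_eq_card_basis I.basis
  simpa using this.symm

/-- The basis of `𝕏^*(H)` dual to the `a_i`, `i ∈ I`; it is extended by zero to all `i`. -/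
def alpha (I : τ.Bases) (i : Fin n) : Fin d → ℤ := fun l =>
  if hi : i ∈ I.1 then I.basis.repr (Pi.single l 1) ⟨i, hi⟩ else 0

theorem alpha_of_notMem {I : τ.Bases} {i : Fin n} (hi : i ∉ I.1) : alpha I i = 0 := by
  funext l; simp [alpha, hi]

theorem alpha_dotProduct {I : τ.Bases} {i : Fin n} (hi : i ∈ I.1) (v : Fin d → ℤ) :
    alpha I i ⬝ᵥ v = I.basis.repr v ⟨i, hi⟩ := by
  conv_rhs => rw [← Finset.univ_sum_single v]
  simp only [map_sum, dotProduct, alpha, hi, dif_pos, Finsupp.coe_finsetSum, Finset.sum_apply]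
  refine Finset.sum_congr rfl fun l _ => ?_
  have : (Pi.single l (v l) : Fin d → ℤ) = v l • Pi.single l 1 := by
    rw [← Pi.single_smul, smul_eq_mul, mul_one]
  rw [this, map_smul, Finsupp.smul_apply, smul_eq_mul, mul_comm]

theorem alpha_dotProduct_aVec {I : τ.Bases} {i k : Fin n} (hk : k ∈ I.1) :
    alpha I i ⬝ᵥ τ.aVec k = if i = k then 1 else 0 := by
  by_cases hi : i ∈ I.1
  · rw [alpha_dotProduct hi]
    have : τ.aVec k = I.basis ⟨k, hk⟩ := by simp [Bases.basis]
    rw [this, Module.Basis.repr_self, Finsupp.single_apply]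
    simp [Subtype.ext_iff, eq_comm]
  · rw [alpha_of_notMem hi, zero_dotProduct, if_neg]
    rintro rfl; exact hi hk

/-- The cocircuit vector: the character of `T` that is `1` at `i` and `0` on the rest of `I`, and is
trivial on `S`. -/
def rho (I : τ.Bases) (i : Fin n) : Fin n → ℤ := τ.aᵀ *ᵥ alpha I i

theorem rho_apply (I : τ.Bases) (i k : Fin n) : rho I i k = alpha I i ⬝ᵥ τ.aVec k :=
  τ.transpose_a_mulVec _ _

theorem rho_apply_mem {I : τ.Bases} {i k : Fin n} (hk : k ∈ I.1) :
    rho I i k = if i = k then 1 else 0 := by rw [rho_apply, alpha_dotProduct_aVec hk]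

theorem b_mulVec_rho (I : τ.Bases) (i : Fin n) : τ.b *ᵥ rho I i = 0 := τ.b_mulVec_a _

/-- Two characters of `H` that agree on a basis of cocharacters are equal. -/
theorem Bases.ext_dotProduct (I : τ.Bases) {x y : Fin d → ℤ}
    (h : ∀ i ∈ I.1, x ⬝ᵥ τ.aVec i = y ⬝ᵥ τ.aVec i) : x = y := by
  funext l
  obtain ⟨f, hf, hl⟩ := I.exists_eq (Pi.single l 1)
  have key : ∀ z : Fin d → ℤ, z l = ∑ k, f k * (z ⬝ᵥ τ.aVec k) := by
    intro z
    have : z ⬝ᵥ (τ.a *ᵥ f) = z l := by rw [hl]; simp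
    rw [← this, a_mulVec_eq_sum, dotProduct_sum]
    exact Finset.sum_congr rfl fun k _ => dotProduct_smul _ _ _
  rw [key x, key y]
  refine Finset.sum_congr rfl fun k _ => ?_
  by_cases hk : k ∈ I.1
  · rw [h k hk]
  · rw [hf k hk, zero_mul, zero_mul]

theorem alpha_ne_zero {I : τ.Bases} {i : Fin n} (hi : i ∈ I.1) : alpha I i ≠ 0 := by
  intro h
  have := alpha_dotProduct_aVec (I := I) (i := i) hi
  rw [h] at this
  simp at this

/-- The circuit vector in `𝕏_*(T)`, supported on `I ∪ {j}`, with coefficient `1` at `j ∉ I`. -/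
def circ (I : τ.Bases) (j : Fin n) : Fin n → ℤ := fun k =>
  if k ∈ I.1 then -rho I k j else if k = j then 1 else 0

theorem circ_mem {I : τ.Bases} {j k : Fin n} (hk : k ∈ I.1) : circ I j k = -rho I k j := by
  simp [circ, hk]

theorem circ_notMem {I : τ.Bases} {j k : Fin n} (hk : k ∉ I.1) :
    circ I j k = if k = j then 1 else 0 := by simp [circ, hk]

theorem Bases.eq_zero_of_alpha (I : τ.Bases) {v : Fin d → ℤ}
    (h : ∀ i ∈ I.1, alpha I i ⬝ᵥ v = 0) : v = 0 := by
  apply I.basis.repr.map_eq_zero_iff.1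
  ext ⟨i, hi⟩
  rw [← alpha_dotProduct hi, h i hi]
  rfl

theorem a_mulVec_circ {I : τ.Bases} {j : Fin n} (hj : j ∉ I.1) : τ.a *ᵥ circ I j = 0 := by
  refine I.eq_zero_of_alpha fun i hi => ?_
  rw [dotProduct_comm, dotProduct_a_mulVec]
  change ∑ k, circ I j k * rho I i k = 0
  rw [Fintype.sum_eq_add i j (by rintro rfl; exact hj hi)]
  · rw [circ_mem hi, circ_notMem hj, rho_apply_mem hi]; simp
  · rintro k ⟨hki, hkj⟩
    by_cases hk : k ∈ I.1
    · rw [rho_apply_mem hk, if_neg (Ne.symm hki), mul_zero]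
    · rw [circ_notMem hk, if_neg hkj, zero_mul]

/-- The circuit vector as a cocharacter of `S`. -/
def bet (I : τ.Bases) (j : Fin n) : Fin r → ℤ := τ.ret *ᵥ circ I j

theorem transpose_b_mulVec_bet {I : τ.Bases} {j : Fin n} (hj : j ∉ I.1) :
    τ.bᵀ *ᵥ bet I j = circ I j := by
  have h := congrArg (· *ᵥ circ I j) τ.sec_mul_a_add
  simpa [Matrix.add_mulVec, ← Matrix.mulVec_mulVec, a_mulVec_circ hj, bet] using h

theorem bet_dotProduct_bVec {I : τ.Bases} {j : Fin n} (hj : j ∉ I.1) (k : Fin n) :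
    bet I j ⬝ᵥ τ.bVec k = circ I j k := by
  rw [← transpose_b_mulVec, transpose_b_mulVec_bet hj]

/-! ### Exchanging one element of a basis -/

/-- The basis `J` arises from `I` by replacing `i` by `j`. -/
structure Exch (I J : τ.Bases) (i j : Fin n) : Prop where
  mem : i ∈ I.1
  notMem : j ∉ I.1
  eq : J.1 = insert j (I.1.erase i)

/-- A nonzero entry `rho I i j` allows `j` to replace `i`: the new family is independent, and by
unimodularity it generates the lattice. -/
theorem exists_exch (huni : τ.IsUnimodular) {I : τ.Bases} {i j : Fin n} (hi : i ∈ I.1)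
    (hj : j ∉ I.1) (h : rho I i j ≠ 0) : ∃ J : τ.Bases, Exch I J i j := by
  have hind : LinearIndependent ℤ (fun k : ↥(insert j (I.1.erase i)) => τ.aVec k) := by
    rw [linearIndependent_iff_mulVec]
    intro f hf h0
    have hfj : f j = 0 := by
      have h1 : f ⬝ᵥ rho I i = 0 := by
        rw [rho, ← dotProduct_a_mulVec, h0, zero_dotProduct]
      have h2 : f ⬝ᵥ rho I i = f j * rho I i j := by
        refine Fintype.sum_eq_single j fun k hk => ?_
        by_cases hkI : k ∈ I.1
        · rw [rho_apply_mem hkI]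
          split_ifs with hik
          · rw [hf k (by subst hik; simp [hk]), zero_mul]
          · rw [mul_zero]
        · rw [hf k (by simp [hk, hkI]), zero_mul]
      exact (mul_eq_zero.1 (h2.symm.trans h1)).resolve_right h
    refine I.eq_zero (fun k hk => ?_) h0
    by_cases hkj : k = j
    · rw [hkj, hfj]
    · exact hf k (by simp [hkj, hk])
  refine ⟨⟨_, hind, huni _ hind ?_⟩, hi, hj, rfl⟩
  rw [Finset.card_insert_of_notMem (by simp [hj]), Finset.card_erase_add_one hi, I.card]

namespace Exch

variable {I J : τ.Bases} {i j : Fin n}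

theorem ne (h : Exch I J i j) : i ≠ j := by rintro rfl; exact h.notMem h.mem

theorem mem_right (h : Exch I J i j) : j ∈ J.1 := by rw [h.eq]; exact Finset.mem_insert_self _ _

theorem notMem_right (h : Exch I J i j) : i ∉ J.1 := by rw [h.eq]; simp [h.ne]

theorem mem_right_iff (h : Exch I J i j) {k : Fin n} (hi : k ≠ i) (hj : k ≠ j) :
    k ∈ J.1 ↔ k ∈ I.1 := by rw [h.eq]; simp [hi, hj]

theorem symm (h : Exch I J i j) : Exch J I j i where
  mem := h.mem_right
  notMem := h.notMem_right
  eq := by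
    rw [h.eq, Finset.erase_insert (by simp [h.notMem]), Finset.insert_erase h.mem]

theorem alpha_eq_smul (h : Exch I J i j) : alpha I i = rho I i j • alpha J j := by
  refine J.ext_dotProduct fun k hk => ?_
  rw [smul_dotProduct, alpha_dotProduct_aVec hk, ← rho_apply, smul_eq_mul]
  by_cases hkj : k = j
  · subst hkj; simp
  · have hkI : k ∈ I.1 := by
      rw [h.eq] at hk; simp_all
    have hki : k ≠ i := by rintro rfl; exact h.notMem_right hk
    rw [rho_apply_mem hkI, if_neg (Ne.symm hki), if_neg (Ne.symm hkj), mul_zero]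

theorem rho_mul_rho (h : Exch I J i j) : rho I i j * rho J j i = 1 := by
  have := congrArg (· ⬝ᵥ τ.aVec i) h.alpha_eq_smul
  simp only [smul_dotProduct, alpha_dotProduct_aVec h.mem, if_true, smul_eq_mul] at this
  rw [rho_apply J]; exact this.symm

theorem rho_symm (h : Exch I J i j) : rho J j i = rho I i j := by
  have := Int.eq_one_or_neg_one_of_mul_eq_one' h.rho_mul_rho
  omega

theorem rho_sq (h : Exch I J i j) : rho I i j * rho I i j = 1 := by
  have := h.rho_mul_rho
  rwa [h.rho_symm] at this

theorem rho_ne_zero (h : Exch I J i j) : rho I i j ≠ 0 := by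
  intro h0
  have := h.rho_sq
  simp [h0] at this

theorem rho_eq_smul (h : Exch I J i j) : rho J j = rho I i j • rho I i := by
  rw [rho, h.symm.alpha_eq_smul, h.rho_symm, Matrix.mulVec_smul, ← rho]

end Exch

/-- For a unimodular sequence all entries of the cocircuit vectors are `0` or `± 1`, because the two
entries that belong to an exchange are integers with product `1`. -/
theorem rho_eq (huni : τ.IsUnimodular) {I : τ.Bases} {i : Fin n} (hi : i ∈ I.1) (j : Fin n) :
    rho I i j = 0 ∨ rho I i j = 1 ∨ rho I i j = -1 := by
  by_cases hj : j ∈ I.1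
  · rw [rho_apply_mem hj]; split_ifs <;> simp
  · by_cases h0 : rho I i j = 0
    · exact Or.inl h0
    · obtain ⟨J, hJ⟩ := exists_exch huni hi hj h0
      exact Or.inr (Int.eq_one_or_neg_one_of_mul_eq_one hJ.rho_mul_rho)

theorem circ_eq (huni : τ.IsUnimodular) (I : τ.Bases) (j k : Fin n) :
    circ I j k = 0 ∨ circ I j k = 1 ∨ circ I j k = -1 := by
  by_cases hk : k ∈ I.1
  · rw [circ_mem hk]
    have := rho_eq huni hk j
    omega
  · rw [circ_notMem hk]; split_ifs <;> simp

theorem circ_unique {I : τ.Bases} {j : Fin n} (hj : j ∉ I.1) {f : Fin n → ℤ}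
    (hf : ∀ k ∉ insert j I.1, f k = 0) (hfj : f j = 1) (h0 : τ.a *ᵥ f = 0) : f = circ I j := by
  rw [← sub_eq_zero]
  refine I.eq_zero (fun k hk => ?_) (by rw [Matrix.mulVec_sub, h0, a_mulVec_circ hj, sub_zero])
  rw [Pi.sub_apply, circ_notMem hk]
  split_ifs with hkj
  · rw [hkj, hfj, sub_self]
  · rw [hf k (by simp [hkj, hk]), sub_zero]

theorem circ_signs (huni : τ.IsUnimodular) (I : τ.Bases) (j : Fin n) :
    circ I j = fun k => if k ∈ Finset.univ.filter (fun k => circ I j k = 1) then 1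
      else if k ∈ Finset.univ.filter (fun k => circ I j k = -1) then -1 else 0 := by
  funext k
  rcases circ_eq huni I j k with h | h | h <;> simp [h]

theorem isSignedCircuit_circ (huni : τ.IsUnimodular) {I : τ.Bases} {j : Fin n} (hj : j ∉ I.1) :
    τ.IsSignedCircuit (Finset.univ.filter fun k => circ I j k = 1)
      (Finset.univ.filter fun k => circ I j k = -1) := by
  have hsupp : ∀ k, k ∉ Finset.univ.filter (fun k => circ I j k = 1) ∪
      Finset.univ.filter (fun k => circ I j k = -1) ↔ circ I j k = 0 := by
    intro k
    rcases circ_eq huni I j k with h | h | h <;> simp [h]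
  refine ⟨?_, ?_, ?_, ?_⟩
  · rw [Finset.disjoint_filter]; intro k _ h; rw [h]; decide
  · rw [linearIndependent_iff_mulVec]
    intro h
    have := congrFun (h (circ I j) (fun k hk => (hsupp k).1 hk) (a_mulVec_circ hj)) j
    rw [circ_notMem hj] at this
    simp at this
  · intro D hD
    rw [linearIndependent_iff_mulVec]
    intro f hf h0
    obtain ⟨k, hkC, hkD⟩ := Finset.exists_of_ssubset hD
    have hk0 : circ I j k ≠ 0 := fun h => (hsupp k).2 h hkC
    have hDI : ∀ l, l ≠ j → l ∉ I.1 → f l = 0 := by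
      intro l hlj hl
      refine hf l fun hlD => (hsupp l).2 ?_ (hD.1 hlD)
      rw [circ_notMem hl, if_neg hlj]
    by_cases hkI : k ∈ I.1
    · rw [circ_mem hkI, neg_ne_zero] at hk0
      obtain ⟨J, hJ⟩ := exists_exch huni hkI hj hk0
      refine J.eq_zero (fun l hl => ?_) h0
      by_cases hlk : l = k
      · subst hlk; exact hf l hkD
      · have hlj : l ≠ j := by rintro rfl; exact hl hJ.mem_right
        exact hDI l hlj fun h => hl ((hJ.mem_right_iff hlk hlj).2 h)
    · have hkj : k = j := by
        by_contra h; rw [circ_notMem hkI, if_neg h] at hk0; exact hk0 rfl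
      subst hkj
      refine I.eq_zero (fun l hl => ?_) h0
      by_cases hlk : l = k
      · subst hlk; exact hf l hkD
      · exact hDI l hlk hl
  · have h := a_mulVec_circ hj
    rw [a_mulVec_eq_sum] at h
    rw [← h, Finset.sum_filter, Finset.sum_filter, ← Finset.sum_sub_distrib]
    refine Finset.sum_congr rfl fun k _ => ?_
    rcases circ_eq huni I j k with h | h | h <;> simp [h]

theorem isCircuitVector_bet (huni : τ.IsUnimodular) {I : τ.Bases} {j : Fin n} (hj : j ∉ I.1) :
    τ.IsCircuitVector (Finset.univ.filter fun k => circ I j k = 1)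
      (Finset.univ.filter fun k => circ I j k = -1) (bet I j) := by
  rw [IsCircuitVector, transpose_b_mulVec_bet hj]
  exact circ_signs huni I j

theorem generic_bet_ne_zero (huni : τ.IsUnimodular) {η : Fin r → ℤ} (hη : τ.IsGeneric η)
    {I : τ.Bases} {j : Fin n} (hj : j ∉ I.1) : η ⬝ᵥ bet I j ≠ 0 :=
  hη _ _ _ (isSignedCircuit_circ huni hj) (isCircuitVector_bet huni hj)

/-- The vector chosen in the definition of `beta` is unique, so it is `bet I j`. -/
theorem beta_eq_bet (huni : τ.IsUnimodular) {I : τ.Bases} {j : Fin n} (hj : j ∉ I.1) :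
    τ.beta I.1 j = bet I j := by
  have hex : ∃ y, ∃ Cp Cm, τ.IsSignedCircuit Cp Cm ∧ Cp ∪ Cm ⊆ insert j I.1 ∧ j ∈ Cp ∧
      τ.IsCircuitVector Cp Cm y := by
    refine ⟨bet I j, _, _, isSignedCircuit_circ huni hj, ?_, ?_, isCircuitVector_bet huni hj⟩
    · intro k hk
      by_contra h
      simp only [Finset.mem_insert, not_or] at h
      have h1 := circ_notMem (j := j) h.2
      rw [if_neg h.1] at h1
      simp [h1] at hk
    · simp [circ_notMem hj]
  obtain ⟨Cp, Cm, hC, hsub, hjC, hy⟩ := Classical.epsilon_spec hex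
  change τ.IsCircuitVector Cp Cm (τ.beta I.1 j) at hy
  rw [IsCircuitVector] at hy
  have : τ.bᵀ *ᵥ τ.beta I.1 j = circ I j := by
    refine circ_unique hj (fun k hk => ?_) ?_ (τ.a_mulVec_b _)
    · rw [hy]
      have h1 : k ∉ Cp ∪ Cm := fun h => hk (hsub h)
      simp only [Finset.mem_union, not_or] at h1
      simp [h1.1, h1.2]
    · rw [hy]; simp [hjC]
  exact τ.injective (this.trans (transpose_b_mulVec_bet hj).symm)

/-! ### Vertices of the hyperplane arrangement -/

/-- The vector with `b v = θ` that vanishes on the basis `I`.  The coordinate hyperplanes cut out an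
arrangement in the affine space `{v | b v = θ}`, and this vector is the vertex of the arrangement in
which the hyperplanes with index in `I` meet. -/
def slack (I : τ.Bases) (θ : Fin r → ℤ) : Fin n → ℤ := fun k =>
  if k ∈ I.1 then 0 else θ ⬝ᵥ bet I k

theorem slack_mem {I : τ.Bases} {θ : Fin r → ℤ} {k : Fin n} (hk : k ∈ I.1) : slack I θ k = 0 := by
  simp [slack, hk]

theorem slack_notMem {I : τ.Bases} {θ : Fin r → ℤ} {k : Fin n} (hk : k ∉ I.1) :
    slack I θ k = θ ⬝ᵥ bet I k := by simp [slack, hk]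

theorem slack_unique {I : τ.Bases} {θ : Fin r → ℤ} {v : Fin n → ℤ} (hv : ∀ k ∈ I.1, v k = 0)
    (h : τ.b *ᵥ v = θ) : v = slack I θ := by
  funext k
  by_cases hk : k ∈ I.1
  · rw [hv k hk, slack_mem hk]
  · rw [slack_notMem hk, ← h, dotProduct_b_mulVec, transpose_b_mulVec_bet hk]
    symm
    refine (Fintype.sum_eq_single k fun l hl => ?_).trans ?_
    · by_cases hlI : l ∈ I.1
      · rw [hv l hlI, zero_mul]
      · rw [circ_notMem hlI, if_neg hl, mul_zero]
    · rw [circ_notMem hk, if_pos rfl, mul_one]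

theorem exists_b_mulVec_eq (τ : TorusSequence n r d) (θ : Fin r → ℤ) : ∃ w, τ.b *ᵥ w = θ :=
  τ.dual.surjective θ

theorem b_mulVec_slack (I : τ.Bases) (θ : Fin r → ℤ) : τ.b *ᵥ slack I θ = θ := by
  obtain ⟨w, rfl⟩ := τ.exists_b_mulVec_eq θ
  have h : τ.b *ᵥ (w - ∑ i ∈ I.1, w i • rho I i) = τ.b *ᵥ w := by
    rw [Matrix.mulVec_sub, Matrix.mulVec_sum, Finset.sum_eq_zero, sub_zero]
    intro i _
    rw [Matrix.mulVec_smul, b_mulVec_rho, smul_zero]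
  rw [← slack_unique (fun k hk => ?_) h, h]
  rw [Pi.sub_apply, Finset.sum_apply, Finset.sum_eq_single k]
  · simp [rho_apply_mem hk]
  · intro i _ hi
    simp [rho_apply_mem hk, hi]
  · exact fun h => absurd hk h

/-- The two vertices of an exchange lie on the line with direction `rho I i`. -/
theorem Exch.slack_eq {I J : τ.Bases} {i j : Fin n} (h : Exch I J i j) (θ : Fin r → ℤ) :
    slack J θ = slack I θ - (rho I i j * slack I θ j) • rho I i := by
  symm
  refine slack_unique (fun k hk => ?_) ?_
  · rw [Pi.sub_apply, Pi.smul_apply, smul_eq_mul]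
    by_cases hkj : k = j
    · subst hkj; linear_combination (-slack I θ k) * h.rho_sq
    · have hki : k ≠ i := by rintro rfl; exact h.notMem_right hk
      have hkI := (h.mem_right_iff hki hkj).1 hk
      rw [slack_mem hkI, rho_apply_mem hkI, if_neg (Ne.symm hki)]; ring
  · rw [Matrix.mulVec_sub, Matrix.mulVec_smul, b_mulVec_rho, b_mulVec_slack]; simp

end TorusSequence

/-! ### Gale duality of bases -/

namespace TorusSequence

variable {n r d : ℕ} {τ : TorusSequence n r d}

/-- The complement of a basis for the `a_i` is a basis for the `b_i`. -/
def Bases.compl (I : τ.Bases) : τ.dual.Bases :=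
  Bases.ofMulVec τ.dual I.1ᶜ
    (fun f hf h0 => by
      obtain ⟨y, rfl⟩ := (τ.dual.exact f).1 h0
      have hy : y = 0 := by
        refine I.ext_dotProduct fun i hi => ?_
        rw [zero_dotProduct, ← hf i (by simpa using hi)]
        exact (τ.transpose_a_mulVec y i).symm
      rw [hy, Matrix.mulVec_zero])
    (fun θ => ⟨slack I θ, fun k hk => slack_mem (by simpa using hk), b_mulVec_slack I θ⟩)

theorem Bases.mem_compl {I : τ.Bases} {k : Fin n} : k ∈ I.compl.1 ↔ k ∉ I.1 :=
  Finset.mem_compl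

/-- Gale duality: the complements of the bases for the `a_i` are the bases for the `b_i`. -/
def gale (τ : TorusSequence n r d) : τ.Bases ≃ τ.dual.Bases where
  toFun := Bases.compl
  invFun := Bases.compl (τ := τ.dual)
  left_inv I := Subtype.ext (compl_compl I.1)
  right_inv I := Subtype.ext (compl_compl I.1)

theorem alpha_compl {I : τ.Bases} {j : Fin n} (hj : j ∉ I.1) : alpha I.compl j = bet I j := by
  refine I.compl.ext_dotProduct fun k hk => ?_
  have hk' := Bases.mem_compl.1 hk
  rw [alpha_dotProduct_aVec hk]
  exact ((bet_dotProduct_bVec hj k).trans ((circ_notMem hk').trans (by simp [eq_comm]))).symm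

theorem rho_compl {I : τ.Bases} {j : Fin n} (hj : j ∉ I.1) : rho I.compl j = circ I j := by
  rw [rho, alpha_compl hj]; exact transpose_b_mulVec_bet hj

theorem circ_compl {I : τ.Bases} {i : Fin n} (hi : i ∈ I.1) : circ I.compl i = rho I i := by
  funext k
  by_cases hk : k ∈ I.1
  · rw [circ_notMem (by rw [Bases.mem_compl]; exact not_not.2 hk), rho_apply_mem hk]
    simp [eq_comm]
  · rw [circ_mem (Bases.mem_compl.2 hk), rho_compl hk, circ_mem hi, neg_neg]

theorem bet_compl {I : τ.Bases} {i : Fin n} (hi : i ∈ I.1) : bet I.compl i = alpha I i := by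
  have hi' : i ∉ I.compl.1 := by rw [Bases.mem_compl]; exact not_not.2 hi
  refine τ.dual.injective ?_
  exact (transpose_b_mulVec_bet hi').trans (circ_compl hi)

theorem Exch.compl {I J : τ.Bases} {i j : Fin n} (h : Exch I J i j) :
    Exch I.compl J.compl j i where
  mem := Bases.mem_compl.2 h.notMem
  notMem := by rw [Bases.mem_compl]; exact not_not.2 h.mem
  eq := by
    ext k
    rw [Bases.mem_compl, h.eq]
    simp only [Finset.mem_insert, Finset.mem_erase, Bases.mem_compl]
    by_cases hki : k = i
    · subst hki; simp [h.ne]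
    · simp [hki]

theorem card_eq (τ : TorusSequence n r d) : n = r + d := by
  have h1 : (τ.sec * τ.a).trace = d := by
    rw [Matrix.trace_mul_comm, τ.a_mul_sec, Matrix.trace_one, Fintype.card_fin]
  have h2 : (τ.bᵀ * τ.ret).trace = r := by
    rw [Matrix.trace_mul_comm, τ.ret_mul_b, Matrix.trace_one, Fintype.card_fin]
  have h3 := congrArg Matrix.trace τ.sec_mul_a_add
  rw [Matrix.trace_add, h1, h2, Matrix.trace_one, Fintype.card_fin] at h3
  exact_mod_cast (h3.symm.trans (add_comm _ _))

/-- A vector orthogonal to as many independent vectors as the rank vanishes. -/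
theorem eq_zero_of_dotProduct_aVec {I : Finset (Fin n)}
    (hI : LinearIndependent ℤ fun i : I => τ.aVec i) (hc : I.card = d) {x : Fin d → ℤ}
    (h : ∀ i ∈ I, x ⬝ᵥ τ.aVec i = 0) : x = 0 := by
  let e : Fin d ≃ I := (finCongr hc.symm).trans I.equivFin.symm
  let M : Matrix (Fin d) (Fin d) ℤ := fun k l => τ.aVec (e k) l
  by_contra hx
  have h1 : M.det = 0 := Matrix.exists_mulVec_eq_zero_iff.1 ⟨x, hx, by
    funext k
    change τ.aVec (e k) ⬝ᵥ x = 0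
    rw [dotProduct_comm]; exact h _ (e k).2⟩
  obtain ⟨v, hv, h0⟩ := Matrix.exists_vecMul_eq_zero_iff.2 h1
  have h2 : LinearIndependent ℤ (fun k => τ.aVec (e k)) := hI.comp e e.injective
  rw [Fintype.linearIndependent_iff] at h2
  refine hv (funext (h2 v ?_))
  rw [← h0]
  funext l
  simp [Matrix.vecMul, dotProduct, M]

/-- The complement of an independent set of `r` vectors `b_j` is an independent set of `d` vectors
`a_i`, hence a basis, and complements of bases are bases. -/
theorem IsUnimodular.dual (huni : τ.IsUnimodular) : τ.dual.IsUnimodular := by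
  intro I hI hc
  have hind : LinearIndependent ℤ (fun i : ↥(Iᶜ : Finset (Fin n)) => τ.aVec i) := by
    rw [linearIndependent_iff_mulVec]
    intro f hf h0
    obtain ⟨y, rfl⟩ := (τ.exact f).1 h0
    have hy : y = 0 := by
      refine eq_zero_of_dotProduct_aVec hI hc fun i hi => ?_
      rw [← hf i (by simpa using hi)]
      exact (τ.transpose_b_mulVec y i).symm
    rw [hy, Matrix.mulVec_zero]
  have hcard : (Iᶜ : Finset (Fin n)).card = d := by
    rw [Finset.card_compl, Fintype.card_fin, hc]
    have := τ.card_eq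
    omega
  have h := (Bases.compl (⟨Iᶜ, hind, huni _ hind hcard⟩ : τ.Bases)).2.2
  change Submodule.span ℤ (Set.range fun i : ↥(Iᶜᶜ : Finset (Fin n)) => τ.dual.aVec i) = ⊤ at h
  rwa [compl_compl] at h

/-- Every independent set of the `a_i` is contained in a basis. -/
theorem exists_bases_superset (huni : τ.IsUnimodular) {S : Finset (Fin n)}
    (hS : LinearIndependent ℤ fun i : S => τ.aVec i) : ∃ I : τ.Bases, S ⊆ I.1 := by
  classical
  let φ : (Fin d → ℤ) →ₗ[ℤ] (Fin d → ℚ) := (Int.castAddHom ℚ).toIntLinearMap.compLeft (Fin d)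
  have hφ : Function.Injective φ := fun x y h => by
    funext l; exact Int.cast_injective (congrFun h l)
  have key : ∀ T : Set (Fin n), LinearIndepOn ℤ τ.aVec T ↔ LinearIndepOn ℚ (φ ∘ τ.aVec) T := by
    intro T
    unfold LinearIndepOn
    rw [← LinearIndependent.iff_fractionRing ℤ ℚ]
    exact (φ.linearIndependent_iff_of_injOn hφ.injOn).symm
  obtain ⟨B, -, hSB, hB, hBi⟩ := exists_linearIndepOn_extension ((key S).1 hS)
    (Set.subset_univ _)
  have hBi' : LinearIndependent ℤ fun i : B.toFinset => τ.aVec i := by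
    have := (key B).2 hBi
    rw [← Set.coe_toFinset B] at this
    exact this
  have hspan : ⊤ ≤ Submodule.span ℚ (Set.range fun i : B => φ (τ.aVec i)) := by
    have h1 : ∀ v : Fin d → ℤ, φ v ∈ Submodule.span ℚ (Set.range fun i : B => φ (τ.aVec i)) := by
      intro v
      obtain ⟨f, rfl⟩ := τ.surjective v
      dsimp only
      rw [a_mulVec_eq_sum, map_sum]
      refine Submodule.sum_mem _ fun k _ => ?_
      rw [map_smul]
      refine Submodule.smul_of_tower_mem _ _ ?_
      have := hB ⟨k, Set.mem_univ _, rfl⟩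
      rwa [Set.image_eq_range] at this
    intro x _
    have : x = ∑ l, x l • φ (Pi.single l 1) := by
      funext m
      simp [φ, Pi.single_apply, Finset.sum_apply]
    rw [this]
    exact Submodule.sum_mem _ fun l _ => Submodule.smul_mem _ _ (h1 _)
  refine ⟨⟨B.toFinset, hBi', huni _ hBi' ?_⟩, fun k hk => by simpa using hSB hk⟩
  have := Module.finrank_eq_card_basis (Module.Basis.mk hBi hspan)
  rw [Set.toFinset_card]
  simpa using this.symm

theorem exists_bases_mem (huni : τ.IsUnimodular) {i : Fin n} (hi : τ.aVec i ≠ 0) :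
    ∃ I : τ.Bases, i ∈ I.1 := by
  have : LinearIndependent ℤ (fun k : ({i} : Finset (Fin n)) => τ.aVec k) := by
    rw [linearIndependent_iff_mulVec]
    intro f hf h0
    have h1 : τ.a *ᵥ f = f i • τ.aVec i := by
      rw [a_mulVec_eq_sum]
      exact Fintype.sum_eq_single i fun k hk => by rw [hf k (by simpa using hk), zero_smul]
    have h2 : f i = 0 := (smul_eq_zero.1 (h1.symm.trans h0)).resolve_right hi
    funext k
    by_cases hk : k = i
    · rw [hk, h2]; rfl
    · exact hf k (by simpa using hk)
  obtain ⟨I, hI⟩ := exists_bases_superset huni this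
  exact ⟨I, hI (by simp)⟩

/-- A nonzero `a_j` has a nonzero coefficient in each basis. -/
theorem exists_rho_ne_zero (I : τ.Bases) {j : Fin n} (hj : τ.aVec j ≠ 0) :
    ∃ i ∈ I.1, rho I i j ≠ 0 := by
  by_contra! h
  exact hj (I.eq_zero_of_alpha fun i hi => by rw [← rho_apply, h i hi])

/-! ### Moving along lines of the arrangement -/

/-- The vertices of `I` and `J = I ∖ i ∪ j` are joined by an edge of the arrangement: no other
hyperplane separates them. -/
def IsEdge (η : Fin r → ℤ) (I J : τ.Bases) (i j : Fin n) : Prop :=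
  Exch I J i j ∧ ∀ k ∉ I.1, k ≠ j → 0 < slack I η k * slack J η k

/-- Two bases that differ by one exchange are joined by a chain of edges on the line through the
two corresponding points of the arrangement: either no hyperplane separates them, or there is
a basis strictly in between. -/
theorem line_induction (huni : τ.IsUnimodular) {η : Fin r → ℤ} (hη : τ.IsGeneric η)
    (P : τ.Bases → τ.Bases → Prop) (edge : ∀ I J i j, IsEdge η I J i j → P I J)
    (split : ∀ I K J i k j, Exch I K i k → Exch I J i j → Exch K J k j →
      0 < (rho I i k * slack I η k) * (rho I i j * slack I η j - rho I i k * slack I η k) →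
      P I K → P K J → P I J) :
    ∀ I J i j, Exch I J i j → P I J := by
  suffices H : ∀ (N : ℕ) (I J : τ.Bases) (i j), Exch I J i j → (slack I η j).natAbs ≤ N → P I J from
    fun I J i j h => H _ I J i j h le_rfl
  intro N
  induction N with
  | zero =>
    intro I J i j h hN
    have := generic_bet_ne_zero huni hη h.notMem
    rw [← slack_notMem h.notMem] at this
    omega
  | succ N ih =>
    intro I J i j h hN
    by_cases hE : IsEdge η I J i j
    · exact edge I J i j hE
    simp only [IsEdge, h, true_and, not_forall, not_lt] at hE
    obtain ⟨k, hkI, hkj, hk⟩ := hE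
    have hki : k ≠ i := by rintro rfl; exact hkI h.mem
    have hIk : slack I η k ≠ 0 := by
      rw [slack_notMem hkI]; exact generic_bet_ne_zero huni hη hkI
    have hkJ : k ∉ J.1 := fun hh => hkI ((h.mem_right_iff hki hkj).1 hh)
    have hJk : slack J η k ≠ 0 := by
      rw [slack_notMem hkJ]; exact generic_bet_ne_zero huni hη hkJ
    have hlt : slack I η k * slack J η k < 0 := lt_of_le_of_ne hk (mul_ne_zero hIk hJk)
    have hJ := congrFun (h.slack_eq η) k
    simp only [Pi.sub_apply, Pi.smul_apply, smul_eq_mul] at hJ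
    have hρk : rho I i k ≠ 0 := by
      intro h0
      rw [h0, mul_zero, sub_zero] at hJ
      rw [hJ] at hlt
      nlinarith [mul_self_nonneg (slack I η k)]
    obtain ⟨K, hK⟩ := exists_exch huni h.mem hkI hρk
    have hρKj : rho K k j = rho I i k * rho I i j := by
      rw [hK.rho_eq_smul]; rfl
    have hjK : j ∉ K.1 := fun hh => h.notMem ((hK.mem_right_iff h.ne.symm (Ne.symm hkj)).1 hh)
    have hKJ : Exch K J k j := by
      refine ⟨hK.mem_right, hjK, ?_⟩
      rw [hK.eq, h.eq, Finset.erase_insert (by simp [hkI])]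
    have hKj := congrFun (hK.slack_eq η) j
    simp only [Pi.sub_apply, Pi.smul_apply, smul_eq_mul] at hKj
    have s1 := hK.rho_sq
    have s2 := h.rho_sq
    -- with signs removed, the parameters of `K` and `J` on the line are `p` and `q`
    set p := rho I i k * slack I η k with hp
    set q := rho I i j * slack I η j with hq
    have hpk : slack I η k = rho I i k * p := by rw [hp]; linear_combination (-slack I η k) * s1
    have hqj : slack I η j = rho I i j * q := by rw [hq]; linear_combination (-slack I η j) * s2
    have hpq : 0 < p * (q - p) := by
      have : slack I η k * slack J η k = -(p * (q - p)) := by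
        rw [hJ, hpk]; linear_combination (p * p - q * p) * s1
      omega
    have hqe : (slack I η j).natAbs = q.natAbs := by
      rw [hqj, Int.natAbs_mul]
      rcases Int.eq_one_or_neg_one_of_mul_eq_one s2 with e | e <;> simp [e]
    have hpe : (slack I η k).natAbs = p.natAbs := by
      rw [hpk, Int.natAbs_mul]
      rcases Int.eq_one_or_neg_one_of_mul_eq_one s1 with e | e <;> simp [e]
    have hKe : (slack K η j).natAbs = (q - p).natAbs := by
      have : slack K η j = rho I i j * (q - p) := by rw [hKj, hqj]; ring
      rw [this, Int.natAbs_mul]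
      rcases Int.eq_one_or_neg_one_of_mul_eq_one s2 with e | e <;> simp [e]
    have hcmp : p.natAbs < q.natAbs ∧ (q - p).natAbs < q.natAbs := by
      rcases pos_and_pos_or_neg_and_neg_of_mul_pos hpq with ⟨h1, h2⟩ | ⟨h1, h2⟩ <;> omega
    exact split I K J i k j hK h hKJ hpq (ih I K i k hK (by omega)) (ih K J k j hKJ (by omega))

end TorusSequence

/-! ### The order on the bases -/

namespace TorusSequence

variable {n r d : ℕ} {τ : TorusSequence n r d} (η : Fin r → ℤ) (ξ : Fin d → ℤ)

/-- The vector whose signs describe the region of the affine arrangement on which `ξ` is extremal at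
the vertex `J`. -/
def signVec (J : τ.Bases) : Fin n → ℤ := slack J η + slack J.compl ξ

/-- The vertex `I` lies on the closed region of the arrangement attached to the vertex `J`. -/
def Feas (I J : τ.Bases) : Prop := ∀ k ∉ I.1, 0 < slack I η k * signVec η ξ J k

/-- `J` arises from `I` by an exchange that decreases the value of `ξ`. -/
def Step (I J : τ.Bases) : Prop :=
  ∃ i j, Exch I J i j ∧ 0 < rho I i j * slack I η j * slack I.compl ξ i

/-- The value of `ξ` at the vertex `I`, up to a constant that does not depend on `I`. -/
def height (I : τ.Bases) : ℤ := (τ.sec *ᵥ ξ) ⬝ᵥ slack I η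

variable {η ξ}

theorem compl_compl_bases (I : τ.Bases) : (I.compl.compl : τ.Bases) = I :=
  Subtype.ext (compl_compl I.1)

theorem dualSlack_notMem {I : τ.Bases} {k : Fin n} (hk : k ∉ I.1) : slack I.compl ξ k = 0 :=
  slack_mem (Bases.mem_compl.2 hk)

theorem dualSlack_mem {I : τ.Bases} {k : Fin n} (hk : k ∈ I.1) :
    slack I.compl ξ k = ξ ⬝ᵥ alpha I k := by
  rw [slack_notMem (by rw [Bases.mem_compl]; exact not_not.2 hk), bet_compl hk]

theorem signVec_mem {J : τ.Bases} {k : Fin n} (hk : k ∈ J.1) :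
    signVec η ξ J k = slack J.compl ξ k := by
  rw [signVec, Pi.add_apply, slack_mem hk, zero_add]

theorem signVec_notMem {J : τ.Bases} {k : Fin n} (hk : k ∉ J.1) :
    signVec η ξ J k = slack J η k := by
  rw [signVec, Pi.add_apply, dualSlack_notMem hk, add_zero]

theorem a_mulVec_dualSlack (I : τ.Bases) (ξ : Fin d → ℤ) : τ.a *ᵥ slack I.compl ξ = ξ :=
  b_mulVec_slack I.compl ξ

theorem exists_slack_sub (I J : τ.Bases) (η : Fin r → ℤ) :
    ∃ χ : Fin d → ℤ, slack I η - slack J η = τ.aᵀ *ᵥ χ := by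
  obtain ⟨χ, h⟩ := (τ.dual.exact (slack I η - slack J η)).1 (by
    change τ.b *ᵥ _ = 0
    rw [Matrix.mulVec_sub, b_mulVec_slack, b_mulVec_slack, sub_self])
  exact ⟨χ, h.symm⟩

theorem dualSlack_dotProduct_slack (I : τ.Bases) : slack I.compl ξ ⬝ᵥ slack I η = 0 := by
  refine Finset.sum_eq_zero fun k _ => ?_
  by_cases hk : k ∈ I.1
  · rw [slack_mem hk, mul_zero]
  · rw [dualSlack_notMem hk, zero_mul]

/-- The values of `ξ` at two vertices differ by the pairing of one vertex with the dual vertex of the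
other, since a vertex is orthogonal to its own dual vertex. -/
theorem height_sub (I J : τ.Bases) :
    height η ξ I - height η ξ J = slack J.compl ξ ⬝ᵥ slack I η := by
  obtain ⟨χ, h⟩ := exists_slack_sub I J η
  rw [height, height, ← dotProduct_sub, h, ← dotProduct_a_mulVec, Matrix.mulVec_mulVec, τ.a_mul_sec,
    Matrix.one_mulVec]
  have h2 := dualSlack_dotProduct_slack (η := η) (ξ := ξ) J
  rw [← sub_zero (slack J.compl ξ ⬝ᵥ slack I η), ← h2, ← dotProduct_sub, h, ← dotProduct_a_mulVec,
    a_mulVec_dualSlack]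

theorem Exch.height_sub {I J : τ.Bases} {i j : Fin n} (h : Exch I J i j) :
    height η ξ I - height η ξ J = rho I i j * slack I η j * slack I.compl ξ i := by
  rw [height, height, ← dotProduct_sub, h.slack_eq, sub_sub_cancel, dotProduct_smul, rho,
    ← dotProduct_a_mulVec, Matrix.mulVec_mulVec, τ.a_mul_sec, Matrix.one_mulVec,
    dualSlack_mem h.mem, ← rho, smul_eq_mul]

theorem signVec_ne_zero (huni : τ.IsUnimodular) (hη : τ.IsGeneric η) (hξ : τ.dual.IsGeneric ξ)
    (J : τ.Bases) (k : Fin n) : signVec η ξ J k ≠ 0 := by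
  by_cases hk : k ∈ J.1
  · have hk' : k ∉ J.compl.1 := by rw [Bases.mem_compl]; exact not_not.2 hk
    rw [signVec_mem hk, slack_notMem hk']
    exact generic_bet_ne_zero huni.dual hξ hk'
  · rw [signVec_notMem hk, slack_notMem hk]
    exact generic_bet_ne_zero huni hη hk

theorem exists_mem_notMem {I J : τ.Bases} (h : I ≠ J) : ∃ k ∈ J.1, k ∉ I.1 := by
  by_contra! hh
  exact h (Bases.ext (Finset.eq_of_subset_of_card_le hh (by rw [I.card, J.card])).symm)

/-- On the region attached to `J`, the value of `ξ` is minimal exactly at `J`. -/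
theorem Feas.height_lt {I J : τ.Bases} (h : Feas η ξ I J) (hne : I ≠ J) :
    height η ξ J < height η ξ I := by
  have : 0 < height η ξ I - height η ξ J := by
    rw [height_sub]
    obtain ⟨k, hkJ, hkI⟩ := exists_mem_notMem hne
    refine Finset.sum_pos' (fun l _ => ?_) ⟨k, Finset.mem_univ _, ?_⟩
    · by_cases hlI : l ∈ I.1
      · rw [slack_mem hlI, mul_zero]
      · by_cases hlJ : l ∈ J.1
        · rw [← signVec_mem hlJ (η := η), mul_comm]; exact (h l hlI).le
        · rw [dualSlack_notMem hlJ, zero_mul]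
    · rw [← signVec_mem hkJ (η := η), mul_comm]; exact h k hkI
  omega

/-- One pivot of the simplex method: a vertex of the region of `J` that is not `J` is joined by
a descending edge to another vertex of this region. -/
theorem Feas.exists_step (huni : τ.IsUnimodular) (hη : τ.IsGeneric η) (hξ : τ.dual.IsGeneric ξ)
    {I J : τ.Bases} (h : Feas η ξ I J) (hne : I ≠ J) :
    ∃ K, Step η ξ I K ∧ Feas η ξ K J := by
  classical
  set ε := signVec η ξ J with hε
  have hε0 : ∀ k, ε k ≠ 0 := signVec_ne_zero huni hη hξ J
  -- a hyperplane through `I` such that `ξ` decreases when it is left into the region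
  obtain ⟨i, hi, hiε⟩ : ∃ i ∈ I.1, ε i * slack I.compl ξ i < 0 := by
    by_contra! hh
    have h1 := h.height_lt hne
    have h2 : 0 ≤ slack I.compl ξ ⬝ᵥ slack J η := by
      refine Finset.sum_nonneg fun k _ => ?_
      by_cases hkI : k ∈ I.1
      · by_cases hkJ : k ∈ J.1
        · rw [slack_mem hkJ, mul_zero]
        · have := hh k hkI
          rwa [hε, signVec_notMem hkJ, mul_comm] at this
      · rw [dualSlack_notMem hkI, zero_mul]
    rw [← height_sub] at h2
    omega
  -- the value of `ξ` is bounded below on the region, so the line meets another hyperplane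
  have hne_set : (Finset.univ.filter fun j => j ∉ I.1 ∧ ε j * ε i * rho I i j < 0).Nonempty := by
    by_contra hh
    rw [Finset.not_nonempty_iff_eq_empty, Finset.filter_eq_empty_iff] at hh
    have h1 : 0 ≤ slack J.compl ξ ⬝ᵥ (ε i • rho I i) := by
      refine Finset.sum_nonneg fun k _ => ?_
      rw [Pi.smul_apply, smul_eq_mul]
      by_cases hkJ : k ∈ J.1
      · rw [← signVec_mem hkJ (η := η), ← hε]
        by_cases hkI : k ∈ I.1
        · rw [rho_apply_mem hkI]
          split_ifs with hik
          · rw [hik, mul_one]; exact mul_self_nonneg _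
          · simp
        · have := hh (Finset.mem_univ k)
          push Not at this
          rw [← mul_assoc]; exact this hkI
      · rw [dualSlack_notMem hkJ, zero_mul]
    rw [dotProduct_smul, rho, ← dotProduct_a_mulVec, a_mulVec_dualSlack, ← dualSlack_mem hi,
      smul_eq_mul] at h1
    omega
  -- the first hyperplane that is met; all entries of `rho` are `± 1`, so that the distances are given
  -- by the entries of the vertex
  obtain ⟨j, hj, hmin⟩ := Finset.exists_min_image _ (fun j => (slack I η j).natAbs) hne_set
  obtain ⟨hjI, hjε⟩ := (Finset.mem_filter.1 hj).2
  obtain ⟨K, hK⟩ := exists_exch huni hi hjI (by rintro h0; simp [h0] at hjε)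
  have hvj := h j hjI
  rw [← hε] at hvj
  have s := Int.eq_one_or_neg_one_of_mul_eq_one hK.rho_sq
  refine ⟨K, ⟨i, j, hK, ?_⟩, fun k hk => ?_⟩
  · have h1 : 0 < (ε j * ε i * rho I i j) * (ε i * slack I.compl ξ i) := mul_pos_of_neg_of_neg hjε hiε
    have h2 := mul_pos h1 hvj
    have h3 : 0 < (ε i * ε j) ^ 2 := by have := mul_ne_zero (hε0 i) (hε0 j); positivity
    refine pos_of_mul_pos_right (a := (ε i * ε j) ^ 2) ?_ h3.le
    convert h2 using 1; ring
  · have hKk := congrFun (hK.slack_eq η) k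
    simp only [Pi.sub_apply, Pi.smul_apply, smul_eq_mul] at hKk
    rw [← hε]
    -- the sign of the direction in which the vertex moves
    have hd : 0 < -(rho I i j * slack I η j) * ε i := by
      have h3 : 0 < (ε j) ^ 2 := by have := hε0 j; positivity
      have h1 : 0 < -(ε j * ε i * rho I i j) * (slack I η j * ε j) := mul_pos (by omega) hvj
      exact pos_of_mul_pos_right (a := ε j ^ 2) (h1.trans_eq (by ring)) h3.le
    by_cases hki : k = i
    · subst hki
      rw [hKk, slack_mem hi, rho_apply_mem hi, if_pos rfl]
      simpa using hd
    · have hkj : k ≠ j := by rintro rfl; exact hk hK.mem_right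
      have hkI : k ∉ I.1 := fun hh => hk ((hK.mem_right_iff hki hkj).2 hh)
      have hvk := h k hkI
      rw [← hε] at hvk
      have hne0 : slack K η k ≠ 0 := by
        rw [slack_notMem hk]; exact generic_bet_ne_zero huni hη hk
      refine lt_of_le_of_ne ?_ (mul_ne_zero hne0 (hε0 k)).symm
      rw [hKk]
      by_cases hkε : ε k * ε i * rho I i k < 0
      · have hm := hmin k (Finset.mem_filter.2 ⟨Finset.mem_univ _, hkI, hkε⟩)
        rcases rho_eq huni hi k with e | e | e
        · simp [e] at hkε
        all_goals
          rw [e]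
          rcases s with e2 | e2 <;> rw [e2] <;>
          rcases lt_or_gt_of_ne (hε0 k) with hs | hs
          all_goals
            first
            | (refine mul_nonneg_of_nonpos_of_nonpos ?_ hs.le
               have := neg_of_mul_pos_left hvk hs.le
               omega)
            | (refine mul_nonneg ?_ hs.le
               have := pos_of_mul_pos_left hvk hs.le
               omega)
      · have h3 : 0 < (ε i) ^ 2 := by have := hε0 i; positivity
        have h1 : 0 ≤ (-(rho I i j * slack I η j) * ε i) * (ε k * ε i * rho I i k) :=
          mul_nonneg hd.le (not_lt.1 hkε)
        have h2 : 0 ≤ -(rho I i j * slack I η j) * rho I i k * ε k := by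
          exact nonneg_of_mul_nonneg_right (a := ε i ^ 2) (h1.trans_eq (by ring)) h3
        linarith [h2, hvk]

/-- The simplex method: the pivots lead from any vertex of the region of `J` to `J`, as the value of
`ξ` decreases. -/
theorem Feas.reflTransGen_step (huni : τ.IsUnimodular) (hη : τ.IsGeneric η)
    (hξ : τ.dual.IsGeneric ξ) {I J : τ.Bases} (h : Feas η ξ I J) :
    Relation.ReflTransGen (Step η ξ) I J := by
  generalize hN : (height η ξ I - height η ξ J).toNat = N
  induction N using Nat.strong_induction_on generalizing I with
  | _ N ih =>
    by_cases hne : I = J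
    · rw [hne]
    · obtain ⟨K, hK, hKJ⟩ := h.exists_step huni hη hξ hne
      refine Relation.ReflTransGen.head hK (ih _ ?_ hKJ rfl)
      obtain ⟨i, j, he, hpos⟩ := hK
      have h1 := he.height_sub (η := η) (ξ := ξ)
      have h2 := h.height_lt hne
      omega

/-- A descending exchange is a chain of descending edges, and the upper vertex of a descending edge
lies on the region attached to the lower one. -/
theorem reflTransGen_feas_of_step (huni : τ.IsUnimodular) (hη : τ.IsGeneric η)
    {I J : τ.Bases} (h : Step η ξ I J) : Relation.ReflTransGen (Feas η ξ) I J := by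
  obtain ⟨i, j, he, hpos⟩ := h
  have hlt : height η ξ J < height η ξ I := by
    have := he.height_sub (η := η) (ξ := ξ); omega
  revert hlt
  refine line_induction huni hη
    (fun I J => height η ξ J < height η ξ I → Relation.ReflTransGen (Feas η ξ) I J) ?_ ?_ I J i j he
  · intro I J i j hE hlt
    refine Relation.ReflTransGen.single fun k hk => ?_
    have he := hE.1
    by_cases hkj : k = j
    · subst hkj
      rw [signVec_mem he.mem_right, dualSlack_mem he.mem_right, he.symm.alpha_eq_smul, he.rho_symm,
        dotProduct_smul, ← dualSlack_mem he.mem, smul_eq_mul]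
      have := he.height_sub (η := η) (ξ := ξ)
      have h2 : 0 < rho I i k * slack I η k * slack I.compl ξ i := by omega
      convert h2 using 1; ring
    · have hki : k ≠ i := by rintro rfl; exact hk he.mem
      rw [signVec_notMem fun hh => hk ((he.mem_right_iff hki hkj).1 hh)]
      exact hE.2 k hk hkj
  · intro I K J i k j hIK hIJ _ hpq h1 h2 hlt
    have e1 := hIK.height_sub (η := η) (ξ := ξ)
    have e2 := hIJ.height_sub (η := η) (ξ := ξ)
    have h3 : 0 < (rho I i j * slack I η j) * slack I.compl ξ i := by omega
    have h4 : height η ξ K < height η ξ I ∧ height η ξ J < height η ξ K := by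
      set p := rho I i k * slack I η k
      set q := rho I i j * slack I η j
      set c := slack I.compl ξ i
      have : 0 < p * c ∧ 0 < (q - p) * c := by
        rcases pos_and_pos_or_neg_and_neg_of_mul_pos hpq with ⟨a, b⟩ | ⟨a, b⟩
        · have : 0 < c := pos_of_mul_pos_right h3 (by omega)
          exact ⟨mul_pos a this, mul_pos b this⟩
        · have : c < 0 := neg_of_mul_pos_right h3 (by omega)
          exact ⟨mul_pos_of_neg_of_neg a this, mul_pos_of_neg_of_neg b this⟩
      have h5 : (q - p) * c = q * c - p * c := by ring
      omega
    exact (h1 h4.1).trans (h2 h4.2)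

/-- The order generated by the incidence of vertices and regions is generated by the descending
exchanges.  The latter condition is self-dual. -/
theorem reflTransGen_feas_iff (huni : τ.IsUnimodular) (hη : τ.IsGeneric η)
    (hξ : τ.dual.IsGeneric ξ) {I J : τ.Bases} :
    Relation.ReflTransGen (Feas η ξ) I J ↔ Relation.ReflTransGen (Step η ξ) I J := by
  constructor
  · intro h
    induction h with
    | refl => exact .refl
    | tail _ h ih => exact ih.trans (h.reflTransGen_step huni hη hξ)
  · intro h
    induction h with
    | refl => exact .refl
    | tail _ h ih => exact ih.trans (reflTransGen_feas_of_step huni hη h)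

theorem Step.compl {I J : τ.Bases} (h : Step η ξ I J) : Step (τ := τ.dual) ξ η J.compl I.compl := by
  obtain ⟨i, j, he, hpos⟩ := h
  refine ⟨i, j, he.symm.compl, ?_⟩
  have h1 : slack J η i = -(rho I i j * slack I η j) := by
    rw [he.slack_eq, Pi.sub_apply, slack_mem he.mem, Pi.smul_apply, rho_apply_mem he.mem]
    simp
  have h2 : slack (J.compl.compl : τ.Bases) η i = slack J η i :=
    congrArg (fun K : τ.Bases => slack K η i) (compl_compl_bases J)
  refine hpos.trans_eq ?_
  rw [h2, rho_compl he.notMem_right, circ_mem he.mem_right, he.rho_symm, h1,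
    dualSlack_mem he.mem_right, he.symm.alpha_eq_smul, he.rho_symm, dotProduct_smul,
    ← dualSlack_mem he.mem, smul_eq_mul]
  linear_combination (-(rho I i j * slack I η j * slack I.compl ξ i)) * he.rho_sq

/-- Gale duality reverses the order generated by `Feas`. -/
theorem reflTransGen_feas_compl_iff (huni : τ.IsUnimodular) (hη : τ.IsGeneric η)
    (hξ : τ.dual.IsGeneric ξ) {I J : τ.Bases} :
    Relation.ReflTransGen (Feas η ξ) I J ↔
      Relation.ReflTransGen (Feas (τ := τ.dual) ξ η) J.compl I.compl := by
  rw [reflTransGen_feas_iff huni hη hξ, reflTransGen_feas_iff (τ := τ.dual) huni.dual hξ hη]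
  constructor
  · intro h
    induction h with
    | refl => exact .refl
    | tail _ h ih => exact .head h.compl ih
  · intro h
    have key : ∀ {A B : τ.dual.Bases}, Relation.ReflTransGen (Step (τ := τ.dual) ξ η) A B →
        Relation.ReflTransGen (Step η ξ) (B.compl : τ.Bases) (A.compl : τ.Bases) := by
      intro A B h
      induction h with
      | refl => exact .refl
      | tail _ h ih => exact .head (Step.compl (τ := τ.dual) h) ih
    have := key h
    rwa [compl_compl_bases, compl_compl_bases] at this

end TorusSequence

open TorusSequence

/-! ### Characters of tori -/

theorem torusChar_add {e : ℕ} (v w : Fin e → ℤ) (h : Torus e) :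
    torusChar (v + w) h = torusChar v h * torusChar w h := by
  simp [torusChar, zpow_add, Finset.prod_mul_distrib]

theorem torusChar_zero {e : ℕ} (h : Torus e) : torusChar (0 : Fin e → ℤ) h = 1 := by
  simp [torusChar]

theorem torusChar_neg {e : ℕ} (w : Fin e → ℤ) (h : Torus e) :
    torusChar (-w) h = (torusChar w h)⁻¹ := by
  simp [torusChar]

theorem torusChar_zsmul {e : ℕ} (m : ℤ) (w : Fin e → ℤ) (h : Torus e) :
    torusChar (m • w) h = torusChar w h ^ m := by
  simp [torusChar, Finset.prod_zpow, zpow_mul, mul_comm m]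

theorem torusChar_mul {e : ℕ} (w : Fin e → ℤ) (g h : Torus e) :
    torusChar w (g * h) = torusChar w g * torusChar w h := by
  simp [torusChar, mul_zpow, Finset.prod_mul_distrib]

theorem torusChar_one {e : ℕ} (w : Fin e → ℤ) : torusChar w (1 : Torus e) = 1 := by
  simp [torusChar]

theorem torusChar_inv {e : ℕ} (w : Fin e → ℤ) (h : Torus e) :
    torusChar w h⁻¹ = (torusChar w h)⁻¹ := by
  simp [torusChar]

theorem torusChar_torusHom {k m : ℕ} (M : Matrix (Fin m) (Fin k) ℤ) (w : Fin m → ℤ)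
    (u : Torus k) : torusChar w (torusHom M u) = torusChar (Mᵀ *ᵥ w) u := by
  change ∏ i, (∏ j, u j ^ M i j) ^ w i = ∏ j, u j ^ (Mᵀ *ᵥ w) j
  simp only [← Finset.prod_zpow, ← zpow_mul]
  rw [Finset.prod_comm]
  exact Finset.prod_congr rfl fun j _ => prod_zpow_index _ _ _

theorem torusChar_oneParam {e : ℕ} (w ξ : Fin e → ℤ) (s : ℂˣ) :
    torusChar w (oneParam ξ s) = s ^ (w ⬝ᵥ ξ) := by
  simp only [torusChar, oneParam, ← zpow_mul, dotProduct, mul_comm (w _)]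
  exact prod_zpow_index _ _ _

theorem zpow_two_injective {a b : ℤ} (h : (Units.mk0 (2 : ℂ) two_ne_zero) ^ a =
    (Units.mk0 (2 : ℂ) two_ne_zero) ^ b) : a = b := by
  have h1 := congrArg (fun u : ℂˣ => ‖(u : ℂ)‖) h
  simp only [Units.val_zpow_eq_zpow_val, Units.val_mk0, norm_zpow, Complex.norm_ofNat] at h1
  exact zpow_right_injective₀ (by norm_num) (by norm_num) h1

theorem torusChar_injective {e : ℕ} {v w : Fin e → ℤ} (h : ∀ t, torusChar v t = torusChar w t) :
    v = w := by
  funext l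
  have := h (oneParam (Pi.single l 1) (Units.mk0 2 two_ne_zero))
  simp only [torusChar_oneParam, dotProduct_single, mul_one] at this
  exact zpow_two_injective this

theorem bigChar_injective {e : ℕ} {v w : (Fin e → ℤ) × ℤ} (h : ∀ t, bigChar v t = bigChar w t) :
    v = w := by
  refine Prod.ext (torusChar_injective fun t => ?_) ?_
  · simpa [bigChar] using h (t, 1)
  · have := h (1, Units.mk0 2 two_ne_zero)
    simp only [bigChar, torusChar_one, one_mul] at this
    exact zpow_two_injective this

theorem exists_torusChar_ne_one {e : ℕ} {w : Fin e → ℤ} (hw : w ≠ 0) :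
    ∃ h, torusChar w h ≠ 1 := by
  by_contra! hh
  exact hw (torusChar_injective fun t => by rw [hh, torusChar_zero])

theorem scale_inl {n : ℕ} (t : BigTorus n) (i : Fin n) : scale t (Sum.inl i) = t.2⁻¹ * t.1 i := rfl

theorem scale_inr {n : ℕ} (t : BigTorus n) (i : Fin n) :
    scale t (Sum.inr i) = t.2⁻¹ * (t.1 i)⁻¹ := rfl

section Chart

variable {n r d : ℕ} {τ : TorusSequence n r d}

theorem inS_fst (s : Torus r) (i : Fin n) : (inS τ s).1 i = torusChar (τ.bVec i) s := rfl

theorem inS_snd (s : Torus r) : (inS τ s).2 = 1 := rfl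

theorem torusChar_inS (w : Fin n → ℤ) (s : Torus r) :
    torusChar w (inS τ s).1 = torusChar (τ.b *ᵥ w) s := torusChar_torusHom _ _ _

theorem toH_surjective : Function.Surjective (toH τ) := fun t => ⟨liftTorus τ t, by
  refine Prod.ext ?_ rfl
  change torusHom τ.a (torusHom τ.sec t.1) = t.1
  rw [← torusHom_mul, τ.a_mul_sec, torusHom_one]⟩

theorem torusChar_toH (x : Fin d → ℤ) (t : BigTorus n) :
    torusChar x (toH τ t).1 = torusChar (τ.aᵀ *ᵥ x) t.1 := torusChar_torusHom _ _ _

/-- The standing assumptions: `τ` is unimodular, the `a_i` are nonzero, and `η` is generic. -/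
class Nondeg (τ : TorusSequence n r d) (η : Fin r → ℤ) : Prop where
  uni : τ.IsUnimodular
  ne_zero : ∀ i, τ.aVec i ≠ 0
  gen : τ.IsGeneric η

/-! ### The charts -/

variable (η : Fin r → ℤ)

/-- The sign of `⟨η, β^I_j⟩` for `j ∉ I`. -/
def sg (I : τ.Bases) (j : Fin n) : ℤ := if 0 < η ⬝ᵥ bet I j then 1 else -1

/-- The coordinate of index `j` that does not vanish on the chart of `I`, for `j ∉ I`. -/
def sel (I : τ.Bases) (j : Fin n) : Fin n ⊕ Fin n :=
  if 0 < η ⬝ᵥ bet I j then Sum.inl j else Sum.inr j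

/-- The points over the chart of `I`. -/
def InChart (I : τ.Bases) (z : Pt n) : Prop := ∀ j ∉ I.1, z (sel η I j) ≠ 0

/-- The invertible coordinates on the chart. -/
def selU (I : τ.Bases) (z : Pt n) (j : Fin n) : ℂˣ :=
  if h : z (sel η I j) ≠ 0 then Units.mk0 _ h else 1

/-- The Laurent monomial of `S`-weight `θ` in the coordinates that are invertible on the chart. -/
def mono (I : τ.Bases) (θ : Fin r → ℤ) (z : Pt n) : ℂˣ :=
  ∏ k, selU η I z k ^ (sg η I k * slack I θ k)

variable {η}

theorem sg_mul_sg (I : τ.Bases) (j : Fin n) : sg η I j * sg η I j = 1 := by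
  unfold sg; split_ifs <;> rfl

theorem scale_sel (I : τ.Bases) (t : BigTorus n) (k : Fin n) :
    scale t (sel η I k) = t.2⁻¹ * t.1 k ^ sg η I k := by
  unfold sel sg
  split_ifs
  · rw [scale_inl, zpow_one]
  · rw [scale_inr, zpow_neg_one]

theorem InChart.act {I : τ.Bases} {z : Pt n} (h : InChart η I z) (t : BigTorus n) :
    InChart η I (ptAct t z) := fun j hj => mul_ne_zero (Units.ne_zero _) (h j hj)

theorem selU_val {I : τ.Bases} {z : Pt n} (h : InChart η I z) {j : Fin n} (hj : j ∉ I.1) :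
    (selU η I z j : ℂ) = z (sel η I j) := by
  rw [selU, dif_pos (h j hj), Units.val_mk0]

theorem selU_act {I : τ.Bases} {z : Pt n} (h : InChart η I z) {j : Fin n} (hj : j ∉ I.1)
    (t : BigTorus n) : selU η I (ptAct t z) j = scale t (sel η I j) * selU η I z j := by
  ext
  rw [selU_val (h.act t) hj, Units.val_mul, selU_val h hj]
  rfl

/-- The weight of `𝕊` on the monomial of `S`-weight `θ` is the negative of this number. -/
def monoDeg (η : Fin r → ℤ) (I : τ.Bases) (θ : Fin r → ℤ) : ℤ := ∑ k, sg η I k * slack I θ k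

theorem mono_act {I : τ.Bases} {z : Pt n} (h : InChart η I z) (θ : Fin r → ℤ) (t : BigTorus n) :
    mono η I θ (ptAct t z) =
      torusChar (slack I θ) t.1 * t.2 ^ (-monoDeg η I θ) * mono η I θ z := by
  have h1 : ∀ k, selU η I (ptAct t z) k ^ (sg η I k * slack I θ k) =
      t.1 k ^ slack I θ k * t.2 ^ (-(sg η I k * slack I θ k)) *
        selU η I z k ^ (sg η I k * slack I θ k) := by
    intro k
    by_cases hk : k ∈ I.1
    · simp [slack_mem hk]
    · rw [selU_act h hk, scale_sel, mul_zpow, mul_zpow, ← zpow_mul, ← mul_assoc (sg η I k),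
        sg_mul_sg, one_mul, inv_zpow', mul_comm (t.2 ^ _)]
  rw [mono, Finset.prod_congr rfl fun k _ => h1 k, Finset.prod_mul_distrib,
    Finset.prod_mul_distrib, prod_zpow_index, Finset.sum_neg_distrib]
  rfl

theorem mono_inS {I : τ.Bases} {z : Pt n} (h : InChart η I z) (θ : Fin r → ℤ) (s : Torus r) :
    mono η I θ (ptAct (inS τ s) z) = torusChar θ s * mono η I θ z := by
  rw [mono_act h, torusChar_inS, b_mulVec_slack, inS_snd, one_zpow, mul_one]

theorem slack_add (I : τ.Bases) (θ θ₂ : Fin r → ℤ) :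
    slack I (θ + θ₂) = slack I θ + slack I θ₂ := by
  symm
  refine slack_unique (fun k hk => ?_) ?_
  · rw [Pi.add_apply, slack_mem hk, slack_mem hk, add_zero]
  · rw [Matrix.mulVec_add, b_mulVec_slack, b_mulVec_slack]

theorem slack_zsmul (I : τ.Bases) (m : ℤ) (θ : Fin r → ℤ) :
    slack I (m • θ) = m • slack I θ := by
  symm
  refine slack_unique (fun k hk => ?_) ?_
  · rw [Pi.smul_apply, slack_mem hk, smul_zero]
  · rw [Matrix.mulVec_smul, b_mulVec_slack]

theorem mono_add (I : τ.Bases) (θ θ₂ : Fin r → ℤ) (z : Pt n) :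
    mono η I (θ + θ₂) z = mono η I θ z * mono η I θ₂ z := by
  rw [mono, mono, mono, ← Finset.prod_mul_distrib, slack_add]
  exact Finset.prod_congr rfl fun k _ => by rw [Pi.add_apply, mul_add, zpow_add]

theorem mono_zsmul (I : τ.Bases) (m : ℤ) (θ : Fin r → ℤ) (z : Pt n) :
    mono η I (m • θ) z = mono η I θ z ^ m := by
  rw [mono, mono, ← Finset.prod_zpow, slack_zsmul]
  refine Finset.prod_congr rfl fun k _ => ?_
  rw [← zpow_mul, Pi.smul_apply, smul_eq_mul]; congr 1; ring

theorem mono_zero (I : τ.Bases) (z : Pt n) : mono η I 0 z = 1 := by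
  simpa using mono_zsmul (η := η) I 0 0 z

theorem mono_neg (I : τ.Bases) (θ : Fin r → ℤ) (z : Pt n) :
    mono η I (-θ) z = (mono η I θ z)⁻¹ := by
  simpa using mono_zsmul (η := η) I (-1) θ z

theorem slack_bVec {I : τ.Bases} {j : Fin n} (hj : j ∉ I.1) :
    slack I (τ.bVec j) = Pi.single j 1 := by
  symm
  refine slack_unique (fun k hk => ?_) ?_
  · rw [Pi.single_eq_of_ne]; rintro rfl; exact hj hk
  · rw [Matrix.mulVec_single_one]; rfl

theorem mono_bVec {I : τ.Bases} {j : Fin n} (hj : j ∉ I.1) (z : Pt n) :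
    mono η I (τ.bVec j) z = selU η I z j ^ sg η I j := by
  rw [mono, Fintype.prod_eq_single j, slack_bVec hj, Pi.single_eq_same, mul_one]
  intro k hk
  rw [slack_bVec hj, Pi.single_eq_of_ne hk, mul_zero, zpow_zero]

variable (η)

/-- The element of `S` that moves a point over the chart to the slice on which the invertible
coordinates are `1`. -/
def shift (I : τ.Bases) (z : Pt n) : Torus r := fun l => mono η I (-Pi.single l 1) z

variable {η}

theorem torusChar_shift (I : τ.Bases) (z : Pt n) (θ : Fin r → ℤ) :
    torusChar θ (shift η I z) = (mono η I θ z)⁻¹ := by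
  have h : ∀ s : Finset (Fin r), mono η I (∑ l ∈ s, θ l • Pi.single l 1) z =
      ∏ l ∈ s, mono η I (Pi.single l 1) z ^ θ l := by
    intro s
    classical
    induction s using Finset.induction_on with
    | empty => simp [mono_zero]
    | insert a s ha ih =>
      rw [Finset.sum_insert ha, Finset.prod_insert ha, mono_add, mono_zsmul, ih]
  have h1 : θ = ∑ l, θ l • Pi.single l (1 : ℤ) := by
    funext m; simp [Finset.sum_apply, Pi.single_apply]
  conv_rhs => rw [h1, h]
  simp [torusChar, shift, mono_neg]

theorem shift_inS {I : τ.Bases} {z : Pt n} (h : InChart η I z) (s : Torus r) :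
    shift η I (ptAct (inS τ s) z) = shift η I z * s⁻¹ := by
  funext l
  rw [shift, mono_inS h, Pi.mul_apply, mul_comm, shift, torusChar_neg]
  congr 2
  simp [torusChar, Pi.single_apply, apply_ite]

/-- The representative of a point on the slice. -/
def normPt (η : Fin r → ℤ) (I : τ.Bases) (z : Pt n) : Pt n := ptAct (inS τ (shift η I z)) z

theorem normPt_inS {I : τ.Bases} {z : Pt n} (h : InChart η I z) (s : Torus r) :
    normPt η I (ptAct (inS τ s) z) = normPt η I z := by
  rw [normPt, shift_inS h, ← ptAct_mul, ← map_mul, inv_mul_cancel_right]; rfl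

theorem normPt_inl (I : τ.Bases) (z : Pt n) (k : Fin n) :
    normPt η I z (Sum.inl k) = ((mono η I (τ.bVec k) z)⁻¹ : ℂˣ) * z (Sum.inl k) := by
  rw [normPt, ptAct, scale_inl, inS_snd, inS_fst, torusChar_shift, inv_one, one_mul]

theorem normPt_inr (I : τ.Bases) (z : Pt n) (k : Fin n) :
    normPt η I z (Sum.inr k) = (mono η I (τ.bVec k) z : ℂˣ) * z (Sum.inr k) := by
  rw [normPt, ptAct, scale_inr, inS_snd, inS_fst, torusChar_shift, inv_one, one_mul, inv_inv]

theorem normPt_sel {I : τ.Bases} {z : Pt n} (h : InChart η I z) {j : Fin n} (hj : j ∉ I.1) :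
    normPt η I z (sel η I j) = 1 := by
  have h1 := selU_val h hj
  have h2 := mono_bVec (η := η) hj z
  by_cases hp : 0 < η ⬝ᵥ bet I j
  · simp only [sel, sg, if_pos hp] at h1 h2 ⊢
    rw [normPt_inl, h2, zpow_one, ← h1, Units.inv_mul]
  · simp only [sel, sg, if_neg hp] at h1 h2 ⊢
    rw [normPt_inr, h2, zpow_neg_one, ← h1, Units.inv_mul]

/-- The index set of the coordinates on the chart of `I`. -/
abbrev Idx (I : τ.Bases) : Type := ↥I.1 ⊕ ↥I.1

/-- The coordinate of `T^*ℂ^n` with an index of the chart. -/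
def Idx.incl {I : τ.Bases} : Idx I → Fin n ⊕ Fin n := Sum.map Subtype.val Subtype.val

/-- The polynomial that expresses `x_k y_k`, `k ∉ I`, on the zero level of the moment map. -/
def quadric (I : τ.Bases) (k : Fin n) : MvPolynomial (Idx I) ℂ :=
  ∑ i : I.1, MvPolynomial.C ((rho I i k : ℤ) : ℂ) *
    (MvPolynomial.X (Sum.inl i) * MvPolynomial.X (Sum.inr i))

variable (η)

/-- The coordinates of `T^*ℂ^n` on the slice, as polynomials in the coordinates of the chart. -/
def slicePoly (I : τ.Bases) : Fin n ⊕ Fin n → MvPolynomial (Idx I) ℂ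
  | Sum.inl k => if hk : k ∈ I.1 then MvPolynomial.X (Sum.inl ⟨k, hk⟩) else
      if 0 < η ⬝ᵥ bet I k then 1 else quadric I k
  | Sum.inr k => if hk : k ∈ I.1 then MvPolynomial.X (Sum.inr ⟨k, hk⟩) else
      if 0 < η ⬝ᵥ bet I k then quadric I k else 1

/-- The point of the slice with given chart coordinates. -/
def slicePt (I : τ.Bases) (u : Idx I → ℂ) : Pt n := fun k => (slicePoly η I k).eval u

variable {η}

theorem slicePoly_incl (I : τ.Bases) (κ : Idx I) :
    slicePoly η I κ.incl = MvPolynomial.X κ := by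
  rcases κ with ⟨k, hk⟩ | ⟨k, hk⟩ <;> simp [Idx.incl, slicePoly, hk]

theorem slicePt_incl (I : τ.Bases) (u : Idx I → ℂ) (κ : Idx I) : slicePt η I u κ.incl = u κ := by
  rw [slicePt, slicePoly_incl, MvPolynomial.eval_X]

theorem slicePt_sel {I : τ.Bases} (u : Idx I → ℂ) {j : Fin n} (hj : j ∉ I.1) :
    slicePt η I u (sel η I j) = 1 := by
  by_cases hp : 0 < η ⬝ᵥ bet I j <;> simp [sel, slicePt, slicePoly, hj, hp]

theorem inChart_slicePt (I : τ.Bases) (u : Idx I → ℂ) : InChart η I (slicePt η I u) :=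
  fun j hj => by rw [slicePt_sel u hj]; exact one_ne_zero

/-- The zero level of the moment map, in terms of the products `x_k y_k`. -/
theorem moment_eq_zero_iff (I : τ.Bases) (z : Pt n) : moment τ z = 0 ↔ ∀ j ∉ I.1,
    z (Sum.inl j) * z (Sum.inr j) =
      ∑ i : I.1, (rho I i j : ℂ) * (z (Sum.inl i.1) * z (Sum.inr i.1)) := by
  set c : Fin n → ℂ := fun k => z (Sum.inl k) * z (Sum.inr k) with hc
  constructor
  · intro h j hj
    have h1 : ∑ k, c k * (circ I j k : ℂ) = 0 := by
      have h2 : ∀ k, c k * (circ I j k : ℂ) = ∑ l, c k * (τ.bVec k l : ℂ) * (bet I j l : ℂ) := by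
        intro k
        rw [← bet_dotProduct_bVec hj]
        simp only [dotProduct, Int.cast_sum, Int.cast_mul, Finset.mul_sum]
        exact Finset.sum_congr rfl fun l _ => by ring
      rw [Finset.sum_congr rfl fun k _ => h2 k, Finset.sum_comm]
      refine Finset.sum_eq_zero fun l _ => ?_
      have h3 : ∑ k, c k * (τ.bVec k l : ℂ) = 0 := congrFun h l
      rw [← Finset.sum_mul, h3, zero_mul]
    have h4 : ∑ k, c k * (circ I j k : ℂ) = c j - ∑ i ∈ I.1, (rho I i j : ℂ) * c i := by
      rw [← Finset.sum_add_sum_compl I.1, Finset.sum_eq_single (s := I.1ᶜ) j]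
      · rw [circ_notMem hj, if_pos rfl, add_comm, sub_eq_add_neg, ← Finset.sum_neg_distrib]
        congr 1
        · simp
        · exact Finset.sum_congr rfl fun i hi => by rw [circ_mem hi]; push_cast; ring
      · intro k hk hkj
        rw [circ_notMem (by simpa using hk), if_neg hkj]; simp
      · intro hj'; exact absurd (by simpa using hj) hj'
    rw [h1, ← Finset.sum_coe_sort] at h4
    exact (sub_eq_zero.1 h4.symm)
  · intro h
    have h1 : ∀ k, c k = ∑ i : I.1, (rho I i k : ℂ) * c i := by
      intro k
      by_cases hk : k ∈ I.1
      · rw [Fintype.sum_eq_single (⟨k, hk⟩ : I.1), rho_apply_mem hk, if_pos rfl]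
        · simp
        · rintro ⟨i, hi⟩ hik
          have : i ≠ k := fun h => hik (Subtype.ext h)
          rw [rho_apply_mem hk, if_neg this]; simp
      · exact h k hk
    funext l
    change ∑ k, c k * (τ.bVec k l : ℂ) = 0
    have h2 : ∀ k, c k * (τ.bVec k l : ℂ) =
        ∑ i : I.1, c i * ((τ.bVec k l * rho I i k : ℤ) : ℂ) := by
      intro k
      conv_lhs => rw [h1 k]
      rw [Finset.sum_mul]
      exact Finset.sum_congr rfl fun i _ => by push_cast; ring
    rw [Finset.sum_congr rfl fun k _ => h2 k, Finset.sum_comm]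
    refine Finset.sum_eq_zero fun i _ => ?_
    have h3 : ∑ k, τ.bVec k l * rho I i k = 0 := congrFun (b_mulVec_rho I i) l
    rw [← Finset.mul_sum, ← Int.cast_sum, h3]; simp

theorem eval_quadric (I : τ.Bases) (k : Fin n) (u : Idx I → ℂ) :
    (quadric I k).eval u = ∑ i : I.1, (rho I i k : ℂ) * (u (Sum.inl i) * u (Sum.inr i)) := by
  simp [quadric]

theorem moment_slicePt (I : τ.Bases) (u : Idx I → ℂ) : moment τ (slicePt η I u) = 0 := by
  rw [moment_eq_zero_iff I]
  intro j hj
  have h1 : ∀ i : I.1, slicePt η I u (Sum.inl i.1) = u (Sum.inl i) := fun i =>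
    slicePt_incl I u (Sum.inl i)
  have h2 : ∀ i : I.1, slicePt η I u (Sum.inr i.1) = u (Sum.inr i) := fun i =>
    slicePt_incl I u (Sum.inr i)
  simp only [h1, h2, ← eval_quadric]
  by_cases hp : 0 < η ⬝ᵥ bet I j <;> simp [slicePt, slicePoly, hj, hp]

/-- A point over the chart, on the zero level, is moved to the slice by `shift`. -/
theorem normPt_eq_slicePt {I : τ.Bases} {z : Pt n} (h : InChart η I z) (h0 : moment τ z = 0) :
    normPt η I z = slicePt η I fun κ => normPt η I z κ.incl := by
  have hm : moment τ (normPt η I z) = 0 := moment_act _ h0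
  rw [moment_eq_zero_iff I] at hm
  have hq : ∀ k ∉ I.1, (quadric I k).eval (fun κ => normPt η I z κ.incl) =
      normPt η I z (Sum.inl k) * normPt η I z (Sum.inr k) := by
    intro k hk
    rw [hm k hk, eval_quadric]; rfl
  funext k
  rcases k with k | k
  · by_cases hk : k ∈ I.1
    · exact (slicePt_incl I (fun κ => normPt η I z κ.incl) (Sum.inl ⟨k, hk⟩)).symm
    · have h1 := normPt_sel h hk
      by_cases hp : 0 < η ⬝ᵥ bet I k
      · simp only [sel, if_pos hp] at h1
        simp [slicePt, slicePoly, hk, hp, h1]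
      · simp only [sel, if_neg hp] at h1
        simp [slicePt, slicePoly, hk, hp, hq, h1]
  · by_cases hk : k ∈ I.1
    · exact (slicePt_incl I (fun κ => normPt η I z κ.incl) (Sum.inr ⟨k, hk⟩)).symm
    · have h1 := normPt_sel h hk
      by_cases hp : 0 < η ⬝ᵥ bet I k
      · simp only [sel, if_pos hp] at h1
        simp [slicePt, slicePoly, hk, hp, hq, h1]
      · simp only [sel, if_neg hp] at h1
        simp [slicePt, slicePoly, hk, hp, h1]

theorem selU_slicePt {I : τ.Bases} (u : Idx I → ℂ) {j : Fin n} (hj : j ∉ I.1) :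
    selU η I (slicePt η I u) j = 1 := by
  ext; rw [selU_val (inChart_slicePt I u) hj, slicePt_sel u hj]; rfl

theorem mono_slicePt (I : τ.Bases) (u : Idx I → ℂ) (θ : Fin r → ℤ) :
    mono η I θ (slicePt η I u) = 1 := by
  refine Finset.prod_eq_one fun k _ => ?_
  by_cases hk : k ∈ I.1
  · rw [slack_mem hk, mul_zero, zpow_zero]
  · rw [selU_slicePt u hk, one_zpow]

theorem normPt_slicePt (I : τ.Bases) (u : Idx I → ℂ) :
    normPt η I (slicePt η I u) = slicePt η I u := by
  have : shift η I (slicePt η I u) = 1 := funext fun l => mono_slicePt I u _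
  rw [normPt, this, map_one, ptAct_one]

end Chart

section Semistable

variable {n r d : ℕ} {τ : TorusSequence n r d} {η : Fin r → ℤ}

/-! ### The charts cover the quotient -/

variable (η) in
/-- The monomial of `S`-weight `θ` in the selected coordinates, provided that its exponents are
nonnegative. -/
def monoPoly (I : τ.Bases) (θ : Fin r → ℤ) : MvPolynomial (Fin n ⊕ Fin n) ℂ :=
  ∏ k, MvPolynomial.X (sel η I k) ^ (sg η I k * slack I θ k).toNat

theorem eval_monoPoly {I : τ.Bases} {θ : Fin r → ℤ} (hθ : ∀ k, 0 ≤ sg η I k * slack I θ k)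
    {z : Pt n} (hz : InChart η I z) : (monoPoly η I θ).eval z = mono η I θ z := by
  rw [monoPoly, mono, map_prod, Units.coe_prod]
  refine Finset.prod_congr rfl fun k _ => ?_
  rw [map_pow, MvPolynomial.eval_X]
  by_cases hk : k ∈ I.1
  · simp [slack_mem hk]
  · rw [← selU_val hz hk, ← Units.val_pow_eq_pow_val, ← zpow_natCast, Int.toNat_of_nonneg (hθ k)]

theorem eval_monoPoly_of_not_inChart {I : τ.Bases} {θ : Fin r → ℤ}
    (hθ : ∀ k ∉ I.1, 0 < sg η I k * slack I θ k) {z : Pt n} (hz : ¬ InChart η I z) :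
    (monoPoly η I θ).eval z = 0 := by
  simp only [InChart, not_forall, not_not] at hz
  obtain ⟨j, hj, h0⟩ := hz
  rw [monoPoly, map_prod]
  refine Finset.prod_eq_zero (Finset.mem_univ j) ?_
  rw [map_pow, MvPolynomial.eval_X, h0, zero_pow]
  have := hθ j hj
  omega

theorem sg_mul_slack_self_nonneg (I : τ.Bases) (k : Fin n) : 0 ≤ sg η I k * slack I η k := by
  by_cases hk : k ∈ I.1
  · simp [slack_mem hk]
  · rw [slack_notMem hk, sg]; split_ifs <;> omega

theorem sg_mul_slack_self_pos [h : Nondeg τ η] (I : τ.Bases) (k : Fin n) (hk : k ∉ I.1) :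
    0 < sg η I k * slack I η k := by
  have := generic_bet_ne_zero h.uni h.gen hk
  rw [slack_notMem hk, sg]; split_ifs <;> omega

theorem InChart.isSemistable {I : τ.Bases} {z : Pt n} (hz : InChart η I z) :
    IsSemistable τ η z := by
  refine ⟨1, one_pos, monoPoly η I η, fun s w => ?_, ?_⟩
  · have h1 : ∀ k, ((scale (inS τ s⁻¹) (sel η I k)) : ℂˣ) ^ (sg η I k * slack I η k).toNat =
        (inS τ s⁻¹).1 k ^ slack I η k := by
      intro k
      rw [scale_sel, inS_snd, inv_one, one_mul, ← zpow_natCast,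
        Int.toNat_of_nonneg (sg_mul_slack_self_nonneg I k), ← zpow_mul, ← mul_assoc, sg_mul_sg,
        one_mul]
    have h2 : ∏ k, (scale (inS τ s⁻¹) (sel η I k)) ^ (sg η I k * slack I η k).toNat =
        (torusChar η s)⁻¹ := by
      rw [Finset.prod_congr rfl fun k _ => h1 k]
      change torusChar (slack I η) (inS τ s⁻¹).1 = _
      rw [torusChar_inS, b_mulVec_slack, torusChar_inv]
    rw [pow_one, ← h2, Units.coe_prod, monoPoly, map_prod, map_prod, ← Finset.prod_mul_distrib]
    refine Finset.prod_congr rfl fun k _ => ?_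
    simp only [map_pow, MvPolynomial.eval_X, ptAct, mul_pow, Units.val_pow_eq_pow_val]
  · rw [eval_monoPoly (sg_mul_slack_self_nonneg I) hz]
    exact Units.ne_zero _

/-- The `S`-weights of the coordinates of `T^*ℂ^n`. -/
def coordWt (τ : TorusSequence n r d) : Fin n ⊕ Fin n → Fin r → ℤ :=
  Sum.elim τ.bVec fun k => -τ.bVec k

theorem scale_inS (s : Torus r) (k : Fin n ⊕ Fin n) :
    scale (inS τ s) k = torusChar (coordWt τ k) s := by
  rcases k with k | k
  · rw [scale_inl, inS_snd, inS_fst, inv_one, one_mul]; rfl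
  · rw [scale_inr, inS_snd, inS_fst, inv_one, one_mul]; exact (torusChar_neg _ _).symm

/-- At a semistable point a positive multiple of `η` is a nonnegative combination of the `S`-weights
of the nonvanishing coordinates, given by a monomial of a semi-invariant. -/
theorem exists_weight_of_isSemistable {z : Pt n} (hz : IsSemistable τ η z) :
    ∃ m : ℕ, 0 < m ∧ ∃ c : Fin n ⊕ Fin n → ℕ, (∀ k, c k ≠ 0 → z k ≠ 0) ∧
      ∑ k, (c k : ℤ) • coordWt τ k = (m : ℤ) • η := by
  obtain ⟨m, hm, f, hf, h0⟩ := hz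
  refine ⟨m, hm, ?_⟩
  rw [MvPolynomial.eval_eq'] at h0
  obtain ⟨e, he, hne⟩ := Finset.exists_ne_zero_of_sum_ne_zero h0
  refine ⟨e, fun k hk hz => ?_, torusChar_injective fun s => ?_⟩
  · refine right_ne_zero_of_mul hne (Finset.prod_eq_zero (Finset.mem_univ k) ?_)
    rw [hz, zero_pow hk]
  · let F : MvPolynomial (Fin n ⊕ Fin n) ℂ := ∑ v ∈ f.support, MvPolynomial.monomial v
      (f.coeff v * ∏ k, ((scale (inS τ s⁻¹) k : ℂˣ) : ℂ) ^ v k)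
    have hF : F = MvPolynomial.C (((torusChar η s)⁻¹ ^ m : ℂˣ) : ℂ) * f := by
      refine MvPolynomial.funext fun w => ?_
      rw [map_mul, MvPolynomial.eval_C, ← hf s w, map_sum, MvPolynomial.eval_eq']
      refine Finset.sum_congr rfl fun v _ => ?_
      rw [MvPolynomial.eval_monomial, Finsupp.prod_fintype _ _ (fun _ => pow_zero _), mul_assoc,
        ← Finset.prod_mul_distrib]
      simp only [ptAct, mul_pow]
    have h1 := congrArg (MvPolynomial.coeff e) hF
    rw [MvPolynomial.coeff_C_mul, MvPolynomial.coeff_sum, Finset.sum_eq_single e,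
      MvPolynomial.coeff_monomial, if_pos rfl, mul_comm] at h1
    · have h2 := mul_right_cancel₀ (MvPolynomial.mem_support_iff.1 he) h1
      have h3 : ∏ k, scale (inS τ s⁻¹) k ^ e k = (torusChar η s)⁻¹ ^ m := by
        ext; rw [Units.coe_prod, ← h2]; simp
      simp only [scale_inS, torusChar_inv, inv_pow, Finset.prod_inv_distrib, inv_inj] at h3
      rw [torusChar_zsmul, zpow_natCast, ← h3]
      have h4 : ∀ T : Finset (Fin n ⊕ Fin n), torusChar (∑ k ∈ T, (e k : ℤ) • coordWt τ k) s =
          ∏ k ∈ T, torusChar (coordWt τ k) s ^ e k := by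
        intro T
        classical
        induction T using Finset.induction_on with
        | empty => simp [torusChar_zero]
        | insert a T ha ih =>
          rw [Finset.sum_insert ha, Finset.prod_insert ha, torusChar_add, ih, torusChar_zsmul,
            zpow_natCast]
      exact h4 _
    · intro v _ hv
      rw [MvPolynomial.coeff_monomial, if_neg hv]
    · intro h; exact absurd he h

/-- Carathéodory's theorem for a cone: a positive combination can be rewritten, up to a positive
factor, as a positive combination of independent vectors. -/
theorem exists_independent_combination {ι : Type*} [Fintype ι] {e : ℕ} (v : ι → Fin e → ℤ)
    (x : Fin e → ℤ) (c : ι → ℕ) (m : ℕ) (hm : 0 < m)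
    (h : ∑ k, (c k : ℤ) • v k = (m : ℤ) • x) :
    ∃ (c' : ι → ℕ) (m' : ℕ), 0 < m' ∧ ∑ k, (c' k : ℤ) • v k = (m' : ℤ) • x ∧
      (∀ k, c' k ≠ 0 → c k ≠ 0) ∧
      ∀ f : ι → ℤ, (∀ k, c' k = 0 → f k = 0) → ∑ k, f k • v k = 0 → f = 0 := by
  classical
  generalize hN : (Finset.univ.filter fun k => c k ≠ 0).card = N
  induction N using Nat.strong_induction_on generalizing c m with
  | _ N ih =>
    by_cases hi : ∀ f : ι → ℤ, (∀ k, c k = 0 → f k = 0) → ∑ k, f k • v k = 0 → f = 0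
    · exact ⟨c, m, hm, h, fun _ h => h, hi⟩
    push Not at hi
    obtain ⟨f, hf, hf0, hfne⟩ := hi
    obtain ⟨f, hf, hf0, k₁, hk₁⟩ : ∃ f : ι → ℤ, (∀ k, c k = 0 → f k = 0) ∧ ∑ k, f k • v k = 0 ∧
        ∃ k, 0 < f k := by
      by_cases hp : ∃ k, 0 < f k
      · exact ⟨f, hf, hf0, hp⟩
      · push Not at hp
        obtain ⟨k, hk⟩ := Function.ne_iff.1 hfne
        refine ⟨-f, fun k hk => by simp [hf k hk],
          by simp only [Pi.neg_apply, neg_smul, Finset.sum_neg_distrib, hf0, neg_zero], k, ?_⟩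
        have := hp k
        simp only [Pi.zero_apply, Pi.neg_apply] at hk ⊢
        omega
    obtain ⟨k₀, hk₀, hmin⟩ := Finset.exists_min_image (Finset.univ.filter fun k => 0 < f k)
      (fun k => (c k : ℚ) / f k) ⟨k₁, by simpa using hk₁⟩
    have hk₀' : 0 < f k₀ := (Finset.mem_filter.1 hk₀).2
    have hnn : ∀ k, 0 ≤ f k₀ * c k - c k₀ * f k := by
      intro k
      by_cases hk : 0 < f k
      · have h1 := hmin k (by simpa using hk)
        have a : (0 : ℚ) < f k := by exact_mod_cast hk
        have b : (0 : ℚ) < f k₀ := by exact_mod_cast hk₀'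
        rw [div_le_div_iff₀ b a] at h1
        have : (c k₀ : ℤ) * f k ≤ c k * f k₀ := by exact_mod_cast h1
        linarith
      · have h1 : (c k₀ : ℤ) * f k ≤ 0 := mul_nonpos_of_nonneg_of_nonpos (by positivity) (by omega)
        have h2 : 0 ≤ f k₀ * c k := by positivity
        linarith
    have hsub : ∀ k, (f k₀ * c k - c k₀ * f k).toNat ≠ 0 → c k ≠ 0 := by
      intro k hk h0
      rw [h0, hf k h0] at hk
      simp at hk
    have hlt : (Finset.univ.filter fun k => (f k₀ * c k - c k₀ * f k).toNat ≠ 0).card < N := by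
      rw [← hN]
      refine Finset.card_lt_card ⟨fun k hk => ?_, fun hh => ?_⟩
      · simp only [Finset.mem_filter, Finset.mem_univ, true_and] at hk ⊢
        exact hsub k hk
      · have h1 : c k₀ ≠ 0 := fun h0 => by have := hf k₀ h0; omega
        have h2 := hh (Finset.mem_filter.2 ⟨Finset.mem_univ k₀, h1⟩)
        simp [mul_comm] at h2
    obtain ⟨c', m', h1, h2, h3, h4⟩ := ih _ hlt (fun k => (f k₀ * c k - c k₀ * f k).toNat)
      (m * (f k₀).toNat) (Nat.mul_pos hm (by omega)) (by
        have : ∀ k, (((f k₀ * c k - c k₀ * f k).toNat : ℕ) : ℤ) • v k =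
            f k₀ • ((c k : ℤ) • v k) - (c k₀ : ℤ) • (f k • v k) := by
          intro k
          rw [Int.toNat_of_nonneg (hnn k), sub_smul, smul_smul, smul_smul]
        simp only [this, Finset.sum_sub_distrib, ← Finset.smul_sum, h, hf0, smul_zero, sub_zero]
        rw [smul_smul, Nat.cast_mul, Int.toNat_of_nonneg hk₀'.le, mul_comm]) rfl
    exact ⟨c', m', h1, h2, fun k hk => hsub k (h3 k hk), h4⟩

/-- Every semistable point lies over a chart: an independent set of characters of nonvanishing
coordinates whose cone contains `η` extends to a basis, and the complement of this basis is the index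
of the chart. -/
theorem exists_inChart [h : Nondeg τ η] {z : Pt n} (hz : IsSemistable τ η z) :
    ∃ I : τ.Bases, InChart η I z := by
  classical
  obtain ⟨m₀, hm₀, c₀, hc₀, hs₀⟩ := exists_weight_of_isSemistable hz
  obtain ⟨c, m, hm, hs, hc, hi⟩ := exists_independent_combination _ _ c₀ m₀ hm₀ hs₀
  set v : Fin n → ℤ := fun k => (c (Sum.inl k) : ℤ) - c (Sum.inr k) with hv
  have hbv : ∀ f : Fin n → ℤ, τ.b *ᵥ f = ∑ k, f k • τ.bVec k := τ.dual.a_mulVec_eq_sum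
  have hv' : τ.b *ᵥ v = (m : ℤ) • η := by
    rw [hbv, ← hs, Fintype.sum_sum_type, ← Finset.sum_add_distrib]
    refine Finset.sum_congr rfl fun k _ => ?_
    rw [coordWt, Sum.elim_inl, Sum.elim_inr, smul_neg, ← sub_eq_add_neg, ← sub_smul]
  obtain ⟨K, hK⟩ := exists_bases_superset h.uni.dual
      (S := Finset.univ.filter fun k => c (Sum.inl k) ≠ 0 ∨ c (Sum.inr k) ≠ 0) (by
    rw [linearIndependent_iff_mulVec]
    intro f hf h0
    have h0' : τ.b *ᵥ f = 0 := h0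
    have := hi (Sum.elim (fun k => if c (Sum.inl k) ≠ 0 then f k else 0)
      (fun k => if c (Sum.inl k) ≠ 0 then 0 else -f k)) (by
        rintro (k | k) hk
        · simp [hk]
        · simp only [Sum.elim_inr]
          split_ifs with h1
          · rfl
          · rw [hf k (by simp [hk, not_not.1 h1]), neg_zero]) (by
        rw [Fintype.sum_sum_type, ← Finset.sum_add_distrib, ← h0', hbv]
        refine Finset.sum_congr rfl fun k _ => ?_
        simp only [Sum.elim_inl, Sum.elim_inr, coordWt]
        split_ifs <;> simp)
    funext k
    by_cases h1 : c (Sum.inl k) ≠ 0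
    · have h2 := congrFun this (Sum.inl k)
      simpa [h1] using h2
    · have h2 := congrFun this (Sum.inr k)
      simp only [Sum.elim_inr, if_neg h1, Pi.zero_apply, neg_eq_zero] at h2
      exact h2)
  let I : τ.Bases := K.compl
  have hvI : v = (m : ℤ) • slack I η := by
    rw [← slack_zsmul]
    refine slack_unique (fun k hk => ?_) hv'
    have : k ∉ K.1 := Bases.mem_compl.1 hk
    have h1 : ¬ (c (Sum.inl k) ≠ 0 ∨ c (Sum.inr k) ≠ 0) := fun hh => this (hK (by simpa using hh))
    push Not at h1
    simp [hv, h1.1, h1.2]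
  refine ⟨I, fun j hj => hc₀ _ (hc _ fun h0 => ?_)⟩
  have h1 := congrFun hvI j
  rw [Pi.smul_apply, smul_eq_mul, slack_notMem hj] at h1
  have hm' : (0 : ℤ) < m := by exact_mod_cast hm
  by_cases hp : 0 < η ⬝ᵥ bet I j
  · rw [sel, if_pos hp] at h0
    have := mul_pos hm' hp
    simp only [hv, h0] at h1
    omega
  · rw [sel, if_neg hp] at h0
    have hne := generic_bet_ne_zero h.uni h.gen hj
    have := mul_neg_of_pos_of_neg hm' (lt_of_le_of_ne (not_lt.1 hp) hne)
    simp only [hv, h0] at h1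
    omega

/-! ### Coordinates on the charts -/

/-- The point of the level set on the slice. -/
def slice (I : τ.Bases) (u : Idx I → ℂ) : Level τ η :=
  ⟨slicePt η I u, moment_slicePt I u, (inChart_slicePt I u).isSemistable⟩

/-- The parametrization of the chart of `I` by an affine space. -/
def param (I : τ.Bases) (u : Idx I → ℂ) : ToricSpace τ η := proj (slice I u)

variable (η) in
/-- The chart of `I`. -/
def chartSet (I : τ.Bases) : Set (ToricSpace τ η) := {x | ∃ z, proj z = x ∧ InChart η I z.1}

/-- The coordinates on the chart of `I`.  Their values off the chart are irrelevant. -/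
def coord (I : τ.Bases) (x : ToricSpace τ η) (κ : Idx I) : ℂ :=
  normPt η I (proj_surjective x).choose.1 κ.incl

theorem proj_mem_chartSet {I : τ.Bases} {z : Level τ η} :
    proj z ∈ chartSet η I ↔ InChart η I z.1 := by
  refine ⟨?_, fun h => ⟨z, rfl, h⟩⟩
  rintro ⟨w, hw, h⟩
  obtain ⟨s, rfl⟩ := proj_eq_iff.1 hw
  exact h.act _

theorem coord_proj {I : τ.Bases} {z : Level τ η} (h : InChart η I z.1) (κ : Idx I) :
    coord I (proj z) κ = normPt η I z.1 κ.incl := by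
  obtain ⟨s, hs⟩ := proj_eq_iff.1 (proj_surjective (proj z)).choose_spec.symm
  rw [coord, ← hs]
  exact congrFun (normPt_inS h s) _

theorem param_mem (I : τ.Bases) (u : Idx I → ℂ) : param I u ∈ chartSet η I :=
  ⟨_, rfl, inChart_slicePt I u⟩

theorem coord_param (I : τ.Bases) (u : Idx I → ℂ) : coord I (param I u : ToricSpace τ η) = u := by
  funext κ
  rw [param, coord_proj (inChart_slicePt I u)]
  change normPt η I (slicePt η I u) κ.incl = _
  rw [normPt_slicePt, slicePt_incl]

theorem levelAct_shift {I : τ.Bases} {z : Level τ η} (h : InChart η I z.1) :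
    levelAct (inS τ (shift η I z.1)) z = slice I (coord I (proj z)) := by
  refine Subtype.ext ((normPt_eq_slicePt h z.2.1).trans ?_)
  have : coord I (proj z) = fun κ => normPt η I z.1 κ.incl := funext fun κ => coord_proj h κ
  rw [this]; rfl

theorem param_coord {I : τ.Bases} {x : ToricSpace τ η} (h : x ∈ chartSet η I) :
    param I (coord I x) = x := by
  obtain ⟨z, rfl, hz⟩ := h
  rw [param, ← levelAct_shift hz, proj_act]

theorem exists_mem_chartSet [Nondeg τ η] (x : ToricSpace τ η) : ∃ I : τ.Bases, x ∈ chartSet η I := by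
  obtain ⟨z, rfl⟩ := proj_surjective x
  obtain ⟨I, hI⟩ := exists_inChart z.2.2
  exact ⟨I, z, rfl, hI⟩

theorem exists_param [Nondeg τ η] (x : ToricSpace τ η) : ∃ (I : τ.Bases) (u : Idx I → ℂ),
    x = param I u := by
  obtain ⟨I, hI⟩ := exists_mem_chartSet x
  exact ⟨I, _, (param_coord hI).symm⟩

/-- Clearing denominators: a polynomial in the chart coordinates becomes a polynomial on `T^*ℂ^n`
after multiplication by a high power of a monomial that vanishes exactly off the chart. -/
theorem exists_clear {I : τ.Bases} {θ : Fin r → ℤ} (hθ : ∀ k ∉ I.1, 0 < sg η I k * slack I θ k)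
    (P : MvPolynomial (Idx I) ℂ) : ∃ N₀ : ℕ, ∀ N ≥ N₀, ∃ G : MvPolynomial (Fin n ⊕ Fin n) ℂ,
      (∀ z, InChart η I z → G.eval z =
        P.eval (fun κ => normPt η I z κ.incl) * (mono η I θ z : ℂ) ^ N) ∧
      ∀ z, ¬ InChart η I z → G.eval z = 0 := by
  have hθ0 : ∀ k, 0 ≤ sg η I k * slack I θ k := by
    intro k
    by_cases hk : k ∈ I.1
    · simp [slack_mem hk]
    · exact (hθ k hk).le
  suffices H : ∃ N₀ : ℕ, ∀ N ≥ N₀, ∃ G : MvPolynomial (Fin n ⊕ Fin n) ℂ,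
      ∀ z, InChart η I z → G.eval z =
        P.eval (fun κ => normPt η I z κ.incl) * (mono η I θ z : ℂ) ^ N by
    obtain ⟨N₀, h⟩ := H
    refine ⟨N₀ + 1, fun N hN => ?_⟩
    obtain ⟨G, hG⟩ := h (N - 1) (by omega)
    refine ⟨G * monoPoly η I θ, fun z hz => ?_, fun z hz => ?_⟩
    · rw [map_mul, hG z hz, eval_monoPoly hθ0 hz, mul_assoc, ← pow_succ,
        Nat.sub_add_cancel (by omega)]
    · rw [map_mul, eval_monoPoly_of_not_inChart hθ hz, mul_zero]
  induction P using MvPolynomial.induction_on with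
  | C c =>
    refine ⟨0, fun N _ => ⟨MvPolynomial.C c * monoPoly η I θ ^ N, fun z hz => ?_⟩⟩
    rw [map_mul, map_pow, eval_monoPoly hθ0 hz, MvPolynomial.eval_C, MvPolynomial.eval_C]
  | add p q hp hq =>
    obtain ⟨N₁, h₁⟩ := hp
    obtain ⟨N₂, h₂⟩ := hq
    refine ⟨max N₁ N₂, fun N hN => ?_⟩
    obtain ⟨G₁, hG₁⟩ := h₁ N (le_trans (le_max_left _ _) hN)
    obtain ⟨G₂, hG₂⟩ := h₂ N (le_trans (le_max_right _ _) hN)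
    exact ⟨G₁ + G₂, fun z hz => by rw [map_add, map_add, hG₁ z hz, hG₂ z hz, add_mul]⟩
  | mul_X p κ hp =>
    obtain ⟨N₁, h₁⟩ := hp
    obtain ⟨θ₁, hθ₁⟩ : ∃ θ₁ : Fin r → ℤ, ∀ z, normPt η I z κ.incl = mono η I θ₁ z * z κ.incl := by
      rcases κ with κ | κ
      · exact ⟨-τ.bVec κ, fun z => by rw [mono_neg]; exact normPt_inl I z κ⟩
      · exact ⟨τ.bVec κ, fun z => normPt_inr I z κ⟩
    obtain ⟨M, hM⟩ : ∃ M : ℕ, ∀ k, 0 ≤ sg η I k * slack I (θ₁ + (M : ℤ) • θ) k := by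
      refine ⟨∑ k, (slack I θ₁ k).natAbs, fun k => ?_⟩
      by_cases hk : k ∈ I.1
      · rw [slack_mem hk, mul_zero]
      · rw [slack_add, slack_zsmul, Pi.add_apply, Pi.smul_apply, smul_eq_mul, mul_add]
        have h1 : (slack I θ₁ k).natAbs ≤ ∑ k, (slack I θ₁ k).natAbs :=
          Finset.single_le_sum (f := fun k => (slack I θ₁ k).natAbs) (fun _ _ => Nat.zero_le _)
            (Finset.mem_univ k)
        set M := ∑ k, (slack I θ₁ k).natAbs
        have h2 : (M : ℤ) ≤ M * (sg η I k * slack I θ k) :=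
          le_mul_of_one_le_right (by positivity) (hθ k hk)
        have h3 : -((slack I θ₁ k).natAbs : ℤ) ≤ sg η I k * slack I θ₁ k := by
          unfold sg; split_ifs <;> omega
        have h4 : sg η I k * (M * slack I θ k) = M * (sg η I k * slack I θ k) := by ring
        omega
    refine ⟨N₁ + M, fun N hN => ?_⟩
    obtain ⟨G, hG⟩ := h₁ (N - M) (by omega)
    refine ⟨G * (monoPoly η I (θ₁ + (M : ℤ) • θ) * MvPolynomial.X κ.incl), fun z hz => ?_⟩
    rw [map_mul, map_mul, map_mul, hG z hz, eval_monoPoly hM hz, MvPolynomial.eval_X,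
      MvPolynomial.eval_X, hθ₁, mono_add, mono_zsmul, zpow_natCast]
    have : N = (N - M) + M := by omega
    conv_rhs => rw [this, pow_add]
    push_cast
    ring

variable (η) in
/-- The pull-back of a polynomial to the slice. -/
def pullPoly (I : τ.Bases) (P : MvPolynomial (Fin n ⊕ Fin n) ℂ) : MvPolynomial (Idx I) ℂ :=
  MvPolynomial.aeval (slicePoly η I) P

theorem eval_pullPoly (I : τ.Bases) (P : MvPolynomial (Fin n ⊕ Fin n) ℂ) (u : Idx I → ℂ) :
    (pullPoly η I P).eval u = P.eval (slicePt η I u) := by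
  induction P using MvPolynomial.induction_on with
  | C c => simp [pullPoly]
  | add p q hp hq => simp only [pullPoly, map_add] at *; rw [hp, hq]
  | mul_X p k hp =>
    simp only [pullPoly, map_mul, MvPolynomial.aeval_X, MvPolynomial.eval_X] at *
    rw [hp]; rfl

variable [Nondeg τ η]

theorem isOpen_basic (I : τ.Bases) (Q : MvPolynomial (Idx I) ℂ) :
    IsOpen {x : ToricSpace τ η | x ∈ chartSet η I ∧ Q.eval (coord I x) ≠ 0} := by
  rw [toric_isOpen_iff]
  rintro z ⟨hz, hQ⟩
  rw [proj_mem_chartSet] at hz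
  obtain ⟨N, hN⟩ := exists_clear (sg_mul_slack_self_pos (η := η) I) Q
  obtain ⟨G, h1, h2⟩ := hN N le_rfl
  have hc : ∀ w : Level τ η, InChart η I w.1 →
      (fun κ => normPt η I w.1 κ.incl) = coord I (proj w) := fun w hw =>
    (funext fun κ => coord_proj hw κ).symm
  refine ⟨G, ?_, fun w hw => ?_⟩
  · rw [h1 _ hz, hc z hz]
    exact mul_ne_zero hQ (pow_ne_zero _ (Units.ne_zero _))
  · have hwI : InChart η I w.1 := by by_contra h; exact hw (h2 _ h)
    rw [h1 _ hwI, hc w hwI] at hw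
    exact ⟨proj_mem_chartSet.2 hwI, left_ne_zero_of_mul hw⟩

theorem isOpen_chartSet (I : τ.Bases) : IsOpen (chartSet η I) := by
  simpa using isOpen_basic (η := η) I 1

theorem eventually_param_iff {I : τ.Bases} {u : Idx I → ℂ} {p : ToricSpace τ η → Prop} :
    (∀ᶠ y in 𝓝 (param I u), p y) ↔ ∃ Q : MvPolynomial (Idx I) ℂ, Q.eval u ≠ 0 ∧
      ∀ v, Q.eval v ≠ 0 → p (param I v) := by
  constructor
  · intro h
    obtain ⟨U, hU, hUo, hxU⟩ := mem_nhds_iff.1 h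
    obtain ⟨Q, h0, hQ⟩ := toric_isOpen_iff.1 hUo (slice I u) hxU
    refine ⟨pullPoly η I Q, by rwa [eval_pullPoly], fun v hv => ?_⟩
    rw [eval_pullPoly] at hv
    exact hU (hQ (slice I v) hv)
  · rintro ⟨Q, h0, h⟩
    refine Filter.mem_of_superset ((isOpen_basic I Q).mem_nhds
      ⟨param_mem I u, by rwa [coord_param]⟩) ?_
    rintro x ⟨hx, hQ⟩
    have := h _ hQ
    rwa [param_coord hx] at this

theorem regularAt_param_iff {I : τ.Bases} {u : Idx I → ℂ} {f : ToricSpace τ η → ℂ} :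
    RegularAt f (param I u) ↔ ∃ P Q : MvPolynomial (Idx I) ℂ, Q.eval u ≠ 0 ∧
      ∀ v, Q.eval v ≠ 0 → f (param I v) = P.eval v / Q.eval v := by
  constructor
  · intro h
    obtain ⟨P, Q, h0, h⟩ := toricRegularAt_proj.1 h
    refine ⟨pullPoly η I P, pullPoly η I Q, by rwa [eval_pullPoly], fun v hv => ?_⟩
    rw [eval_pullPoly] at hv
    rw [eval_pullPoly, eval_pullPoly]
    exact h (slice I v) hv
  · rintro ⟨P, Q, h0, h⟩
    obtain ⟨N₁, h₁⟩ := exists_clear (sg_mul_slack_self_pos (η := η) I) P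
    obtain ⟨N₂, h₂⟩ := exists_clear (sg_mul_slack_self_pos (η := η) I) Q
    obtain ⟨G₁, hG₁, -⟩ := h₁ (max N₁ N₂) (le_max_left _ _)
    obtain ⟨G₂, hG₂, hG₂'⟩ := h₂ (max N₁ N₂) (le_max_right _ _)
    have hc : ∀ w : Level τ η, InChart η I w.1 →
        (fun κ => normPt η I w.1 κ.incl) = coord I (proj w) := fun w hw =>
      (funext fun κ => coord_proj hw κ).symm
    refine toricRegularAt_proj.2 ⟨G₁, G₂, ?_, fun w hw => ?_⟩
    · have hI := inChart_slicePt (η := η) I u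
      change G₂.eval (slicePt η I u) ≠ 0
      rw [hG₂ _ hI, normPt_slicePt]
      simp only [slicePt_incl]
      exact mul_ne_zero h0 (pow_ne_zero _ (Units.ne_zero _))
    · have hwI : InChart η I w.1 := by by_contra h; exact hw (hG₂' _ h)
      rw [hG₂ _ hwI, hc w hwI] at hw
      have hx := h _ (left_ne_zero_of_mul hw)
      rw [param_coord (proj_mem_chartSet.2 hwI)] at hx
      refine hx.trans ?_
      rw [hG₁ _ hwI, hG₂ _ hwI, hc w hwI,
        mul_div_mul_right _ _ (pow_ne_zero _ (Units.ne_zero _))]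

theorem regularAt_coord {I : τ.Bases} {x : ToricSpace τ η} (hx : x ∈ chartSet η I) (κ : Idx I) :
    RegularAt (fun y => coord I y κ) x := by
  rw [← param_coord hx, regularAt_param_iff]
  refine ⟨MvPolynomial.X κ, 1, by simp, fun v _ => ?_⟩
  rw [coord_param]; simp

theorem chart_eq_chartSet (I : τ.Bases) : chart τ η I.1 = chartSet η I := by
  have hN : Nondeg τ η := inferInstance
  ext x
  refine exists_congr fun z => and_congr_right fun _ => forall₂_congr fun j hj => ?_
  rw [beta_eq_bet hN.uni hj]
  have hne := generic_bet_ne_zero hN.uni hN.gen hj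
  by_cases hp : 0 < η ⬝ᵥ bet I j
  · simp [sel, hp, not_lt.2 hp.le]
  · have : η ⬝ᵥ bet I j < 0 := lt_of_le_of_ne (not_lt.1 hp) hne
    simp [sel, hp, this]

end Semistable

section Action

variable {n r d : ℕ} {τ : TorusSequence n r d} {η : Fin r → ℤ}

/-! ### The torus action in the charts -/

variable (η) in
/-- The weights of `H × 𝕊` on the coordinates of the chart of `I`. -/
def chartWt (I : τ.Bases) : Idx I → (Fin d → ℤ) × ℤ
  | Sum.inl i => (alpha I i, monoDeg η I (τ.bVec i) - 1)
  | Sum.inr i => (-alpha I i, -monoDeg η I (τ.bVec i) - 1)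

theorem slack_bVec_eq (I : τ.Bases) (i : Fin n) :
    slack I (τ.bVec i) = Pi.single i 1 - rho I i := by
  symm
  refine slack_unique (fun k hk => ?_) ?_
  · rw [Pi.sub_apply, rho_apply_mem hk, Pi.single_apply]
    simp [eq_comm]
  · rw [Matrix.mulVec_sub, b_mulVec_rho, sub_zero, Matrix.mulVec_single_one]; rfl

theorem torusChar_single {e : ℕ} (i : Fin e) (t : Torus e) : torusChar (Pi.single i 1) t = t i := by
  simp [torusChar, Pi.single_apply, apply_ite]

theorem normPt_act {I : τ.Bases} {z : Pt n} (h : InChart η I z) (t : BigTorus n) (κ : Idx I) :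
    normPt η I (ptAct t z) κ.incl = (bigChar (chartWt η I κ) (toH τ t) : ℂ) *
      normPt η I z κ.incl := by
  rcases κ with ⟨i, hi⟩ | ⟨i, hi⟩
  · change normPt η I (ptAct t z) (Sum.inl i) = _ * normPt η I z (Sum.inl i)
    rw [normPt_inl, normPt_inl, mono_act h, slack_bVec_eq, sub_eq_add_neg, torusChar_add,
      torusChar_neg, torusChar_single, bigChar]
    change _ = ((torusChar (alpha I i) (toH τ t).1 * t.2 ^ (_ - 1 : ℤ) : ℂˣ) : ℂ) * _
    rw [torusChar_toH, ← rho, ptAct, scale_inl, ← mul_assoc, ← mul_assoc, ← Units.val_mul,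
      ← Units.val_mul]
    congr 2
    rw [zpow_sub_one, zpow_neg]
    simp only [mul_inv, inv_inv]
    have : t.1 i * (t.1 i)⁻¹ = 1 := mul_inv_cancel _
    calc _ = (t.1 i * (t.1 i)⁻¹) * (torusChar (rho I i) t.1 *
        (t.2 ^ monoDeg η I (τ.bVec i) * t.2⁻¹) * (mono η I (τ.bVec i) z)⁻¹) := by
          simp only [mul_comm, mul_left_comm, mul_assoc]
      _ = _ := by rw [this, one_mul]
  · change normPt η I (ptAct t z) (Sum.inr i) = _ * normPt η I z (Sum.inr i)
    rw [normPt_inr, normPt_inr, mono_act h, slack_bVec_eq, sub_eq_add_neg, torusChar_add,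
      torusChar_neg, torusChar_single, bigChar]
    change _ = ((torusChar (-alpha I i) (toH τ t).1 * t.2 ^ (_ - 1 : ℤ) : ℂˣ) : ℂ) * _
    rw [torusChar_neg, torusChar_toH, ← rho, ptAct, scale_inr, ← mul_assoc, ← mul_assoc,
      ← Units.val_mul, ← Units.val_mul]
    congr 2
    rw [zpow_sub_one]
    have : t.1 i * (t.1 i)⁻¹ = 1 := mul_inv_cancel _
    calc _ = (t.1 i * (t.1 i)⁻¹) * ((torusChar (rho I i) t.1)⁻¹ *
        (t.2 ^ (-monoDeg η I (τ.bVec i)) * t.2⁻¹) * (mono η I (τ.bVec i) z)) := by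
          simp only [mul_comm, mul_left_comm, mul_assoc]
      _ = _ := by rw [this, one_mul]

theorem smul_mem_chartSet {I : τ.Bases} {x : ToricSpace τ η} (hx : x ∈ chartSet η I)
    (t : BigTorus d) : t • x ∈ chartSet η I := by
  obtain ⟨z, rfl, hz⟩ := hx
  obtain ⟨t, rfl⟩ := toH_surjective (τ := τ) t
  rw [toH_smul_proj, proj_mem_chartSet]
  exact hz.act t

theorem smul_mem_chartSet_iff {I : τ.Bases} {x : ToricSpace τ η} {t : BigTorus d} :
    t • x ∈ chartSet η I ↔ x ∈ chartSet η I :=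
  ⟨fun h => by simpa using smul_mem_chartSet h t⁻¹, fun h => smul_mem_chartSet h t⟩

theorem coord_smul {I : τ.Bases} {x : ToricSpace τ η} (hx : x ∈ chartSet η I) (t : BigTorus d)
    (κ : Idx I) : coord I (t • x) κ = (bigChar (chartWt η I κ) t : ℂ) * coord I x κ := by
  obtain ⟨z, rfl, hz⟩ := hx
  obtain ⟨t, rfl⟩ := toH_surjective (τ := τ) t
  rw [toH_smul_proj, coord_proj hz, coord_proj (hz.act t)]
  exact normPt_act hz t κ

theorem smul_param (I : τ.Bases) (u : Idx I → ℂ) (t : BigTorus d) :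
    t • (param I u : ToricSpace τ η) =
      param I fun κ => (bigChar (chartWt η I κ) t : ℂ) * u κ := by
  rw [← param_coord (smul_mem_chartSet (param_mem I u) t)]
  congr 1
  funext κ
  rw [coord_smul (param_mem I u), coord_param]

theorem chartWt_fst_ne_zero (I : τ.Bases) (κ : Idx I) : (chartWt η I κ).1 ≠ 0 := by
  rcases κ with i | i
  · exact alpha_ne_zero i.2
  · exact neg_ne_zero.2 (alpha_ne_zero i.2)

theorem smul_param_zero (I : τ.Bases) (t : BigTorus d) :
    t • (param I 0 : ToricSpace τ η) = param I 0 := by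
  rw [smul_param]; congr 1; funext κ; simp

theorem eq_param_zero_of_fixed {I : τ.Bases} {x : ToricSpace τ η} (hx : x ∈ chartSet η I)
    (h : ∀ h : Torus d, ((h, 1) : BigTorus d) • x = x) : x = param I 0 := by
  rw [← param_coord hx]
  congr 1
  funext κ
  obtain ⟨t, ht⟩ := exists_torusChar_ne_one (chartWt_fst_ne_zero (η := η) I κ)
  have h1 := coord_smul hx (t, 1) κ
  rw [h t] at h1
  have h2 : (bigChar (chartWt η I κ) (t, 1) : ℂ) ≠ 1 := by
    rw [bigChar, one_zpow, mul_one]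
    exact fun h => ht (Units.ext h)
  by_contra h0
  exact h2 (mul_right_cancel₀ h0 (by rw [one_mul]; exact h1.symm))

theorem eq_of_param_zero_mem {I J : τ.Bases} (h : (param I 0 : ToricSpace τ η) ∈ chartSet η J) :
    I = J := by
  have h1 : InChart η J (slicePt η I 0) := proj_mem_chartSet.1 h
  refine Bases.ext (Finset.eq_of_subset_of_card_le (fun k hk => ?_) (by rw [I.card, J.card]))
  by_contra hkJ
  refine h1 k hkJ ?_
  unfold sel
  split_ifs
  · exact slicePt_incl I 0 (Sum.inl ⟨k, hk⟩)
  · exact slicePt_incl I 0 (Sum.inr ⟨k, hk⟩)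

theorem slicePt_zero (I : τ.Bases) (k : Fin n) :
    slicePt η I 0 (Sum.inl k) = (if k ∉ I.1 ∧ 0 < η ⬝ᵥ bet I k then 1 else 0) ∧
    slicePt η I 0 (Sum.inr k) = if k ∉ I.1 ∧ ¬ 0 < η ⬝ᵥ bet I k then 1 else 0 := by
  have hq : MvPolynomial.constantCoeff (quadric I k) = 0 := by simp [quadric]
  by_cases hk : k ∈ I.1 <;> by_cases hp : 0 < η ⬝ᵥ bet I k <;>
    simp [slicePt, slicePoly, hk, hp, hq]

instance : Finite τ.Bases := Subtype.finite

variable [hN : Nondeg τ η]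

variable (τ η) in
/-- The bijection `I ↦ p_I` of the bases with the fixed points. -/
def fixedEquiv : τ.Bases ≃ FixedPts d (ToricSpace τ η) :=
  Equiv.ofBijective (fun I => ⟨param I 0, fun _ => smul_param_zero I _⟩) ⟨fun I J h => by
    refine eq_of_param_zero_mem (η := η) (J := J) ?_
    have h' : (param I 0 : ToricSpace τ η) = param J 0 := Subtype.ext_iff.1 h
    rw [h']; exact param_mem J 0, fun p => by
    obtain ⟨I, hI⟩ := exists_mem_chartSet p.1
    exact ⟨I, Subtype.ext (eq_param_zero_of_fixed hI p.2).symm⟩⟩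

theorem mem_chart_iff_eq_fixedEquiv (I : τ.Bases) (p : FixedPts d (ToricSpace τ η)) :
    p.1 ∈ chart τ η I.1 ↔ p = fixedEquiv τ η I := by
  rw [chart_eq_chartSet]
  constructor
  · exact fun h => Subtype.ext (eq_param_zero_of_fixed h p.2)
  · rintro rfl; exact param_mem I 0

theorem eval_mem_productAlg {I : τ.Bases} {x₀ : ToricSpace τ η} (hx : x₀ ∈ chartSet η I)
    (P : MvPolynomial (Idx I) ℂ) :
    (fun (t : BigTorus d) (x : ToricSpace τ η) =>
      P.eval fun κ => (bigChar (chartWt η I κ) t : ℂ) * coord I x κ) ∈ productAlg d x₀ := by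
  induction P using MvPolynomial.induction_on with
  | C c =>
    simp only [MvPolynomial.eval_C]
    exact (productAlg d x₀).algebraMap_mem c
  | add p q hp hq =>
    simp only [map_add]
    exact add_mem hp hq
  | mul_X p κ hp =>
    simp only [map_mul, MvPolynomial.eval_X]
    refine mul_mem hp (mul_mem ?_ ?_)
    · exact Algebra.subset_adjoin (Or.inl ⟨_, rfl⟩)
    · exact Algebra.subset_adjoin (Or.inr ⟨_, regularAt_coord hx κ, rfl⟩)

/-- In the coordinates of the charts the action is diagonal, by characters of the torus. -/
theorem isAlgebraicAction : IsAlgebraicAction d (ToricSpace τ η) := by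
  intro f t₀ x₀ hf
  obtain ⟨I, hI⟩ := exists_mem_chartSet x₀
  have h1 : t₀ • x₀ = param I fun κ => (bigChar (chartWt η I κ) t₀ : ℂ) * coord I x₀ κ := by
    conv_lhs => rw [← param_coord hI]
    exact smul_param I _ _
  rw [h1] at hf
  obtain ⟨P, Q, h0, h⟩ := regularAt_param_iff.1 hf
  refine ⟨_, eval_mem_productAlg hI P, _, eval_mem_productAlg hI Q, h0, ?_⟩
  filter_upwards [(isOpen_chartSet I).mem_nhds hI] with x hx t ht
  rw [← h _ ht, ← smul_param, param_coord hx]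

/-! ### Attracting sets and their closures -/

instance neBot_comap_units : (comap (fun s : ℂˣ => (s : ℂ)) (𝓝 0)).NeBot := by
  refine comap_neBot fun t ht => ?_
  obtain ⟨ε, hε, h⟩ := Metric.mem_nhds_iff.1 ht
  refine ⟨Units.mk0 ((ε / 2 : ℝ) : ℂ) (by exact_mod_cast (by positivity : ε / 2 ≠ 0)), h ?_⟩
  rw [Units.val_mk0, mem_ball_zero_iff, Complex.norm_real, Real.norm_of_nonneg (by positivity)]
  linarith

theorem tendsto_units_val :
    Tendsto (fun s : ℂˣ => (s : ℂ)) (comap (fun s : ℂˣ => (s : ℂ)) (𝓝 0)) (𝓝 0) := tendsto_comap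

theorem tendsto_units_zpow {m : ℤ} (hm : 0 < m) :
    Tendsto (fun s : ℂˣ => ((s ^ m : ℂˣ) : ℂ)) (comap (fun s : ℂˣ => (s : ℂ)) (𝓝 0)) (𝓝 0) := by
  obtain ⟨k, rfl⟩ := Int.eq_ofNat_of_zero_le hm.le
  have h : Tendsto (fun s : ℂˣ => (s : ℂ) ^ k) (comap (fun s : ℂˣ => (s : ℂ)) (𝓝 0))
      (𝓝 ((0 : ℂ) ^ k)) := tendsto_comap.pow k
  rw [zero_pow (by omega)] at h
  simpa using h

theorem realPairing_realPt {e : ℕ} (ξ α : Fin e → ℤ) :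
    realPairing (realPt ξ) α = ((ξ ⬝ᵥ α : ℤ) : ℝ) := by
  simp [realPairing, realPt, dotProduct]

theorem realPairing_neg {e : ℕ} (x : Fin e → ℝ) (α : Fin e → ℤ) :
    realPairing x (-α) = -realPairing x α := by
  simp [realPairing]

/-- The set of points of `𝔥_ℝ` on the same side as `ξ` of all the hyperplanes of the cocircuits. -/
def cell (τ : TorusSequence n r d) (ξ : Fin d → ℤ) : Set (Fin d → ℝ) :=
  {x | ∀ (I : τ.Bases), ∀ i ∈ I.1, 0 < realPairing x (alpha I i) * ((ξ ⬝ᵥ alpha I i : ℤ) : ℝ)}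

theorem dotProduct_alpha_ne_zero {ξ : Fin d → ℤ} (huni : τ.IsUnimodular)
    (hξ : τ.dual.IsGeneric ξ) {I : τ.Bases} {i : Fin n} (hi : i ∈ I.1) : ξ ⬝ᵥ alpha I i ≠ 0 := by
  rw [← bet_compl hi]
  exact generic_bet_ne_zero huni.dual hξ (by rw [Bases.mem_compl]; exact not_not.2 hi)

/-- The attracting set of a fixed point is the subspace of its chart spanned by the coordinates with
positive weight. -/
theorem mem_attr_param_iff {ξ : Fin d → ℤ} {C : Set (Fin d → ℝ)}
    (hC : realPt ξ ∈ C) (hC₂ : C ⊆ cell τ ξ) {J : τ.Bases} {x : ToricSpace τ η} :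
    x ∈ attr d C (param J 0 : ToricSpace τ η) ↔ x ∈ chartSet η J ∧
      ∀ κ, coord J x κ ≠ 0 → 0 < (chartWt η J κ).1 ⬝ᵥ ξ := by
  classical
  constructor
  · rintro ⟨ξ', hξ', h⟩
    have hx : x ∈ chartSet η J := by
      have hev : ∀ᶠ y in 𝓝 (param J 0 : ToricSpace τ η), y ∈ chartSet η J :=
        (isOpen_chartSet J).mem_nhds (param_mem J 0)
      have h1 := h (fun y => if y ∈ chartSet η J then 1 else 0)
        (regularAt_congr (fun _ => 1) _ _ (regularAt_const 1 _) (by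
          filter_upwards [hev] with y hy
          rw [if_pos hy]))
      rw [if_pos (param_mem J 0)] at h1
      obtain ⟨s, hs⟩ := (h1.eventually_ne one_ne_zero).exists
      simp only [smul_mem_chartSet_iff] at hs
      by_contra hx
      rw [if_neg hx] at hs
      exact hs rfl
    refine ⟨hx, fun κ hκ => ?_⟩
    have h1 := h _ (regularAt_coord (param_mem J 0) κ)
    simp only [coord_smul hx, coord_param, Pi.zero_apply] at h1
    have h2 : ∀ s : ℂˣ, bigChar (chartWt η J κ) (oneParam ξ' s, 1) =
        s ^ ((chartWt η J κ).1 ⬝ᵥ ξ') := by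
      intro s
      rw [bigChar, one_zpow, mul_one]; exact torusChar_oneParam _ _ _
    simp only [h2] at h1
    have h3 : 0 < (chartWt η J κ).1 ⬝ᵥ ξ' * ((chartWt η J κ).1 ⬝ᵥ ξ) := by
      rcases κ with κ | κ
      · have := hC₂ hξ' J κ κ.2
        rw [realPairing_realPt] at this
        simp only [chartWt, dotProduct_comm _ ξ', dotProduct_comm _ ξ]
        exact_mod_cast this
      · have := hC₂ hξ' J κ κ.2
        rw [realPairing_realPt] at this
        simp only [chartWt, dotProduct_comm _ ξ', dotProduct_comm _ ξ, dotProduct_neg, neg_mul_neg]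
        exact_mod_cast this
    by_contra hneg
    have h4 : 0 < -((chartWt η J κ).1 ⬝ᵥ ξ') := by
      rcases pos_and_pos_or_neg_and_neg_of_mul_pos h3 with h | h
      · exact absurd h.2 hneg
      · omega
    have h5 := (tendsto_units_zpow h4).mul h1
    rw [zero_mul] at h5
    refine hκ (tendsto_nhds_unique (tendsto_const_nhds.congr fun s => ?_) h5)
    rw [← mul_assoc, ← Units.val_mul, ← zpow_add, neg_add_cancel, zpow_zero, Units.val_one, one_mul]
  · rintro ⟨hx, h⟩
    refine ⟨ξ, hC, fun f hf => ?_⟩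
    obtain ⟨P, Q, h0, hPQ⟩ := regularAt_param_iff.1 hf
    have hlim : Tendsto (fun (s : ℂˣ) (κ : Idx J) =>
        (bigChar (chartWt η J κ) (oneParam ξ s, 1) : ℂ) * coord J x κ)
        (comap (fun s : ℂˣ => (s : ℂ)) (𝓝 0)) (𝓝 0) := by
      refine tendsto_pi_nhds.2 fun κ => ?_
      by_cases hκ : coord J x κ = 0
      · simp only [hκ, mul_zero]; exact tendsto_const_nhds
      · have := (tendsto_units_zpow (h κ hκ)).mul_const (coord J x κ)
        rw [zero_mul] at this
        refine this.congr fun s => ?_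
        rw [bigChar, one_zpow, mul_one, torusChar_oneParam]
    have hP := (P.continuous_eval.tendsto 0).comp hlim
    have hQ := (Q.continuous_eval.tendsto 0).comp hlim
    rw [hPQ 0 h0]
    refine (hP.div hQ h0).congr' ?_
    filter_upwards [hQ.eventually_ne h0] with s hs
    refine (hPQ _ hs).symm.trans (congrArg f ?_)
    rw [← smul_param, param_coord hx]

/-- The closure of the attracting set of `p_J` contains `p_I` if and only if the vertex `I` lies on
the region of the arrangement attached to `J`. -/
theorem param_mem_closure_attr_iff {ξ : Fin d → ℤ} (hξ : τ.dual.IsGeneric ξ)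
    {C : Set (Fin d → ℝ)} (hC : realPt ξ ∈ C) (hC₂ : C ⊆ cell τ ξ) {I J : τ.Bases} :
    (param I 0 : ToricSpace τ η) ∈ closure (attr d C (param J 0 : ToricSpace τ η)) ↔
      Feas η ξ I J := by
  classical
  constructor
  · intro hcl k hk
    have hne : slack I η k * signVec η ξ J k ≠ 0 := by
      refine mul_ne_zero ?_ (signVec_ne_zero hN.uni hN.gen hξ J k)
      rw [slack_notMem hk]; exact generic_bet_ne_zero hN.uni hN.gen hk
    by_contra hneg
    -- one of the coordinates that are invertible at `p_I` vanishes on the whole attracting set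
    have hV : IsOpen {x : ToricSpace τ η | ∀ z : Level τ η, proj z = x → z.1 (sel η I k) ≠ 0} := by
      rw [toric_isOpen_iff]
      intro z hz
      refine ⟨MvPolynomial.X (sel η I k), ?_, fun w hw v hv => ?_⟩
      · rw [MvPolynomial.eval_X]; exact hz z rfl
      · rw [MvPolynomial.eval_X] at hw
        obtain ⟨s, rfl⟩ := proj_eq_iff.1 hv.symm
        exact mul_ne_zero (Units.ne_zero _) hw
    obtain ⟨x, hxV, hxA⟩ := mem_closure_iff.1 hcl _ hV (by
      intro z hz
      obtain ⟨s, rfl⟩ := proj_eq_iff.1 hz.symm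
      refine mul_ne_zero (Units.ne_zero _) ?_
      change slicePt η I 0 _ ≠ 0
      rw [slicePt_sel 0 hk]; exact one_ne_zero)
    obtain ⟨hxJ, hx⟩ := (mem_attr_param_iff hC hC₂).1 hxA
    have h1 : slicePt η J (coord J x) (sel η I k) ≠ 0 := hxV _ (param_coord hxJ)
    rw [slack_notMem hk] at hneg hne
    by_cases hkJ : k ∈ J.1
    · rw [signVec_mem hkJ, dualSlack_mem hkJ] at hneg hne
      unfold sel at h1
      split_ifs at h1 with hp
      · have h2 := hx (Sum.inl ⟨k, hkJ⟩) fun h =>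
          h1 ((slicePt_incl (η := η) J _ (Sum.inl ⟨k, hkJ⟩)).trans h)
        rw [dotProduct_comm] at h2
        exact hneg (mul_pos hp h2)
      · have h2 := hx (Sum.inr ⟨k, hkJ⟩) fun h =>
          h1 ((slicePt_incl (η := η) J _ (Sum.inr ⟨k, hkJ⟩)).trans h)
        simp only [chartWt, dotProduct_comm _ ξ, dotProduct_neg] at h2
        have := left_ne_zero_of_mul hne
        exact hneg (mul_pos_of_neg_of_neg (by omega) (by omega))
    · rw [signVec_notMem hkJ, slack_notMem hkJ] at hneg hne
      have hq : (quadric J k).eval (coord J x) = 0 := by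
        rw [eval_quadric]
        refine Finset.sum_eq_zero fun i _ => ?_
        by_cases hi : coord J x (Sum.inl i) = 0
        · rw [hi, zero_mul, mul_zero]
        · have h2 := hx (Sum.inl i) hi
          by_cases hi2 : coord J x (Sum.inr i) = 0
          · rw [hi2, mul_zero, mul_zero]
          · have h3 := hx (Sum.inr i) hi2
            simp only [chartWt, neg_dotProduct] at h2 h3
            omega
      have hn1 := left_ne_zero_of_mul hne
      have hn2 := right_ne_zero_of_mul hne
      unfold sel at h1
      split_ifs at h1 with hp
      · have : ¬ 0 < η ⬝ᵥ bet J k := fun h => hneg (mul_pos hp h)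
        refine h1 ?_
        simp [slicePt, slicePoly, hkJ, this, hq]
      · have : 0 < η ⬝ᵥ bet J k := by
          by_contra h
          exact hneg (mul_pos_of_neg_of_neg (by omega) (by omega))
        refine h1 ?_
        simp [slicePt, slicePoly, hkJ, this, hq]
  · intro hF
    rw [mem_closure_iff]
    intro o ho hIo
    obtain ⟨Q, h0, hQ⟩ := toric_isOpen_iff.1 ho (slice I 0) hIo
    -- the line from the fixed point in the direction with all the signs of the region of `J`
    let v : Pt n := Sum.elim (fun k => if 0 < signVec η ξ J k then 1 else 0)
      (fun k => if 0 < signVec η ξ J k then 0 else 1)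
    let w : ℂ → Pt n := fun s k => slicePt η I 0 k + s * v k
    have hw0 : w 0 = slicePt η I 0 := by funext k; simp [w]
    have hcont : Continuous fun s => Q.eval (w s) :=
      Q.continuous_eval.comp (continuous_pi fun k => by fun_prop)
    have hev1 : ∀ᶠ s : ℂˣ in comap (fun s : ℂˣ => (s : ℂ)) (𝓝 0), Q.eval (w s) ≠ 0 := by
      have := (hcont.tendsto 0).comp tendsto_units_val
      refine this.eventually_ne ?_
      rw [hw0]; exact h0
    have hev2 : ∀ᶠ s : ℂˣ in comap (fun s : ℂˣ => (s : ℂ)) (𝓝 0), (s : ℂ) ≠ -1 :=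
      tendsto_units_val.eventually_ne (by norm_num)
    obtain ⟨s, hs1, hs2⟩ := (hev1.and hev2).exists
    have hs3 : (1 : ℂ) + s ≠ 0 := fun h => hs2 (by linear_combination h)
    have hinl : ∀ k, (w s (Sum.inl k) ≠ 0 ↔ 0 < signVec η ξ J k) := by
      intro k
      have hz := (slicePt_zero (η := η) I k).1
      by_cases hk : k ∈ I.1
      · by_cases hp : 0 < signVec η ξ J k <;> simp [w, v, hz, hk, hp]
      · have hFk := hF k hk
        rw [slack_notMem hk] at hFk
        by_cases hp : 0 < signVec η ξ J k
        · have : 0 < η ⬝ᵥ bet I k := pos_of_mul_pos_left hFk hp.le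
          simp [w, v, hz, hk, hp, this, hs3]
        · have : ¬ 0 < η ⬝ᵥ bet I k := fun h => hp (pos_of_mul_pos_right hFk h.le)
          simp [w, v, hz, hk, hp, this]
    have hinr : ∀ k, (w s (Sum.inr k) ≠ 0 ↔ ¬ 0 < signVec η ξ J k) := by
      intro k
      have hz := (slicePt_zero (η := η) I k).2
      by_cases hk : k ∈ I.1
      · by_cases hp : 0 < signVec η ξ J k
        · simp [w, v, hz, hk, hp]
        · simp [w, v, hz, hk, not_lt.1 hp]
      · have hFk := hF k hk
        rw [slack_notMem hk] at hFk
        by_cases hp : 0 < signVec η ξ J k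
        · have : 0 < η ⬝ᵥ bet I k := pos_of_mul_pos_left hFk hp.le
          simp [w, v, hz, hk, hp, this]
        · have : ¬ 0 < η ⬝ᵥ bet I k := fun h => hp (pos_of_mul_pos_right hFk h.le)
          simp only [w, v, hz, hk, this, Sum.elim_inr, hp, if_false, not_false_eq_true, and_self,
            if_true, mul_one, iff_true]
          exact hs3
    have hmom : moment τ (w s) = 0 := by
      funext l
      refine Finset.sum_eq_zero fun k _ => ?_
      by_cases hp : 0 < signVec η ξ J k
      · have : w s (Sum.inr k) = 0 := by
          by_contra h; exact (hinr k).1 h hp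
        rw [this, mul_zero, zero_mul]
      · have : w s (Sum.inl k) = 0 := by
          by_contra h; exact hp ((hinl k).1 h)
        rw [this, zero_mul, zero_mul]
    have hJ : InChart η J (w s) := by
      intro k hk
      unfold sel
      rw [← slack_notMem hk, ← signVec_notMem hk (ξ := ξ)]
      split_ifs with hp
      · exact (hinl k).2 hp
      · exact (hinr k).2 hp
    let z : Level τ η := ⟨w s, hmom, hJ.isSemistable⟩
    refine ⟨proj z, hQ z hs1, (mem_attr_param_iff hC hC₂).2 ⟨proj_mem_chartSet.2 hJ, ?_⟩⟩
    intro κ hκ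
    rw [coord_proj (z := z) hJ] at hκ
    have h1 : w s κ.incl ≠ 0 := right_ne_zero_of_mul hκ
    rcases κ with κ | κ
    · have := (hinl _).1 h1
      rw [signVec_mem κ.2, dualSlack_mem κ.2] at this
      rwa [dotProduct_comm]
    · have h2 := (hinr _).1 h1
      rw [signVec_mem κ.2, dualSlack_mem κ.2] at h2
      have h3 := dotProduct_alpha_ne_zero hN.uni hξ κ.2
      simp only [chartWt, dotProduct_comm _ ξ, dotProduct_neg]
      omega

/-- The order on the fixed points is the one generated by the incidence of vertices and regions of the
arrangement. -/
theorem fixedLE_iff {ξ : Fin d → ℤ} (hξ : τ.dual.IsGeneric ξ) {C : Set (Fin d → ℝ)}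
    (hC : realPt ξ ∈ C) (hC₂ : C ⊆ cell τ ξ) {I J : τ.Bases} :
    fixedLE d C (fixedEquiv τ η I) (fixedEquiv τ η J) ↔
      Relation.ReflTransGen (Feas η ξ) I J := by
  constructor
  · intro h
    have := Relation.ReflTransGen.lift (p := Feas η ξ) (fixedEquiv τ η).symm (fun p q hpq => by
      obtain ⟨I, rfl⟩ := (fixedEquiv τ η).surjective p
      obtain ⟨J, rfl⟩ := (fixedEquiv τ η).surjective q
      simp only [Function.onFun, Equiv.symm_apply_apply]
      exact (param_mem_closure_attr_iff hξ hC hC₂).1 hpq) _ _ h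
    simpa [Function.onFun] using this
  · intro h
    exact Relation.ReflTransGen.lift (fixedEquiv τ η)
      (fun I J h => (param_mem_closure_attr_iff hξ hC hC₂).2 h) _ _ h

end Action

/-! ### Tangent spaces at the fixed points -/

theorem differentiable_eval {σ : Type*} (P : MvPolynomial σ ℂ) {w : ℂ → σ → ℂ}
    (hw : ∀ k, Differentiable ℂ fun s => w s k) : Differentiable ℂ fun s => P.eval (w s) := by
  induction P using MvPolynomial.induction_on with
  | C c => simp
  | add p q hp hq => simp only [map_add]; exact hp.add hq
  | mul_X p k hp => simp only [map_mul, MvPolynomial.eval_X]; exact hp.mul (hw k)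

section Derivation

variable {X : Type} [SpaceWithFunctions X] {p : X}

/-- A point derivation depends only on the germ of the function. -/
theorem tangent_congr {D : regularAlg p →ₗ[ℂ] ℂ} (hD : D ∈ tangentSpace p) {f g : regularAlg p}
    (h : ∀ᶠ y in 𝓝 p, f.1 y = g.1 y) : D f = D g := by
  classical
  -- the indicator of the set where `f` and `g` differ vanishes near `p`
  let χ : regularAlg p := ⟨fun y => if f.1 y = g.1 y then 0 else 1,
    regularAt_congr (fun _ => 0) _ _ (regularAt_const 0 p) (by
      filter_upwards [h] with y hy
      rw [if_pos hy])⟩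
  have h1 : (f - g) * χ = f - g := by
    refine Subtype.ext (funext fun y => ?_)
    change (f.1 y - g.1 y) * (if f.1 y = g.1 y then 0 else 1) = f.1 y - g.1 y
    split_ifs with hy
    · rw [hy]; ring
    · rw [mul_one]
  have h2 := hD (f - g) χ
  have h3 : f.1 p = g.1 p := h.self_of_nhds
  have h4 : (f - g).1 p = 0 := sub_eq_zero.2 h3
  have h5 : χ.1 p = 0 := if_pos h3
  rw [h1, h4, h5, zero_mul, zero_mul, add_zero, map_sub] at h2
  exact sub_eq_zero.1 h2

theorem tangent_algebraMap {D : regularAlg p →ₗ[ℂ] ℂ} (hD : D ∈ tangentSpace p) (c : ℂ) :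
    D (algebraMap ℂ (regularAlg p) c) = 0 := by
  have h1 := hD 1 1
  have h2 : D 1 = 0 := by
    have h3 : (1 : regularAlg p).1 p = 1 := rfl
    rw [mul_one, h3, one_mul] at h1
    linear_combination -h1
  rw [Algebra.algebraMap_eq_smul_one, map_smul, h2, smul_zero]

theorem tangent_aeval_eq_zero {σ : Type*} {D : regularAlg p →ₗ[ℂ] ℂ} (hD : D ∈ tangentSpace p)
    (c : σ → regularAlg p) (hc : ∀ k, D (c k) = 0) (P : MvPolynomial σ ℂ) :
    D (MvPolynomial.aeval c P) = 0 := by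
  induction P using MvPolynomial.induction_on with
  | C a => rw [MvPolynomial.aeval_C]; exact tangent_algebraMap hD a
  | add p q hp hq => rw [map_add, map_add, hp, hq, add_zero]
  | mul_X p k hp =>
    rw [map_mul, MvPolynomial.aeval_X, hD, hp, hc, mul_zero, mul_zero, add_zero]

end Derivation

section Tangent

variable {n r d : ℕ} {τ : TorusSequence n r d} {η : Fin r → ℤ} [hN : Nondeg τ η]

variable (η) in
/-- The coordinates as functions that are regular near the fixed point. -/
def coordFn (I : τ.Bases) (κ : Idx I) : regularAlg (param I 0 : ToricSpace τ η) :=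
  ⟨fun y => coord I y κ, regularAt_coord (param_mem I 0) κ⟩

theorem aeval_coordFn (I : τ.Bases) (P : MvPolynomial (Idx I) ℂ) (y : ToricSpace τ η) :
    (MvPolynomial.aeval (coordFn η I) P).1 y = P.eval (coord I y) := by
  induction P using MvPolynomial.induction_on with
  | C a => rw [MvPolynomial.aeval_C, MvPolynomial.eval_C]; rfl
  | add p q hp hq => rw [map_add, map_add, ← hp, ← hq]; rfl
  | mul_X p k hp => rw [map_mul, map_mul, MvPolynomial.aeval_X, MvPolynomial.eval_X, ← hp]; rfl

/-- A tangent vector is determined by its values on the coordinates. -/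
theorem tangent_eq_zero {I : τ.Bases} {D : regularAlg (param I 0 : ToricSpace τ η) →ₗ[ℂ] ℂ}
    (hD : D ∈ tangentSpace (param I 0 : ToricSpace τ η)) (h : ∀ κ, D (coordFn η I κ) = 0) :
    D = 0 := by
  ext f
  obtain ⟨P, Q, h0, hPQ⟩ := regularAt_param_iff.1 f.2
  have h1 : D (f * MvPolynomial.aeval (coordFn η I) Q) = D (MvPolynomial.aeval (coordFn η I) P) := by
    refine tangent_congr hD (eventually_param_iff.2 ⟨Q, h0, fun v hv => ?_⟩)
    change f.1 (param I v) * (MvPolynomial.aeval (coordFn η I) Q).1 (param I v) = _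
    rw [aeval_coordFn, aeval_coordFn, coord_param, hPQ v hv, div_mul_cancel₀ _ hv]
  rw [hD, tangent_aeval_eq_zero hD _ h, tangent_aeval_eq_zero hD _ h, mul_zero, zero_add,
    aeval_coordFn, coord_param] at h1
  exact (mul_eq_zero.1 h1).resolve_left h0

/-- A regular function is differentiable along a differentiable curve in a chart. -/
theorem differentiableAt_param {I : τ.Bases} {f : ToricSpace τ η → ℂ} {w : ℂ → Idx I → ℂ}
    (hw : ∀ κ, Differentiable ℂ fun s => w s κ) {s₀ : ℂ} (hf : RegularAt f (param I (w s₀))) :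
    DifferentiableAt ℂ (fun s => f (param I (w s))) s₀ := by
  obtain ⟨P, Q, h0, h⟩ := regularAt_param_iff.1 hf
  have hP := differentiable_eval P hw
  have hQ := differentiable_eval Q hw
  refine ((hP s₀).div (hQ s₀) h0).congr_of_eventuallyEq ?_
  filter_upwards [hQ.continuous.continuousAt.eventually_ne h0] with s hs
  exact h _ hs

theorem differentiable_single {σ : Type*} [DecidableEq σ] (κ k : σ) :
    Differentiable ℂ fun s : ℂ => (Pi.single κ s : σ → ℂ) k := by
  by_cases h : k = κ
  · subst h; simp [differentiable_fun_id]
  · simp [h]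

theorem differentiableAt_single {I : τ.Bases} (κ : Idx I)
    (f : regularAlg (param I 0 : ToricSpace τ η)) :
    DifferentiableAt ℂ (fun s => f.1 (param I (Pi.single κ s))) 0 := by
  refine differentiableAt_param (w := fun s => Pi.single κ s) (differentiable_single κ) ?_
  rw [Pi.single_zero]; exact f.2

variable (η) in
/-- The partial derivatives at the fixed point. -/
def partialD (I : τ.Bases) (κ : Idx I) : regularAlg (param I 0 : ToricSpace τ η) →ₗ[ℂ] ℂ where
  toFun f := deriv (fun s => f.1 (param I (Pi.single κ s))) 0
  map_add' f g := deriv_add (differentiableAt_single κ f) (differentiableAt_single κ g)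
  map_smul' c f := deriv_const_mul c (differentiableAt_single κ f)

theorem partialD_mem (I : τ.Bases) (κ : Idx I) :
    partialD η I κ ∈ tangentSpace (param I 0 : ToricSpace τ η) := by
  intro f g
  have := deriv_mul (differentiableAt_single κ f) (differentiableAt_single κ g)
  simp only [Pi.single_zero] at this
  refine Eq.trans this ?_
  simp only [partialD, LinearMap.coe_mk, AddHom.coe_mk]
  ring

theorem partialD_coordFn (I : τ.Bases) (κ κ₂ : Idx I) :
    partialD η I κ (coordFn η I κ₂) = if κ = κ₂ then 1 else 0 := by
  change deriv (fun s => coord I (param I (Pi.single κ s) : ToricSpace τ η) κ₂) 0 = _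
  simp only [coord_param]
  split_ifs with h
  · subst h; simp
  · simp [Ne.symm h]

theorem tangent_eq_sum {I : τ.Bases} {D : regularAlg (param I 0 : ToricSpace τ η) →ₗ[ℂ] ℂ}
    (hD : D ∈ tangentSpace (param I 0 : ToricSpace τ η)) :
    D = ∑ κ, D (coordFn η I κ) • partialD η I κ := by
  rw [← sub_eq_zero]
  refine tangent_eq_zero (sub_mem hD (sum_mem fun κ _ => Submodule.smul_mem _ _
    (partialD_mem I κ))) fun κ => ?_
  rw [LinearMap.sub_apply, LinearMap.sum_apply, Fintype.sum_eq_single κ fun κ₂ h => by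
    rw [LinearMap.smul_apply, partialD_coordFn, if_neg h, smul_zero], LinearMap.smul_apply,
    partialD_coordFn, if_pos rfl, smul_eq_mul, mul_one, sub_self]

/-- The dimension of a coordinate subspace of the tangent space. -/
theorem finrank_of_mem_iff {I : τ.Bases} (S : Idx I → Prop)
    (W : Submodule ℂ (regularAlg (param I 0 : ToricSpace τ η) →ₗ[ℂ] ℂ))
    (hW : ∀ D, D ∈ W ↔ D ∈ tangentSpace (param I 0 : ToricSpace τ η) ∧
      ∀ κ, ¬ S κ → D (coordFn η I κ) = 0) :
    Module.finrank ℂ W = Nat.card {κ // S κ} := by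
  classical
  let φ : W →ₗ[ℂ] ({κ // S κ} → ℂ) :=
    { toFun := fun D κ => D.1 (coordFn η I κ.1)
      map_add' := fun _ _ => rfl
      map_smul' := fun _ _ => rfl }
  have hφ : Function.Bijective φ := by
    constructor
    · rw [← LinearMap.ker_eq_bot, LinearMap.ker_eq_bot']
      rintro ⟨D, hD⟩ h
      refine Subtype.ext (tangent_eq_zero ((hW D).1 hD).1 fun κ => ?_)
      by_cases hκ : S κ
      · exact congrFun h ⟨κ, hκ⟩
      · exact ((hW D).1 hD).2 κ hκ
    · intro c
      refine ⟨⟨∑ κ : {κ // S κ}, c κ • partialD η I κ.1, (hW _).2 ⟨sum_mem fun κ _ =>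
        Submodule.smul_mem _ _ (partialD_mem I κ.1), fun κ hκ => ?_⟩⟩, funext fun κ => ?_⟩
      · rw [LinearMap.sum_apply]
        refine Finset.sum_eq_zero fun κ₂ _ => ?_
        rw [LinearMap.smul_apply, partialD_coordFn, if_neg, smul_zero]
        rintro h; exact hκ (h ▸ κ₂.2)
      · change (∑ κ : {κ // S κ}, c κ • partialD η I κ.1) (coordFn η I κ.1) = c κ
        rw [LinearMap.sum_apply, Fintype.sum_eq_single κ]
        · simp [partialD_coordFn]
        · intro κ₂ hκ₂
          rw [LinearMap.smul_apply, partialD_coordFn, if_neg, smul_zero]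
          exact fun h => hκ₂ (Subtype.ext h)
  rw [(LinearEquiv.ofBijective φ hφ).finrank_eq, Module.finrank_fintype_fun_eq_card,
    Nat.card_eq_fintype_card]

/-- The weight spaces for a subset `A` of the torus are spanned by partial derivatives. -/
theorem mem_weightSpace_iff {I : τ.Bases} (A : Set (BigTorus d)) (χ : BigTorus d → ℂˣ)
    (D : regularAlg (param I 0 : ToricSpace τ η) →ₗ[ℂ] ℂ) :
    (D ∈ tangentSpace (param I 0 : ToricSpace τ η) ∧
      ∀ t ∈ A, ∀ f g : regularAlg (param I 0 : ToricSpace τ η),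
        (∀ y, g.1 y = f.1 (t • y)) → D g = (χ t : ℂ) * D f) ↔
    D ∈ tangentSpace (param I 0 : ToricSpace τ η) ∧
      ∀ κ, ¬ (∀ t ∈ A, bigChar (chartWt η I κ) t = χ t) → D (coordFn η I κ) = 0 := by
  refine and_congr_right fun hD => ⟨fun h κ hκ => ?_, fun h t ht f g hfg => ?_⟩
  · push Not at hκ
    obtain ⟨t, ht, hne⟩ := hκ
    have hreg : RegularAt (fun y => coord I (t • y) κ) (param I 0 : ToricSpace τ η) :=
      TorusSpace.regularAt_smul (fun y => coord I y κ) t _ (by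
        rw [smul_param_zero]; exact regularAt_coord (param_mem I 0) κ)
    have h1 := h t ht (coordFn η I κ) ⟨fun y => coord I (t • y) κ, hreg⟩ fun _ => rfl
    have h2 : D ⟨fun y => coord I (t • y) κ, hreg⟩ = D ((bigChar (chartWt η I κ) t : ℂ) • coordFn η I κ) := by
      refine tangent_congr hD ?_
      filter_upwards [(isOpen_chartSet I).mem_nhds (param_mem I 0)] with y hy
      exact coord_smul hy t κ
    rw [h2, map_smul, smul_eq_mul] at h1
    by_contra h0
    exact hne (Units.ext (mul_right_cancel₀ h0 h1))
  · have h1 : ∀ κ, partialD η I κ g = (bigChar (chartWt η I κ) t : ℂ) * partialD η I κ f := by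
      intro κ
      let F : ℂ → ℂ := fun s => f.1 (param I (Pi.single κ s))
      have h2 : (fun s => g.1 (param I (Pi.single κ s))) = fun s =>
          F ((bigChar (chartWt η I κ) t : ℂ) * s) := by
        funext s
        rw [hfg, smul_param]
        refine congrArg (fun u => f.1 (param I u)) (funext fun κ₂ => ?_)
        by_cases hk : κ₂ = κ
        · subst hk; simp
        · simp [hk]
      change deriv (fun s => g.1 (param I (Pi.single κ s))) 0 = _ * deriv F 0
      rw [h2]
      refine (deriv_comp_mul_left _ F 0).trans ?_
      rw [mul_zero, smul_eq_mul]
    rw [tangent_eq_sum hD, LinearMap.sum_apply, LinearMap.sum_apply, Finset.mul_sum]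
    refine Finset.sum_congr rfl fun κ _ => ?_
    rw [LinearMap.smul_apply, LinearMap.smul_apply, h1]
    by_cases hκ : ∀ t ∈ A, bigChar (chartWt η I κ) t = χ t
    · rw [hκ t ht, smul_eq_mul, smul_eq_mul]; ring
    · rw [h κ hκ]; simp

theorem rootMult_param (I : τ.Bases) (α : Fin d → ℤ) :
    rootMult d (param I 0 : ToricSpace τ η) α = Nat.card {κ // (chartWt η I κ).1 = α} := by
  refine finrank_of_mem_iff _ _ fun D => ?_
  have h := mem_weightSpace_iff (η := η) (I := I) (Set.range fun h : Torus d => (h, 1))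
    (fun t => torusChar α t.1) D
  simp only [Set.forall_mem_range] at h
  refine Iff.trans h (and_congr_right fun _ => forall_congr' fun κ => imp_congr_left (not_congr ?_))
  simp only [bigChar, one_zpow, mul_one]
  exact ⟨torusChar_injective, fun h t => by rw [h]⟩

theorem finrank_bigWeightSpace_param (I : τ.Bases) (w : (Fin d → ℤ) × ℤ) :
    Module.finrank ℂ (bigWeightSpace d (param I 0 : ToricSpace τ η) w) =
      Nat.card {κ // chartWt η I κ = w} := by
  refine finrank_of_mem_iff _ _ fun D => ?_
  have h := mem_weightSpace_iff (η := η) (I := I) Set.univ (fun t => bigChar w t) D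
  simp only [Set.mem_univ, true_implies] at h
  refine Iff.trans h (and_congr_right fun _ => forall_congr' fun κ => imp_congr_left (not_congr ?_))
  exact ⟨bigChar_injective, fun h t => by rw [h]⟩

theorem dimAt_param (I : τ.Bases) : dimAt (param I 0 : ToricSpace τ η) = 2 * d := by
  rw [dimAt, finrank_of_mem_iff (η := η) (I := I) (fun _ => True) _ (by simp)]
  rw [Nat.card_congr (Equiv.subtypeUnivEquiv fun _ => trivial), Nat.card_eq_fintype_card,
    Fintype.card_sum, Fintype.card_coe, I.card]
  ring

theorem rootMult_ne_zero_iff {I : τ.Bases} {α : Fin d → ℤ} :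
    rootMult d (param I 0 : ToricSpace τ η) α ≠ 0 ↔ ∃ κ, (chartWt η I κ).1 = α := by
  rw [rootMult_param, Nat.card_ne_zero, nonempty_subtype]
  exact ⟨fun h => h.1, fun h => ⟨h, Subtype.finite⟩⟩

/-! ### Chambers -/

theorem realPairing_add {e : ℕ} (x y : Fin e → ℝ) (α : Fin e → ℤ) :
    realPairing (x + y) α = realPairing x α + realPairing y α := by
  simp [realPairing, add_mul, Finset.sum_add_distrib]

theorem realPairing_smul {e : ℕ} (c : ℝ) (x : Fin e → ℝ) (α : Fin e → ℤ) :
    realPairing (c • x) α = c * realPairing x α := by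
  simp [realPairing, Finset.mul_sum, mul_assoc]

theorem continuous_realPairing {e : ℕ} (α : Fin e → ℤ) :
    Continuous fun x : Fin e → ℝ => realPairing x α := by
  unfold realPairing; fun_prop

theorem mem_rootComplement_iff {x : Fin d → ℝ} : x ∈ rootComplement d (ToricSpace τ η) ↔
    ∀ I : τ.Bases, ∀ i ∈ I.1, realPairing x (alpha I i) ≠ 0 := by
  constructor
  · intro h I i hi
    exact h _ ⟨fixedEquiv τ η I, rootMult_ne_zero_iff.2 ⟨Sum.inl ⟨i, hi⟩, rfl⟩⟩
  · rintro h α ⟨p, hp⟩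
    obtain ⟨I, rfl⟩ := (fixedEquiv τ η).surjective p
    obtain ⟨κ, rfl⟩ := rootMult_ne_zero_iff.1 hp
    rcases κ with κ | κ
    · exact h I κ κ.2
    · change realPairing x (-alpha I κ) ≠ 0
      rw [realPairing_neg]
      exact neg_ne_zero.2 (h I κ κ.2)

theorem realPt_mem_cell {ξ : Fin d → ℤ} (huni : τ.IsUnimodular) (hξ : τ.dual.IsGeneric ξ) :
    realPt ξ ∈ cell τ ξ := by
  intro I i hi
  rw [realPairing_realPt]
  have := dotProduct_alpha_ne_zero huni hξ hi
  have h2 : ((ξ ⬝ᵥ alpha I i : ℤ) : ℝ) ≠ 0 := by exact_mod_cast this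
  exact mul_self_pos.2 h2

theorem convex_cell (ξ : Fin d → ℤ) : Convex ℝ (cell τ ξ) := by
  intro x hx y hy a b ha hb hab I i hi
  have h1 := hx I i hi
  have h2 := hy I i hi
  rw [realPairing_add, realPairing_smul, realPairing_smul, add_mul, mul_assoc, mul_assoc]
  rcases ha.eq_or_lt with rfl | ha
  · have : b = 1 := by linarith
    simpa [this] using h2
  · have := mul_pos ha h1
    have := mul_nonneg hb h2.le
    linarith

theorem realPt_mem_rootComplement {ξ : Fin d → ℤ} (hξ : τ.dual.IsGeneric ξ) :
    realPt ξ ∈ rootComplement d (ToricSpace τ η) := by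
  rw [mem_rootComplement_iff]
  intro I i hi
  exact left_ne_zero_of_mul (realPt_mem_cell hN.uni hξ I i hi).ne'

/-- The chamber of `ξ` is the set of points on the same side as `ξ` of all root hyperplanes. -/
theorem connectedComponentIn_eq_cell {ξ : Fin d → ℤ} (hξ : τ.dual.IsGeneric ξ) :
    connectedComponentIn (rootComplement d (ToricSpace τ η)) (realPt ξ) = cell τ ξ := by
  refine Set.Subset.antisymm (fun y hy I i hi => ?_) ?_
  · set c : ℝ := ((ξ ⬝ᵥ alpha I i : ℤ) : ℝ)
    by_contra hneg
    have hξ0 := realPt_mem_cell hN.uni hξ I i hi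
    have hcont : ContinuousOn (fun x : Fin d → ℝ => realPairing x (alpha I i) * c)
        (connectedComponentIn (rootComplement d (ToricSpace τ η)) (realPt ξ)) :=
      ((continuous_realPairing _).mul continuous_const).continuousOn
    obtain ⟨z, hz, hz0⟩ := isPreconnected_connectedComponentIn.intermediate_value hy
      (mem_connectedComponentIn (realPt_mem_rootComplement hξ)) hcont ⟨not_lt.1 hneg, hξ0.le⟩
    have h1 := mem_rootComplement_iff.1 (connectedComponentIn_subset _ _ hz) I i hi
    exact mul_ne_zero h1 (right_ne_zero_of_mul hξ0.ne') hz0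
  · refine (convex_cell ξ).isPreconnected.subset_connectedComponentIn
      (realPt_mem_cell hN.uni hξ) fun x hx => ?_
    rw [mem_rootComplement_iff]
    exact fun I i hi => left_ne_zero_of_mul (hx I i hi).ne'

/-! ### The repelling part of the tangent space -/

theorem negative_weights {e : ℕ} {c : ℤ} (hc : c ≠ 0) (v : Fin e → ℤ) (m : ℤ) :
    ((if c < 0 then (v, m - 1) else 0) + if -c < 0 then (-v, -m - 1) else 0) =
      (-((if 0 < c then 1 else -1 : ℤ) • v), -((if 0 < c then 1 else -1) * m) - 1) := by
  rcases lt_or_gt_of_ne hc with h | h <;> simp [h, h.not_gt]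

/-- Of the two coordinates of the chart with index `i ∈ I` exactly one is repelling, namely the one
whose weight is negative on `ξ`. -/
theorem wtDetNeg_param {ξ : Fin d → ℤ} (hξ : τ.dual.IsGeneric ξ) (I : τ.Bases) :
    wtDetNeg d (cell τ ξ) (param I 0 : ToricSpace τ η) =
      ∑ i : I.1, (-(sg ξ I.compl i • alpha I i),
        -(sg ξ I.compl i * monoDeg η I (τ.bVec i)) - 1) := by
  classical
  have hneg : ∀ κ, (∀ x ∈ cell τ ξ, realPairing x (chartWt η I κ).1 < 0) ↔
      ξ ⬝ᵥ (chartWt η I κ).1 < 0 := by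
    intro κ
    constructor
    · intro h
      have := h _ (realPt_mem_cell hN.uni hξ)
      rw [realPairing_realPt] at this
      exact_mod_cast this
    · intro h x hx
      rcases κ with κ | κ
      · have h1 := hx I κ κ.2
        have h2 : ((ξ ⬝ᵥ alpha I κ : ℤ) : ℝ) < 0 := by exact_mod_cast h
        exact neg_of_mul_pos_left h1 h2.le
      · have h1 := hx I κ κ.2
        change ξ ⬝ᵥ (-alpha I κ) < 0 at h
        rw [dotProduct_neg] at h
        have h2 : (0 : ℝ) < ((ξ ⬝ᵥ alpha I κ : ℤ) : ℝ) := by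
          have : 0 < ξ ⬝ᵥ alpha I κ := by omega
          exact_mod_cast this
        change realPairing x (-alpha I κ) < 0
        rw [realPairing_neg]
        have := pos_of_mul_pos_left h1 h2.le
        linarith
  have h1 : wtDetNeg d (cell τ ξ) (param I 0 : ToricSpace τ η) =
      ∑ κ, if ξ ⬝ᵥ (chartWt η I κ).1 < 0 then chartWt η I κ else 0 := by
    unfold wtDetNeg
    rw [finsum_eq_sum_of_support_subset (s := Finset.univ.image (chartWt η I))]
    · rw [← Finset.sum_fiberwise_of_maps_to (g := chartWt η I)
        (t := Finset.univ.image (chartWt η I)) (fun κ _ => Finset.mem_image_of_mem _ (Finset.mem_univ κ))]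
      refine Finset.sum_congr rfl fun w hw => ?_
      obtain ⟨κ₀, -, rfl⟩ := Finset.mem_image.1 hw
      rw [Finset.sum_congr rfl (g := fun _ => if ξ ⬝ᵥ (chartWt η I κ₀).1 < 0 then
        chartWt η I κ₀ else 0) fun κ hκ => by rw [(Finset.mem_filter.1 hκ).2],
        Finset.sum_const, finrank_bigWeightSpace_param, Nat.card_eq_fintype_card,
        Fintype.card_subtype]
      simp only [hneg]
      split_ifs <;> simp
    · intro w hw
      rw [Function.mem_support, finrank_bigWeightSpace_param] at hw
      have h2 : Nat.card {κ // chartWt η I κ = w} ≠ 0 := by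
        intro h; rw [h] at hw; simp at hw
      obtain ⟨⟨κ, hκ⟩⟩ := (Nat.card_ne_zero.1 h2).1
      exact Finset.mem_coe.2 (Finset.mem_image.2 ⟨κ, Finset.mem_univ _, hκ⟩)
  rw [h1, Fintype.sum_sum_type, ← Finset.sum_add_distrib]
  refine Finset.sum_congr rfl fun i _ => ?_
  have h0 := dotProduct_alpha_ne_zero hN.uni hξ i.2
  simp only [chartWt, dotProduct_neg, sg, bet_compl i.2]
  exact negative_weights h0 _ _

end Tangent

set_option linter.unusedSectionVars false

section Bundles

variable {n r d : ℕ} {τ : TorusSequence n r d} {η : Fin r → ℤ} [hN : Nondeg τ η]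

/-! ### The line bundles associated with characters -/

/-- A chart that contains `x`. -/
def chIdx (x : ToricSpace τ η) : τ.Bases := (exists_mem_chartSet x).choose

theorem mem_chIdx (x : ToricSpace τ η) : x ∈ chartSet η (chIdx x) :=
  (exists_mem_chartSet x).choose_spec

theorem inChart_chIdx (z : Level τ η) : InChart η (chIdx (proj z)) z.1 :=
  proj_mem_chartSet.1 (mem_chIdx (proj z))

/-- A point of the level set over `x`. -/
def repr (x : ToricSpace τ η) : Level τ η := (proj_surjective x).choose

theorem proj_repr (x : ToricSpace τ η) : proj (repr x) = x := (proj_surjective x).choose_spec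

/-- A nowhere vanishing function of `S`-weight `-θ` on the level set; it identifies the fibres of
the trivial bundle with those of the line bundle.  It depends on the choice of a chart for each
point and is not regular. -/
def trivU (θ : Fin r → ℤ) (z : Level τ η) : ℂˣ := (mono η (chIdx (proj z)) θ z.1)⁻¹

theorem trivU_inS (θ : Fin r → ℤ) (z : Level τ η) (s : Torus r) :
    trivU θ (levelAct (inS τ s) z) = (torusChar θ s)⁻¹ * trivU θ z := by
  unfold trivU
  rw [proj_act]
  refine (congrArg _ (mono_inS (inChart_chIdx z) θ s)).trans ?_
  rw [mul_inv]

/-- The frame on the chart of `I` of the line bundle of the character `θ` of `S`. -/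
def frame (I : τ.Bases) (θ : Fin r → ℤ) (y : ToricSpace τ η) : ℂˣ :=
  mono η I θ (repr y).1 * trivU θ (repr y)

theorem frame_proj {I : τ.Bases} {z : Level τ η} (hz : InChart η I z.1) (θ : Fin r → ℤ) :
    frame I θ (proj z) = mono η I θ z.1 * trivU θ z := by
  obtain ⟨s, hs⟩ := proj_eq_iff.1 (proj_repr (proj z)).symm
  have h1 : (repr (proj z)).1 = ptAct (inS τ s) z.1 := by rw [← hs]; rfl
  rw [frame, h1, mono_inS hz, ← hs, trivU_inS, mul_mul_mul_comm, mul_inv_cancel, one_mul]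

theorem frame_add (I : τ.Bases) (θ θ₂ : Fin r → ℤ) (y : ToricSpace τ η) :
    frame I (θ + θ₂) y = frame I θ y * frame I θ₂ y := by
  simp only [frame, trivU, mono_add, mul_inv]
  rw [mul_mul_mul_comm]

theorem levelRegularAt_mono {I : τ.Bases} {z₀ : Level τ η} (h : InChart η I z₀.1)
    (θ : Fin r → ℤ) : LevelRegularAt (fun z => ((mono η I θ z.1 : ℂˣ) : ℂ)) z₀ := by
  let R : MvPolynomial (Fin n ⊕ Fin n) ℂ := ∏ k ∈ I.1ᶜ, MvPolynomial.X (sel η I k)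
  have hR : ∀ z : Pt n, R.eval z ≠ 0 ↔ InChart η I z := by
    intro z
    simp [R, Finset.prod_ne_zero_iff, InChart]
  let P : MvPolynomial (Fin n ⊕ Fin n) ℂ :=
    ∏ k ∈ I.1ᶜ, MvPolynomial.X (sel η I k) ^ (sg η I k * slack I θ k).toNat
  let Q : MvPolynomial (Fin n ⊕ Fin n) ℂ :=
    ∏ k ∈ I.1ᶜ, MvPolynomial.X (sel η I k) ^ (-(sg η I k * slack I θ k)).toNat
  have hQ : ∀ z : Pt n, InChart η I z → Q.eval z ≠ 0 := by
    intro z hz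
    simp only [Q, map_prod, map_pow, MvPolynomial.eval_X, Finset.prod_ne_zero_iff,
      Finset.mem_compl]
    exact fun k hk => pow_ne_zero _ (hz k hk)
  refine ⟨P * R, Q * R, ?_, fun w hw => ?_⟩
  · rw [map_mul]; exact mul_ne_zero (hQ _ h) ((hR _).2 h)
  · rw [map_mul] at hw
    have hw2 := right_ne_zero_of_mul hw
    have hI := (hR _).1 hw2
    rw [map_mul, map_mul, mul_div_mul_right _ _ hw2]
    change ((∏ k, selU η I w.1 k ^ (sg η I k * slack I θ k) : ℂˣ) : ℂ) = _
    rw [Units.coe_prod, ← Finset.prod_mul_prod_compl I.1, Finset.prod_eq_one (s := I.1), one_mul]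
    · simp only [P, Q, map_prod, map_pow, MvPolynomial.eval_X, ← Finset.prod_div_distrib]
      refine Finset.prod_congr rfl fun k hk => ?_
      have hk' : k ∉ I.1 := by simpa using hk
      rw [← selU_val hI hk', Units.val_zpow_eq_zpow_val, ← zpow_natCast, ← zpow_natCast,
        ← zpow_sub₀ (Units.ne_zero _)]
      congr 1
      omega
    · intro k hk
      rw [slack_mem hk, mul_zero, zpow_zero, Units.val_one]

theorem LevelRegularAt.mul {f g : Level τ η → ℂ} {z : Level τ η} (hf : LevelRegularAt f z)
    (hg : LevelRegularAt g z) : LevelRegularAt (fun w => f w * g w) z := by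
  obtain ⟨P, Q, h0, h⟩ := hf
  obtain ⟨P₂, Q₂, h0₂, h₂⟩ := hg
  refine ⟨P * P₂, Q * Q₂, by simp [h0, h0₂], fun w hw => ?_⟩
  rw [map_mul] at hw
  simp only [h w (left_ne_zero_of_mul hw), h₂ w (right_ne_zero_of_mul hw), map_mul,
    div_mul_div_comm]

theorem LevelRegularAt.congr {f g : Level τ η → ℂ} {z : Level τ η} (hf : LevelRegularAt f z)
    {U : Set (ToricSpace τ η)} (hU : IsOpen U) (hz : proj z ∈ U)
    (hfg : ∀ w, proj w ∈ U → f w = g w) : LevelRegularAt g z := by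
  obtain ⟨P, Q, h0, h⟩ := hf
  obtain ⟨R, h1, h2⟩ := toric_isOpen_iff.1 hU z hz
  refine ⟨P * R, Q * R, by simp [h0, h1], fun w hw => ?_⟩
  rw [map_mul] at hw
  have h3 := right_ne_zero_of_mul hw
  rw [map_mul, map_mul, mul_div_mul_right _ _ h3, ← h w (left_ne_zero_of_mul hw),
    hfg w (h2 w h3)]

theorem unitRegularAt_frame {I J : τ.Bases} {x : ToricSpace τ η} (hI : x ∈ chartSet η I)
    (hJ : x ∈ chartSet η J) (θ : Fin r → ℤ) : UnitRegularAt (frame I θ / frame J θ) x := by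
  obtain ⟨z, rfl⟩ := proj_surjective x
  refine toricRegularAt_proj (f := fun y => (((frame I θ / frame J θ : ToricSpace τ η → ℂˣ) y : ℂˣ) : ℂ)).2 ?_
  refine (LevelRegularAt.mul (levelRegularAt_mono (proj_mem_chartSet.1 hI) θ)
    (levelRegularAt_mono (proj_mem_chartSet.1 hJ) (-θ))).congr
    ((isOpen_chartSet I).inter (isOpen_chartSet J)) ⟨hI, hJ⟩ fun w hw => ?_
  have h1 := frame_proj (proj_mem_chartSet.1 hw.1) θ
  have h2 := frame_proj (proj_mem_chartSet.1 hw.2) θ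
  rw [← Units.val_mul, Pi.div_apply, h1, h2, mul_div_mul_right_eq_div, mono_neg, div_eq_mul_inv]

variable (τ η) in
/-- The line bundle of the character `θ` of `S`. -/
def lineB (θ : Fin r → ℤ) : lineBundles (ToricSpace τ η) :=
  ⟨fun x => frame (chIdx x) θ, fun x => by
    filter_upwards [(isOpen_chartSet (chIdx x)).mem_nhds (mem_chIdx x)] with y hy
    exact unitRegularAt_frame hy (mem_chIdx y) θ⟩

/-- The action of `T × 𝕊` in the fibres of the line bundle of the character `w` of `T`. -/
def cocyc (w : Fin n → ℤ) (t : BigTorus n) (z : Level τ η) : ℂˣ :=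
  trivU (τ.b *ᵥ w) (levelAct t z) * torusChar w t.1 / trivU (τ.b *ᵥ w) z

theorem cocyc_mul (w : Fin n → ℤ) (s t : BigTorus n) (z : Level τ η) :
    cocyc w (s * t) z = cocyc w s (levelAct t z) * cocyc w t z := by
  unfold cocyc
  rw [levelAct_mul, Prod.fst_mul, torusChar_mul]
  ext
  push_cast
  field_simp

theorem cocyc_inS (w : Fin n → ℤ) (s : Torus r) (z : Level τ η) : cocyc w (inS τ s) z = 1 := by
  unfold cocyc
  rw [trivU_inS, torusChar_inS, mul_right_comm, inv_mul_cancel, one_mul, div_self']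

theorem cocyc_inS_right (w : Fin n → ℤ) (s : Torus r) (t : BigTorus n) (z : Level τ η) :
    cocyc w t (levelAct (inS τ s) z) = cocyc w t z := by
  have h1 := cocyc_mul w t (inS τ s) z
  rw [mul_comm t, cocyc_mul, cocyc_inS, cocyc_inS, one_mul, mul_one] at h1
  exact h1.symm

/-- The action of `H × 𝕊` in the fibres of the line bundle of the character `w` of `T`. -/
def eqCocyc (w : Fin n → ℤ) (t : BigTorus d) (x : ToricSpace τ η) : ℂˣ :=
  cocyc w (liftTorus τ t) (repr x)

theorem eqCocyc_proj (w : Fin n → ℤ) (t : BigTorus n) (z : Level τ η) :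
    eqCocyc w (toH τ t) (proj z) = cocyc w t z := by
  have h : t = liftTorus τ (toH τ t) * inS τ (torusHom τ.ret t.1) := by
    refine Prod.ext ?_ ?_
    · change t.1 = torusHom τ.sec (torusHom τ.a t.1) * torusHom τ.bᵀ (torusHom τ.ret t.1)
      rw [← torusHom_mul, ← torusHom_mul, ← torusHom_add, τ.sec_mul_a_add, torusHom_one]
    · change t.2 = t.2 * 1
      rw [mul_one]
  obtain ⟨s, hs⟩ := proj_eq_iff.1 (proj_repr (proj z)).symm
  conv_rhs => rw [h, cocyc_mul, cocyc_inS, mul_one, cocyc_inS_right]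
  rw [eqCocyc, ← hs, cocyc_inS_right]

variable (η) in
/-- The weight of `H × 𝕊` on the fibre over `p_I` of the bundle of the character `w` of `T`. -/
def fibreW (I : τ.Bases) (w : Fin n → ℤ) : (Fin d → ℤ) × ℤ :=
  (∑ i : I.1, w i • alpha I i, monoDeg η I (τ.b *ᵥ w))

theorem transpose_a_fibreW (I : τ.Bases) (w : Fin n → ℤ) :
    τ.aᵀ *ᵥ (fibreW η I w).1 = w - slack I (τ.b *ᵥ w) := by
  have h : w - τ.aᵀ *ᵥ (fibreW η I w).1 = slack I (τ.b *ᵥ w) := by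
    refine slack_unique (fun k hk => ?_) ?_
    · rw [Pi.sub_apply, transpose_a_mulVec, fibreW, sum_dotProduct,
        Fintype.sum_eq_single (⟨k, hk⟩ : I.1)]
      · rw [smul_dotProduct, alpha_dotProduct_aVec hk]; simp
      · rintro ⟨i, hi⟩ h
        rw [smul_dotProduct, alpha_dotProduct_aVec hk, if_neg fun h' => h (Subtype.ext h'),
          smul_zero]
    · rw [Matrix.mulVec_sub, b_mulVec_a, sub_zero]
  rw [← h, sub_sub_cancel]

/-- In the frame over a chart the torus acts by a character, because the frame is a monomial. -/
theorem cocyc_eq {I : τ.Bases} (w : Fin n → ℤ) (t : BigTorus n) {z : Level τ η}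
    (hz : InChart η I z.1) : cocyc w t z = bigChar (fibreW η I w) (toH τ t) *
      (frame I (τ.b *ᵥ w) (proj (levelAct t z)) / frame I (τ.b *ᵥ w) (proj z)) := by
  have h1 : bigChar (fibreW η I w) (toH τ t) =
      torusChar w t.1 * (torusChar (slack I (τ.b *ᵥ w)) t.1)⁻¹ * t.2 ^ monoDeg η I (τ.b *ᵥ w) := by
    rw [bigChar, torusChar_toH, transpose_a_fibreW, sub_eq_add_neg, torusChar_add, torusChar_neg]
    rfl
  rw [h1, frame_proj hz, frame_proj (z := levelAct t z) (hz.act t)]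
  change _ = _ * (mono η I (τ.b *ᵥ w) (ptAct t z.1) * _ / _)
  rw [mono_act hz, cocyc, zpow_neg, div_eq_mul_inv, div_eq_mul_inv]
  generalize torusChar (slack I (τ.b *ᵥ w)) t.1 = A
  generalize t.2 ^ monoDeg η I (τ.b *ᵥ w) = B
  generalize mono η I (τ.b *ᵥ w) z.1 = C
  generalize trivU (τ.b *ᵥ w) z = D
  rw [mul_inv]
  symm
  calc _ = (A⁻¹ * A) * (B * B⁻¹) * (C * C⁻¹) *
      (trivU (τ.b *ᵥ w) (levelAct t z) * torusChar w t.1 * D⁻¹) := by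
        simp only [mul_comm, mul_left_comm, mul_assoc]
    _ = _ := by simp

theorem eqCocyc_eq {I : τ.Bases} (w : Fin n → ℤ) (t : BigTorus d) {x : ToricSpace τ η}
    (hx : x ∈ chartSet η I) : eqCocyc w t x = bigChar (fibreW η I w) t *
      (frame I (τ.b *ᵥ w) (t • x) / frame I (τ.b *ᵥ w) x) := by
  obtain ⟨z, rfl⟩ := proj_surjective x
  obtain ⟨t, rfl⟩ := toH_surjective (τ := τ) t
  rw [eqCocyc_proj, cocyc_eq w t (proj_mem_chartSet.1 hx), toH_smul_proj]

variable (τ η) in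
/-- The equivariant line bundle of the character `w` of `T`. -/
def eqLineB (w : Fin n → ℤ) : eqLineBundles d (ToricSpace τ η) :=
  ⟨((lineB τ η (τ.b *ᵥ w)).1, eqCocyc w), (lineB τ η (τ.b *ᵥ w)).2, fun s t x => by
    obtain ⟨z, rfl⟩ := proj_surjective x
    obtain ⟨t, rfl⟩ := toH_surjective (τ := τ) t
    obtain ⟨s, rfl⟩ := toH_surjective (τ := τ) s
    change eqCocyc _ _ _ = eqCocyc _ _ _ * eqCocyc _ _ _
    rw [← map_mul, toH_smul_proj, eqCocyc_proj, eqCocyc_proj, eqCocyc_proj, cocyc_mul],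
  fun t₀ x₀ => by
    have hJ : x₀ ∈ chartSet η (chIdx (t₀ • x₀)) := smul_mem_chartSet_iff.1 (mem_chIdx _)
    refine ⟨fun t _ => (bigChar (fibreW η (chIdx (t₀ • x₀)) w) t : ℂ),
      Algebra.subset_adjoin (Or.inl ⟨_, rfl⟩), fun _ x =>
        (((frame (chIdx (t₀ • x₀)) (τ.b *ᵥ w) / frame (chIdx x₀) (τ.b *ᵥ w) :
          ToricSpace τ η → ℂˣ) x : ℂˣ) : ℂ),
      Algebra.subset_adjoin (Or.inr ⟨_, unitRegularAt_frame hJ (mem_chIdx _) _, rfl⟩),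
      Units.ne_zero _, ?_⟩
    filter_upwards [(isOpen_chartSet _).mem_nhds hJ] with x hx t _
    rw [← Units.val_div_eq_div_val]
    congr 1
    change eqCocyc w t x * frame (chIdx x₀) (τ.b *ᵥ w) x /
      frame (chIdx (t₀ • x₀)) (τ.b *ᵥ w) (t • x) = _
    rw [eqCocyc_eq w t hx, Pi.div_apply]
    ext
    push_cast
    field_simp⟩

theorem trivU_add (θ θ₂ : Fin r → ℤ) (z : Level τ η) :
    trivU (θ + θ₂) z = trivU θ z * trivU θ₂ z := by
  simp only [trivU, mono_add, mul_inv]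

theorem lineB_add (θ θ₂ : Fin r → ℤ) : lineB τ η (θ + θ₂) = lineB τ η θ * lineB τ η θ₂ :=
  Subtype.ext (funext fun _ => funext fun _ => frame_add _ _ _ _)

theorem eqLineB_add (w w₂ : Fin n → ℤ) : eqLineB τ η (w + w₂) = eqLineB τ η w * eqLineB τ η w₂ := by
  refine Subtype.ext (Prod.ext ?_ ?_)
  · change (lineB τ η (τ.b *ᵥ (w + w₂))).1 = _
    rw [Matrix.mulVec_add, lineB_add]; rfl
  · refine funext fun t => funext fun x => ?_
    change cocyc _ _ _ = cocyc _ _ _ * cocyc _ _ _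
    simp only [cocyc, Matrix.mulVec_add, trivU_add, torusChar_add, div_eq_mul_inv, mul_inv]
    simp only [mul_comm, mul_left_comm, mul_assoc]

variable (τ η) in
/-- The homomorphism `w ↦ ℒ(w)` to the equivariant Picard group. -/
def bundleHom : (Fin n → ℤ) →+ EqPic d (ToricSpace τ η) :=
  AddMonoidHom.mk' (fun w => eqPicMk d (eqLineB τ η w)) fun w w₂ => by rw [eqLineB_add]; rfl

variable (τ η) in
/-- The homomorphism from the characters of `S` to the Picard group. -/
def picHom : (Fin r → ℤ) →+ Pic (ToricSpace τ η) :=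
  AddMonoidHom.mk' (fun θ => picMk (lineB τ η θ)) fun θ θ₂ => by rw [lineB_add]; rfl

theorem forget_bundleHom (w : Fin n → ℤ) :
    forget d (bundleHom τ η w) = picHom τ η (τ.b *ᵥ w) := rfl

theorem isAssociated_bundleHom (w : Fin n → ℤ) : IsAssociated w (bundleHom τ η w) := by
  refine ⟨eqLineB τ η w, rfl, trivU (τ.b *ᵥ w), fun z₀ => ?_, fun t z => ?_⟩
  · refine (levelRegularAt_mono (inChart_chIdx z₀) (-(τ.b *ᵥ w))).congr
      (isOpen_chartSet (chIdx (proj z₀))) (mem_chIdx _) fun v hv => ?_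
    change _ = ((trivU (τ.b *ᵥ w) v / frame (chIdx (proj z₀)) (τ.b *ᵥ w) (proj v) : ℂˣ) : ℂ)
    rw [frame_proj (proj_mem_chartSet.1 hv), mono_neg, div_mul_cancel_right]
  · change _ = eqCocyc w (toH τ t) (proj z) * _
    rw [eqCocyc_proj, cocyc, div_mul_cancel]

/-! ### The weights in the fibres -/

/-- At a fixed point an isomorphism of equivariant bundles does not change the character on the fibre. -/
theorem hasFibreWeight_unique {e : ℕ} {X : Type} [SpaceWithFunctions X] [TorusSpace e X]
    {l : EqPic e X} {p : X} (hp : ∀ t : BigTorus e, t • p = p) {v w : (Fin e → ℤ) × ℤ}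
    (hv : HasFibreWeight e l p v) (hw : HasFibreWeight e l p w) : v = w := by
  obtain ⟨E, rfl, hE⟩ := hv
  obtain ⟨F, hF, hF₂⟩ := hw
  have hFE : (QuotientGroup.mk F : eqLineBundles e X ⧸ eqTrivialBundles e X) =
    QuotientGroup.mk E := hF
  obtain ⟨φ, -, hφ⟩ := QuotientGroup.eq.1 hFE
  refine bigChar_injective fun t => ?_
  have h1 := hφ t p
  rw [hp, div_self'] at h1
  have h2 : (F.1.2 t p)⁻¹ * E.1.2 t p = 1 := h1
  rw [← hE, ← hF₂]
  exact (inv_mul_eq_one.1 h2).symm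

theorem hasFibreWeight_bundleHom (I : τ.Bases) (w : Fin n → ℤ) :
    HasFibreWeight d (bundleHom τ η w) (param I 0) (fibreW η I w) := by
  refine ⟨eqLineB τ η w, rfl, fun t => ?_⟩
  change eqCocyc w t _ = _
  rw [eqCocyc_eq w t (param_mem I 0), smul_param_zero, div_self', mul_one]

theorem fibreWt_bundleHom (I : τ.Bases) (w : Fin n → ℤ) :
    fibreWt d (bundleHom τ η w) (param I 0) = fibreW η I w :=
  hasFibreWeight_unique (smul_param_zero I)
    (Classical.epsilon_spec (p := HasFibreWeight d (bundleHom τ η w) (param I 0))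
      ⟨_, hasFibreWeight_bundleHom I w⟩) (hasFibreWeight_bundleHom I w)

end Bundles

/-! ### Rational curves joining the fixed points -/

/-- A section over the projective line of the line bundle of degree `N`, given by the entire
functions `A` and `B` in the two charts, vanishes if `N < 0`, or if `N = 0` and it has a zero. -/
theorem eq_zero_of_eq_zpow_mul {A B : ℂ → ℂ} (hA : Differentiable ℂ A) (hB : ContinuousAt B 0)
    {N : ℤ} (h : ∀ t : ℂˣ, A t = ((t ^ N : ℂˣ) : ℂ) * B ((t⁻¹ : ℂˣ) : ℂ))
    (hN : N < 0 ∨ N = 0 ∧ B 0 = 0) (t : ℂ) : A t = 0 := by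
  refine hA.apply_eq_of_tendsto_cocompact t ?_
  rw [← Metric.cobounded_eq_cocompact]
  have hinv : Tendsto (fun t : ℂ => t⁻¹) (Bornology.cobounded ℂ) (𝓝 0) := tendsto_inv₀_cobounded
  have hB2 : Tendsto (fun t : ℂ => B t⁻¹) (Bornology.cobounded ℂ) (𝓝 (B 0)) :=
    hB.tendsto.comp hinv
  have hne : ∀ᶠ t : ℂ in Bornology.cobounded ℂ, t ≠ 0 := by
    have h1 : ({0} : Set ℂ)ᶜ ∈ Bornology.cobounded ℂ := Bornology.isBounded_singleton
    filter_upwards [h1] with t ht using ht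
  rcases hN with hN | ⟨rfl, h0⟩
  · obtain ⟨k, rfl⟩ : ∃ k : ℕ, N = -((k + 1 : ℕ) : ℤ) := ⟨(-N - 1).toNat, by omega⟩
    have h2 := (hinv.pow (k + 1)).mul hB2
    rw [zero_pow (by omega), zero_mul] at h2
    refine h2.congr' ?_
    filter_upwards [hne] with t ht
    have := h (Units.mk0 t ht)
    rw [Units.val_mk0] at this
    rw [this, zpow_neg, zpow_natCast, ← inv_pow]
    simp
  · rw [h0] at hB2
    refine hB2.congr' ?_
    filter_upwards [hne] with t ht
    have := h (Units.mk0 t ht)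
    rw [Units.val_mk0] at this
    rw [this]
    simp

section Edge

variable {n r d : ℕ} {τ : TorusSequence n r d} {η : Fin r → ℤ}

variable (η) in
theorem exists_idx_incl {I : τ.Bases} (J : τ.Bases) {i : Fin n} (hi : i ∈ I.1) :
    ∃ κ : Idx I, κ.incl = sel η J i := by
  unfold sel
  split_ifs
  · exact ⟨Sum.inl ⟨i, hi⟩, rfl⟩
  · exact ⟨Sum.inr ⟨i, hi⟩, rfl⟩

theorem Idx.incl_injective {I : τ.Bases} : Function.Injective (Idx.incl (I := I)) :=
  Function.Injective.sumMap Subtype.val_injective Subtype.val_injective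

theorem eval_quadric_single {I : τ.Bases} (k : Fin n) (κ : Idx I) (t : ℂ) :
    (quadric I k).eval (Pi.single κ t) = 0 := by
  classical
  rw [eval_quadric]
  refine Finset.sum_eq_zero fun i _ => ?_
  rcases κ with κ | κ <;> simp [Pi.single_apply]

/-- On a coordinate axis of the chart, the coordinates dual to the invertible ones vanish. -/
theorem slicePt_single_of_ne {I : τ.Bases} (κ : Idx I) (t : ℂ) {k : Fin n} (hk : k ∉ I.1)
    {m : Fin n ⊕ Fin n} (hm : m = Sum.inl k ∨ m = Sum.inr k) (hne : m ≠ sel η I k) :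
    slicePt η I (Pi.single κ t) m = 0 := by
  by_cases hp : 0 < η ⬝ᵥ bet I k
  · simp only [sel, hp, if_true] at hne
    rcases hm with rfl | rfl
    · exact absurd rfl hne
    · simp [slicePt, slicePoly, hk, hp, eval_quadric_single]
  · simp only [sel, hp, if_false] at hne
    rcases hm with rfl | rfl
    · simp [slicePt, slicePoly, hk, hp, eval_quadric_single]
    · exact absurd rfl hne

theorem TorusSequence.Exch.slack_eq_neg {I J : τ.Bases} {i j : Fin n} (h : Exch I J i j) (θ : Fin r → ℤ) :
    slack J θ i = -(rho I i j * slack I θ j) := by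
  rw [h.slack_eq, Pi.sub_apply, Pi.smul_apply, slack_mem h.mem, rho_apply_mem h.mem]
  simp

theorem TorusSequence.Exch.sg_eq [hN : Nondeg τ η] {I J : τ.Bases} {i j : Fin n} (h : Exch I J i j) :
    sg η J i = -(rho I i j * sg η I j) := by
  have h1 := h.slack_eq_neg η
  rw [slack_notMem h.notMem_right, slack_notMem h.notMem] at h1
  have h2 := generic_bet_ne_zero hN.uni hN.gen h.notMem
  unfold sg
  rcases rho_eq hN.uni h.mem j with h0 | h0 | h0
  · exact absurd h0 h.rho_ne_zero
  · rw [h0] at h1 ⊢; split_ifs <;> omega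
  · rw [h0] at h1 ⊢; split_ifs <;> omega

theorem TorusSequence.IsEdge.sel_eq {I J : τ.Bases} {i j : Fin n} (h : IsEdge η I J i j) {k : Fin n}
    (hkI : k ∉ I.1) (hkj : k ≠ j) : sel η J k = sel η I k := by
  have hki : k ∉ J.1 := by
    rw [h.1.mem_right_iff (by rintro rfl; exact hkI h.1.mem) hkj]; exact hkI
  have := h.2 k hkI hkj
  rw [slack_notMem hkI, slack_notMem hki] at this
  unfold sel
  rcases pos_and_pos_or_neg_and_neg_of_mul_pos this with h | h
  · rw [if_pos h.1, if_pos h.2]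
  · rw [if_neg (by omega), if_neg (by omega)]

theorem TorusSequence.Exch.unique {I J : τ.Bases} {i j i₂ j₂ : Fin n} (h : Exch I J i j) (h₂ : Exch I J i₂ j₂) :
    i = i₂ ∧ j = j₂ := by
  constructor
  · by_contra hne
    exact h.notMem_right ((h₂.mem_right_iff hne (by rintro rfl; exact h₂.notMem h.mem)).2 h.mem)
  · by_contra hne
    exact h.notMem ((h₂.mem_right_iff (by rintro rfl; exact h.notMem h₂.mem) hne).1 h.mem_right)

theorem TorusSequence.IsEdge.symm {I J : τ.Bases} {i j : Fin n} (h : IsEdge η I J i j) : IsEdge η J I j i := by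
  refine ⟨h.1.symm, fun k hk hki => ?_⟩
  have hkj : k ≠ j := by rintro rfl; exact hk h.1.mem_right
  rw [mul_comm]
  exact h.2 k (fun hkI => hk ((h.1.mem_right_iff hki hkj).2 hkI)) hkj

variable [hN : Nondeg τ η]

/-- An edge of the arrangement gives a rational curve that joins the two fixed points.  It is
a coordinate axis in both charts, and the chart of `J` meets the chart of `I` in the complement of
a coordinate hyperplane. -/
theorem TorusSequence.IsEdge.exists_curve {I J : τ.Bases} {i j : Fin n} (h : IsEdge η I J i j) :
    ∃ (κ : Idx I) (l : Idx J),
      (∀ t : ℂˣ, (param I (Pi.single κ (t : ℂ)) : ToricSpace τ η) =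
        param J (Pi.single l ((t⁻¹ : ℂˣ) : ℂ))) ∧
      (∀ (t : ℂˣ) (θ : Fin r → ℤ), frame (η := η) J θ (param I (Pi.single κ (t : ℂ)) : ToricSpace τ η) =
        t ^ (sg η J i * slack J θ i) *
          frame I θ (param I (Pi.single κ (t : ℂ)) : ToricSpace τ η)) ∧
      (∀ x : ToricSpace τ η, x ∈ chartSet η I → (x ∈ chartSet η J ↔ coord I x κ ≠ 0)) ∧
      ((chartWt η I κ).1 = alpha I i ∨ (chartWt η I κ).1 = -alpha I i) := by
  classical
  obtain ⟨κ, hκ⟩ := exists_idx_incl η J h.1.mem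
  obtain ⟨l, hl⟩ := exists_idx_incl η I h.1.mem_right
  have hJI : ∀ k ∉ J.1, k ≠ i → k ∉ I.1 ∧ k ≠ j := by
    intro k hk hki
    have hkj : k ≠ j := by rintro rfl; exact hk h.1.mem_right
    exact ⟨fun hkI => hk ((h.1.mem_right_iff hki hkj).2 hkI), hkj⟩
  have hsel : ∀ (u : Idx I → ℂ), ∀ k ∉ J.1,
      slicePt η I u (sel η J k) = if k = i then u κ else 1 := by
    intro u k hk
    split_ifs with hki
    · rw [hki, ← hκ, slicePt_incl]
    · obtain ⟨h1, h2⟩ := hJI k hk hki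
      rw [h.sel_eq h1 h2, slicePt_sel u h1]
  have hchart : ∀ u : Idx I → ℂ, InChart η J (slicePt η I u) ↔ u κ ≠ 0 := by
    intro u
    constructor
    · intro hu
      have := hu i h.1.notMem_right
      rwa [hsel u i h.1.notMem_right, if_pos rfl] at this
    · intro hu k hk
      rw [hsel u k hk]
      split_ifs
      · exact hu
      · exact one_ne_zero
  have hmono : ∀ (t : ℂˣ) (θ : Fin r → ℤ), mono η J θ (slicePt η I (Pi.single κ (t : ℂ))) =
      t ^ (sg η J i * slack J θ i) := by
    intro t θ
    have hin : InChart η J (slicePt η I (Pi.single κ (t : ℂ))) := (hchart _).2 (by simp)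
    refine (Fintype.prod_eq_single i fun k hk => ?_).trans ?_
    · by_cases hkJ : k ∈ J.1
      · rw [slack_mem hkJ, mul_zero, zpow_zero]
      · have : selU η J (slicePt η I (Pi.single κ (t : ℂ))) k = 1 := by
          ext; rw [selU_val hin hkJ, hsel _ _ hkJ, if_neg hk]; rfl
        rw [this, one_zpow]
    · congr 1
      ext
      rw [selU_val hin h.1.notMem_right, hsel _ _ h.1.notMem_right, if_pos rfl, Pi.single_eq_same]
  refine ⟨κ, l, fun t => ?_, fun t θ => ?_, fun x hx => ?_, ?_⟩
  · have hin : InChart η J (slicePt η I (Pi.single κ (t : ℂ))) := (hchart _).2 (by simp)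
    have hmem : (param I (Pi.single κ (t : ℂ)) : ToricSpace τ η) ∈ chartSet η J := ⟨_, rfl, hin⟩
    rw [← param_coord hmem]
    congr 1
    funext m
    refine (coord_proj (z := slice I (Pi.single κ (t : ℂ))) hin m).trans ?_
    change normPt η J (slicePt η I (Pi.single κ (t : ℂ))) m.incl = _
    have hb : slack J (τ.bVec j) i = -rho I i j := by
      rw [slack_bVec_eq, Pi.sub_apply, Pi.single_eq_of_ne h.1.ne, h.1.rho_symm]; ring
    have hsg := h.1.sg_eq (η := η)
    by_cases hm : m = l
    · subst hm
      have h1 := slicePt_sel (η := η) (Pi.single κ (t : ℂ)) h.1.notMem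
      rw [Pi.single_eq_same, hl]
      by_cases hp : 0 < η ⬝ᵥ bet I j
      · have h2 : sg η J i * slack J (τ.bVec j) i = 1 := by
          rw [hsg, hb, sg, if_pos hp]; linear_combination h.1.rho_sq
        simp only [sel, if_pos hp] at h1 ⊢
        rw [normPt_inl, h1, hmono, h2, zpow_one, mul_one]
      · have h2 : sg η J i * slack J (τ.bVec j) i = -1 := by
          rw [hsg, hb, sg, if_neg hp]; linear_combination -h.1.rho_sq
        simp only [sel, if_neg hp] at h1 ⊢
        rw [normPt_inr, h1, hmono, h2, zpow_neg_one, mul_one]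
    · rw [Pi.single_eq_of_ne hm]
      have hz : slicePt η I (Pi.single κ (t : ℂ)) m.incl = 0 := by
        have hml : m.incl ≠ sel η I j := fun h' => hm (Idx.incl_injective (h'.trans hl.symm))
        have key : ∀ k ∈ J.1, ∀ q : Fin n ⊕ Fin n, (q = Sum.inl k ∨ q = Sum.inr k) →
            q ≠ sel η I j → slicePt η I (Pi.single κ (t : ℂ)) q = 0 := by
          intro k hk q hq hne
          by_cases hkj : k = j
          · subst hkj
            exact slicePt_single_of_ne κ t h.1.notMem hq hne
          · have hki : k ≠ i := by rintro rfl; exact h.1.notMem_right hk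
            have hkI : k ∈ I.1 := (h.1.mem_right_iff hki hkj).1 hk
            obtain ⟨q', hq'⟩ : ∃ q' : Idx I, q'.incl = q := by
              rcases hq with rfl | rfl
              · exact ⟨Sum.inl ⟨k, hkI⟩, rfl⟩
              · exact ⟨Sum.inr ⟨k, hkI⟩, rfl⟩
            rw [← hq', slicePt_incl, Pi.single_eq_of_ne]
            rintro rfl
            rw [hκ] at hq'
            unfold sel at hq'
            rcases hq with rfl | rfl <;> split_ifs at hq' <;>
              simp only [Sum.inl.injEq, Sum.inr.injEq] at hq' <;>
              exact hki hq'.symm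
        rcases m with m | m
        · exact key m m.2 _ (Or.inl rfl) hml
        · exact key m m.2 _ (Or.inr rfl) hml
      rw [normPt, ptAct, hz, mul_zero]
  · have hin : InChart η J (slicePt η I (Pi.single κ (t : ℂ))) := (hchart _).2 (by simp)
    have h1 : frame J θ (param I (Pi.single κ (t : ℂ)) : ToricSpace τ η) = _ :=
      frame_proj (z := slice I (Pi.single κ (t : ℂ))) hin θ
    have h2 : frame I θ (param I (Pi.single κ (t : ℂ)) : ToricSpace τ η) = _ :=
      frame_proj (z := slice I (Pi.single κ (t : ℂ))) (inChart_slicePt I _) θ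
    rw [h1, h2]
    change mono η J θ (slicePt η I _) * _ = _ * (mono η I θ (slicePt η I _) * _)
    rw [hmono, mono_slicePt, one_mul]
  · rw [← hchart (coord I x)]
    conv_lhs => rw [← param_coord hx]
    exact proj_mem_chartSet
  · rcases κ with κ | κ
    · left
      have : (Sum.inl κ.1 : Fin n ⊕ Fin n) = sel η J i := hκ
      unfold sel at this
      split_ifs at this
      exact congrArg (alpha I) (Sum.inl.inj this)
    · right
      have : (Sum.inr κ.1 : Fin n ⊕ Fin n) = sel η J i := hκ
      unfold sel at this
      split_ifs at this
      exact congrArg (fun k => -alpha I k) (Sum.inr.inj this)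

/-- A property of the signs or zeros of `θ` on the circuit vectors can be checked on edges: a pair of
bases that differ by an exchange is joined by a chain of edges on a line, and the values for the
pair are the sums of the values for the edges, with those of `η` of the same sign. -/
theorem slack_of_edges {p : ℤ → ℤ → Prop} (θ : Fin r → ℤ)
    (hp : ∀ x y, p x y → p (-x) (-y))
    (hadd : ∀ x y x₂ y₂, p x y → p x₂ y₂ → 0 < y * y₂ → p (x + x₂) (y + y₂))
    (edge : ∀ (I J : τ.Bases) i j, IsEdge η I J i j → p (slack I θ j) (slack I η j))
    (I : τ.Bases) {j : Fin n} (hj : j ∉ I.1) : p (slack I θ j) (slack I η j) := by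
  have hsign : ∀ ε x y : ℤ, (ε = 1 ∨ ε = -1) → p x y → p (ε * x) (ε * y) := by
    rintro ε x y (rfl | rfl) h
    · simpa using h
    · simpa using hp x y h
  have main := line_induction hN.uni hN.gen
    (fun I J => ∀ i j, Exch I J i j → p (slack I θ j) (slack I η j))
    (fun I J i j h i₂ j₂ h₂ => by
      obtain ⟨rfl, rfl⟩ := h.1.unique h₂
      exact edge I J i j h)
    (fun I K J i k j hIK hIJ hKJ hpos h1 h2 i₂ j₂ h₂ => by
      obtain ⟨rfl, rfl⟩ := hIJ.unique h₂
      have e1 : ∀ ζ : Fin r → ℤ,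
          slack K ζ j = slack I ζ j - rho I i k * slack I ζ k * rho I i j := fun ζ => by
        rw [hIK.slack_eq]; rfl
      have hk : rho I i k = 1 ∨ rho I i k = -1 :=
        (rho_eq hN.uni hIK.mem k).resolve_left hIK.rho_ne_zero
      have hj : rho I i j = 1 ∨ rho I i j = -1 :=
        (rho_eq hN.uni hIJ.mem j).resolve_left hIJ.rho_ne_zero
      have p1 := hsign _ _ _ hk (h1 _ _ hIK)
      have p2 := hsign _ _ _ hj (h2 _ _ hKJ)
      have e2 : ∀ ζ : Fin r → ℤ, rho I i j * slack K ζ j =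
          rho I i j * slack I ζ j - rho I i k * slack I ζ k := fun ζ => by
        rw [e1]; linear_combination (-rho I i k * slack I ζ k) * hIJ.rho_sq
      rw [e2, e2] at p2
      have p3 := hsign _ _ _ hj (hadd _ _ _ _ p1 p2 hpos)
      have e3 : ∀ x y : ℤ, rho I i j * (x + (rho I i j * y - x)) = y := fun x y => by
        linear_combination y * hIJ.rho_sq
      rwa [e3, e3] at p3)
  obtain ⟨i, hi, hρ⟩ := exists_rho_ne_zero I (hN.ne_zero j)
  obtain ⟨J, hJ⟩ := exists_exch hN.uni hi hj hρ
  exact main I J i j hJ i j hJ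

/-- A section of a power of the line bundle of `θ`, restricted to the curve of an edge and expressed
in the frames of the two charts, is a pair of entire functions `A` and `B`, which differ by a power
of the coordinate. -/
theorem TorusSequence.IsEdge.exists_section {I J : τ.Bases} {i j : Fin n} (h : IsEdge η I J i j)
    (θ : Fin r → ℤ) (m : ℤ) (g : ToricSpace τ η → ℂ)
    (hg : ∀ K : τ.Bases, ∀ x ∈ chartSet η K, RegularAt (fun y => g y / ((frame K θ y ^ m : ℂˣ) : ℂ)) x) :
    ∃ A B : ℂ → ℂ, Differentiable ℂ A ∧ Differentiable ℂ B ∧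
      (∀ t : ℂˣ, A t = ((t ^ (m * (sg η J i * slack J θ i)) : ℂˣ) : ℂ) * B ((t⁻¹ : ℂˣ) : ℂ)) ∧
      (A 0 = 0 ↔ g (param I 0) = 0) ∧ (B 0 = 0 ↔ g (param J 0) = 0) ∧
      ((∀ x, g x ≠ 0) → ∀ t, A t ≠ 0 ∧ B t ≠ 0) := by
  obtain ⟨κ, l, h1, h2, -⟩ := h.exists_curve
  refine ⟨fun t => g (param I (Pi.single κ t)) / ((frame I θ (param I (Pi.single κ t) : ToricSpace τ η) ^ m : ℂˣ) : ℂ),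
    fun t => g (param J (Pi.single l t)) / ((frame J θ (param J (Pi.single l t) : ToricSpace τ η) ^ m : ℂˣ) : ℂ),
    fun t => ?_, fun t => ?_, fun t => ?_, ?_, ?_, fun hne t => ⟨?_, ?_⟩⟩
  · exact differentiableAt_param (w := fun s => Pi.single κ s) (differentiable_single κ)
      (hg I _ (param_mem I _))
  · exact differentiableAt_param (w := fun s => Pi.single l s) (differentiable_single l)
      (hg J _ (param_mem J _))
  · change _ = _ * (g (param J (Pi.single l _)) / _)
    rw [← h1 t, h2 t, mul_zpow, ← zpow_mul, mul_comm m]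
    push_cast
    field_simp
  · rw [div_eq_zero_iff, or_iff_left (Units.ne_zero _), Pi.single_zero]
  · rw [div_eq_zero_iff, or_iff_left (Units.ne_zero _), Pi.single_zero]
  · exact div_ne_zero (hne _) (Units.ne_zero _)
  · exact div_ne_zero (hne _) (Units.ne_zero _)

/-- A character of `S` whose line bundle is trivial is zero: its degree on every curve vanishes. -/
theorem picHom_injective : Function.Injective (picHom τ η) := by
  rw [injective_iff_map_eq_zero]
  intro θ hθ
  have h0 : (QuotientGroup.mk (lineB τ η θ) : lineBundles (ToricSpace τ η) ⧸ trivialBundles _) =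
    QuotientGroup.mk 1 := hθ
  obtain ⟨φ, hφ⟩ : lineB τ η θ ∈ trivialBundles (ToricSpace τ η) := by
    have := QuotientGroup.eq.1 h0.symm
    simpa using this
  have hreg : ∀ K : τ.Bases, ∀ x ∈ chartSet η K, UnitRegularAt (φ / frame K θ) x := by
    intro K x hx
    have h1 := (hφ x).mul (unitRegularAt_frame (mem_chIdx x) hx θ)
    change UnitRegularAt (φ / frame (chIdx x) θ * (frame (chIdx x) θ / frame K θ)) x at h1
    rwa [div_mul_div_cancel] at h1
  have hN1 : ∀ m : ℤ, ∀ K : τ.Bases, ∀ x ∈ chartSet η K,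
      (m = 1 ∨ m = -1) → RegularAt (fun y => ((φ y ^ m : ℂˣ) : ℂ) / ((frame K θ y ^ m : ℂˣ) : ℂ)) x := by
    rintro m K x hx (rfl | rfl)
    · simpa [UnitRegularAt] using hreg K x hx
    · have := (hreg K x hx).inv
      refine regularAt_congr _ _ _ this (Eventually.of_forall fun y => ?_)
      simp [div_eq_mul_inv, mul_comm]
  have hz : ∀ I : τ.Bases, slack I θ = 0 := by
    intro I
    funext j
    by_cases hj : j ∈ I.1
    · exact slack_mem hj
    · refine slack_of_edges (η := η) (p := fun x _ => x = 0) θ (fun x _ h => by simp [h])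
        (fun x _ y _ h h₂ _ => by simp [h, h₂]) (fun I J i j hE => ?_) I hj
      -- the degree can be neither negative nor positive
      have key : ∀ m : ℤ, (m = 1 ∨ m = -1) → ¬ m * (sg η I j * slack I θ j) < 0 := by
        intro m hm hneg
        obtain ⟨A, B, hA, hB, h1, -, -, h2⟩ := hE.symm.exists_section θ m
          (fun y => ((φ y ^ m : ℂˣ) : ℂ)) (fun K x hx => hN1 m K x hx hm)
        exact (h2 (fun x => Units.ne_zero _) 0).1
          (eq_zero_of_eq_zpow_mul hA hB.continuous.continuousAt h1 (Or.inl hneg) 0)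
      have h1 := key 1 (Or.inl rfl)
      have h2 := key (-1) (Or.inr rfl)
      have h3 : sg η I j * slack I θ j = 0 := by omega
      have h4 := sg_mul_sg (η := η) I j
      calc slack I θ j = sg η I j * (sg η I j * slack I θ j) := by rw [← mul_assoc, h4, one_mul]
        _ = 0 := by rw [h3, mul_zero]
  obtain ⟨x⟩ : Nonempty τ.Bases := by
    obtain ⟨I, -⟩ := exists_bases_superset hN.uni (S := ∅) (linearIndependent_empty_type)
    exact ⟨I⟩
  rw [← b_mulVec_slack x θ, hz x, Matrix.mulVec_zero]

end Edge

/-! ### Rational functions and line bundles on an affine space -/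

section Affine

open MvPolynomial

variable {σ : Type*}

theorem exists_eval_ne_zero {Q : MvPolynomial σ ℂ} (hQ : Q ≠ 0) : ∃ v, eval v Q ≠ 0 := by
  by_contra! h
  exact hQ (MvPolynomial.funext fun v => by rw [h v, map_zero])

theorem eq_of_eval_eq {P₁ P₂ Q : MvPolynomial σ ℂ} (hQ : Q ≠ 0)
    (h : ∀ v, eval v Q ≠ 0 → eval v P₁ = eval v P₂) : P₁ = P₂ := by
  have h1 : Q * (P₁ - P₂) = 0 := MvPolynomial.funext fun v => by
    rw [map_mul, map_sub, map_zero]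
    by_cases hv : eval v Q = 0
    · rw [hv, zero_mul]
    · rw [h v hv, sub_self, mul_zero]
  exact sub_eq_zero.1 ((mul_eq_zero.1 h1).resolve_left hQ)

theorem ne_zero_of_eval_ne_zero {Q : MvPolynomial σ ℂ} {v : σ → ℂ} (h : eval v Q ≠ 0) : Q ≠ 0 := by
  rintro rfl; exact h (map_zero _)

theorem eval_eq_zero_of_dvd {P Q : MvPolynomial σ ℂ} (h : P ∣ Q) {v : σ → ℂ} (hP : eval v P = 0) :
    eval v Q = 0 := by
  obtain ⟨R, rfl⟩ := h
  rw [map_mul, hP, zero_mul]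

/-- The function `g` is a quotient of polynomials near `v`. -/
def PolyReg (g : (σ → ℂ) → ℂ) (v : σ → ℂ) : Prop :=
  ∃ P Q : MvPolynomial σ ℂ, eval v Q ≠ 0 ∧ ∀ w, eval w Q ≠ 0 → g w = eval w P / eval w Q

theorem PolyReg.mul {f g : (σ → ℂ) → ℂ} {v : σ → ℂ} (hf : PolyReg f v) (hg : PolyReg g v) :
    PolyReg (fun w => f w * g w) v := by
  obtain ⟨P, Q, h0, h⟩ := hf
  obtain ⟨P₂, Q₂, h0₂, h₂⟩ := hg
  refine ⟨P * P₂, Q * Q₂, by simp [h0, h0₂], fun w hw => ?_⟩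
  rw [map_mul] at hw
  simp only [h w (left_ne_zero_of_mul hw), h₂ w (right_ne_zero_of_mul hw), map_mul,
    div_mul_div_comm]

theorem PolyReg.congr {f g : (σ → ℂ) → ℂ} {v : σ → ℂ} (hf : PolyReg f v) {R : MvPolynomial σ ℂ}
    (hR : eval v R ≠ 0) (h : ∀ w, eval w R ≠ 0 → f w = g w) : PolyReg g v := by
  obtain ⟨P, Q, h0, hPQ⟩ := hf
  refine ⟨P * R, Q * R, by simp [h0, hR], fun w hw => ?_⟩
  rw [map_mul] at hw
  have h3 := right_ne_zero_of_mul hw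
  rw [map_mul, map_mul, mul_div_mul_right _ _ h3, ← hPQ w (left_ne_zero_of_mul hw), h w h3]

theorem PolyReg.inv {f : (σ → ℂ) → ℂ} {v : σ → ℂ} (hf : PolyReg f v) (h : f v ≠ 0) :
    PolyReg (fun w => (f w)⁻¹) v := by
  obtain ⟨P, Q, h0, hPQ⟩ := hf
  have hP : eval v P ≠ 0 := by
    intro hP; exact h (by rw [hPQ v h0, hP, zero_div])
  refine ⟨Q * Q, P * Q, by simp [h0, hP], fun w hw => ?_⟩
  rw [map_mul] at hw
  have h1 := left_ne_zero_of_mul hw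
  have h2 := right_ne_zero_of_mul hw
  simp only [hPQ w h2, map_mul]
  field_simp

theorem polyReg_div (P : MvPolynomial σ ℂ) {Q : MvPolynomial σ ℂ} {v : σ → ℂ} (h : eval v Q ≠ 0) :
    PolyReg (fun w => eval w P / eval w Q) v := ⟨P, Q, h, fun _ _ => rfl⟩

/-- A function that is regular and without zeros on a set is there a quotient of two polynomials
without zeros. -/
theorem exists_global_fraction {W : Set (σ → ℂ)} {g : (σ → ℂ) → ℂ} (hg : ∀ v ∈ W, PolyReg g v)
    (hg0 : ∀ v ∈ W, g v ≠ 0) : ∃ A B : MvPolynomial σ ℂ, A ≠ 0 ∧ B ≠ 0 ∧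
      ∀ v ∈ W, eval v A ≠ 0 ∧ eval v B ≠ 0 ∧ g v = eval v A / eval v B := by
  rcases W.eq_empty_or_nonempty with rfl | ⟨v₀, hv₀⟩
  · exact ⟨1, 1, one_ne_zero, one_ne_zero, fun v hv => absurd hv (Set.notMem_empty v)⟩
  obtain ⟨P₀, Q₀, h0, h⟩ := hg v₀ hv₀
  have hQ₀ := ne_zero_of_eval_ne_zero h0
  obtain ⟨A, B, c, hAB, hA, hB⟩ := UniqueFactorizationMonoid.exists_reduced_factors' P₀ Q₀ hQ₀
  have hB0 : B ≠ 0 := by rintro rfl; exact hQ₀ (by rw [← hB, mul_zero])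
  have hc0 : c ≠ 0 := by rintro rfl; exact hQ₀ (by rw [← hB, zero_mul])
  have key : ∀ v ∈ W, eval v A ≠ 0 ∧ eval v B ≠ 0 ∧ g v = eval v A / eval v B := by
    intro v hv
    obtain ⟨P, Q, h1, h2⟩ := hg v hv
    have hQ := ne_zero_of_eval_ne_zero h1
    have h3 : P₀ * Q = P * Q₀ := eq_of_eval_eq (mul_ne_zero hQ₀ hQ) fun w hw => by
      rw [map_mul] at hw
      have hl := left_ne_zero_of_mul hw
      have hr := right_ne_zero_of_mul hw
      have h4 := (h w hl).symm.trans (h2 w hr)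
      rw [div_eq_div_iff hl hr] at h4
      rw [map_mul, map_mul, h4]
    have h5 : A * Q = P * B := mul_left_cancel₀ hc0 (by
      rw [← mul_assoc, hA, h3, ← hB]; ring)
    have h6 : B ∣ Q := hAB.symm.dvd_of_dvd_mul_left (h5 ▸ Dvd.intro_left P rfl)
    have h7 : eval v B ≠ 0 := fun h0 => h1 (eval_eq_zero_of_dvd h6 h0)
    have h8 : g v = eval v A / eval v B := by
      rw [h2 v h1, div_eq_div_iff h1 h7, ← map_mul, ← map_mul, h5]
    exact ⟨fun h0 => hg0 v hv (by rw [h8, h0, zero_div]), h7, h8⟩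
  exact ⟨A, B, ne_zero_of_eval_ne_zero (key v₀ hv₀).1, hB0, key⟩

theorem exists_prime_dvd_eval_eq_zero {A : MvPolynomial σ ℂ} (hA : A ≠ 0) {v : σ → ℂ}
    (h : eval v A = 0) : ∃ p, Prime p ∧ p ∣ A ∧ eval v p = 0 := by
  induction A using UniqueFactorizationMonoid.induction_on_prime with
  | h₁ => exact absurd rfl hA
  | h₂ a ha => exact absurd h (ha.map (eval v)).ne_zero
  | h₃ a p ha hp ih =>
    rw [map_mul] at h
    rcases mul_eq_zero.1 h with h | h
    · exact ⟨p, hp, dvd_mul_right _ _, h⟩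
    · obtain ⟨q, h1, h2, h3⟩ := ih ha h
      exact ⟨q, h1, h2.mul_left _, h3⟩

/-- Splitting off the prime factors that vanish at a point. -/
theorem exists_split {A : MvPolynomial σ ℂ} (hA : A ≠ 0) (u : σ → ℂ) :
    ∃ A₁ A₂, A = A₁ * A₂ ∧ eval u A₂ ≠ 0 ∧ ∀ p, Prime p → p ∣ A₁ → eval u p = 0 := by
  induction A using UniqueFactorizationMonoid.induction_on_prime with
  | h₁ => exact absurd rfl hA
  | h₂ a ha =>
    exact ⟨1, a, (one_mul a).symm, (ha.map (eval u)).ne_zero,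
      fun p hp h => absurd (isUnit_of_dvd_one h) hp.not_isUnit⟩
  | h₃ a p ha hp ih =>
    obtain ⟨A₁, A₂, rfl, h2, h3⟩ := ih ha
    by_cases h : eval u p = 0
    · refine ⟨p * A₁, A₂, by ring, h2, fun q hq hqd => ?_⟩
      rcases hq.dvd_or_dvd hqd with h4 | h4
      · exact eval_eq_zero_of_dvd ((hq.associated_of_dvd hp h4).symm.dvd) h
      · exact h3 q hq h4
    · exact ⟨A₁, p * A₂, by ring, by rw [map_mul]; exact mul_ne_zero h h2, h3⟩

variable [Finite σ]

/-- The zero set of a prime polynomial determines it, by Hilbert's Nullstellensatz. -/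
theorem exists_eval_eq_zero_of_not_dvd {p g : MvPolynomial σ ℂ} (hp : Prime p) (h : ¬ p ∣ g) :
    ∃ z, eval z p = 0 ∧ eval z g ≠ 0 := by
  by_contra! hz
  have hprime : (Ideal.span {p}).IsPrime := (Ideal.span_singleton_prime hp.ne_zero).2 hp
  have h1 : g ∈ vanishingIdeal ℂ (zeroLocus ℂ (Ideal.span {p})) := by
    rw [mem_vanishingIdeal_iff]
    intro z hz'
    rw [mem_zeroLocus_iff] at hz'
    have := hz' p (Ideal.mem_span_singleton_self p)
    rw [aeval_eq_eval] at this ⊢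
    exact hz z this
  rw [vanishingIdeal_zeroLocus_eq_radical, hprime.radical, Ideal.mem_span_singleton] at h1
  exact h h1

/-- A polynomial without zeros off a coordinate hyperplane is a monomial. -/
theorem eq_C_mul_X_pow {A : MvPolynomial σ ℂ} (hA : A ≠ 0) {κ : σ}
    (h : ∀ v : σ → ℂ, v κ ≠ 0 → eval v A ≠ 0) : ∃ (c : ℂ) (k : ℕ), c ≠ 0 ∧ A = C c * X κ ^ k := by
  have hunit : ∀ a : MvPolynomial σ ℂ, IsUnit a → ∃ c : ℂ, c ≠ 0 ∧ a = C c := by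
    intro a ha
    obtain ⟨c, hc, h⟩ := MvPolynomial.isUnit_iff_eq_C_of_isReduced.1 ha
    exact ⟨c, hc.ne_zero, h⟩
  induction A using UniqueFactorizationMonoid.induction_on_prime with
  | h₁ => exact absurd rfl hA
  | h₂ a ha =>
    obtain ⟨c, hc, rfl⟩ := hunit a ha
    exact ⟨c, 0, hc, by simp⟩
  | h₃ a p ha hp ih =>
    obtain ⟨c, k, hc, rfl⟩ := ih ha fun v hv => by
      have := h v hv
      rw [map_mul] at this
      exact right_ne_zero_of_mul this
    have h1 : p ∣ X κ := by
      by_contra hd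
      obtain ⟨z, hz, hz2⟩ := exists_eval_eq_zero_of_not_dvd hp hd
      rw [eval_X] at hz2
      have := h z hz2
      rw [map_mul, hz, zero_mul] at this
      exact this rfl
    obtain ⟨e, he⟩ := h1
    have hX : Irreducible (X κ : MvPolynomial σ ℂ) := MvPolynomial.X_prime.irreducible
    have heu : IsUnit e := (hX.isUnit_or_isUnit he).resolve_left hp.not_isUnit
    obtain ⟨e', he', rfl⟩ := hunit e heu
    refine ⟨c * e'⁻¹, k + 1, mul_ne_zero hc (inv_ne_zero he'), ?_⟩
    have h2 : p = C e'⁻¹ * X κ := by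
      rw [he, mul_comm p, ← mul_assoc, ← C_mul, inv_mul_cancel₀ he', C_1, one_mul]
    rw [h2, C_mul, pow_succ]
    ring

/-- A regular function without zeros off a coordinate hyperplane is a Laurent monomial. -/
theorem exists_laurent_monomial {κ : σ} {g : (σ → ℂ) → ℂ} (hg : ∀ v, v κ ≠ 0 → PolyReg g v)
    (hg0 : ∀ v, v κ ≠ 0 → g v ≠ 0) :
    ∃ (c : ℂ) (m : ℤ), c ≠ 0 ∧ ∀ v, v κ ≠ 0 → g v = c * v κ ^ m := by
  obtain ⟨A, B, hA, hB, h⟩ := exists_global_fraction (W := {v | v κ ≠ 0}) hg hg0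
  obtain ⟨a, k, ha, rfl⟩ := eq_C_mul_X_pow hA fun v hv => (h v hv).1
  obtain ⟨b, l, hb, rfl⟩ := eq_C_mul_X_pow hB fun v hv => (h v hv).2.1
  refine ⟨a / b, k - l, div_ne_zero ha hb, fun v hv => ?_⟩
  rw [(h v hv).2.2]
  simp only [map_mul, map_pow, eval_C, eval_X]
  rw [zpow_sub₀ hv, zpow_natCast, zpow_natCast, div_mul_div_comm]

/-- Let `A` have no zeros in the intersection of the complement of the zero set of `𝔞` with the
neighbourhood `q ≠ 0` of `u`.  A prime factor of `A` that vanishes at `u` has no zeros off the zero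
set of `𝔞`, as its own zero set is irreducible. -/
theorem eval_ne_zero_of_prime_factors {A A₁ q : MvPolynomial σ ℂ} {u : σ → ℂ} (hA₁ : A₁ ≠ 0)
    (hd : A₁ ∣ A) (hq : eval u q ≠ 0) (hp : ∀ p, Prime p → p ∣ A₁ → eval u p = 0)
    {𝔞 : Ideal (MvPolynomial σ ℂ)} (hA : ∀ v, (∃ f ∈ 𝔞, eval v f ≠ 0) → eval v q ≠ 0 → eval v A ≠ 0)
    {v : σ → ℂ} (hv : ∃ f ∈ 𝔞, eval v f ≠ 0) : eval v A₁ ≠ 0 := by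
  intro h0
  obtain ⟨p, hpp, hpd, hpv⟩ := exists_prime_dvd_eval_eq_zero hA₁ h0
  obtain ⟨f, hf, hfv⟩ := hv
  have h1 : ¬ p ∣ f * q := by
    intro h
    rcases hpp.dvd_or_dvd h with h | h
    · exact hfv (eval_eq_zero_of_dvd h hpv)
    · exact hq (eval_eq_zero_of_dvd h (hp p hpp hpd))
  obtain ⟨z, hz, hz2⟩ := exists_eval_eq_zero_of_not_dvd hpp h1
  rw [map_mul] at hz2
  exact hA z ⟨f, hf, left_ne_zero_of_mul hz2⟩ (right_ne_zero_of_mul hz2)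
    (eval_eq_zero_of_dvd (hpd.trans hd) hz)

/-- A complex number as a unit; zero is replaced by one. -/
def toUnit (c : ℂ) : ℂˣ := if h : c ≠ 0 then Units.mk0 c h else 1

theorem toUnit_val {c : ℂ} (h : c ≠ 0) : (toUnit c : ℂ) = c := by
  rw [toUnit, dif_pos h, Units.val_mk0]

/-- Every line bundle on an affine space is trivial.  A frame over an open set can be modified by
primes without zeros there so that it extends to a neighbourhood of a given point. -/
theorem exists_affine_frame (F : (σ → ℂ) → (σ → ℂ) → ℂˣ)
    (hF : ∀ u, ∃ q : MvPolynomial σ ℂ, eval u q ≠ 0 ∧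
      ∀ v, eval v q ≠ 0 → PolyReg (fun w => ((F u w / F v w : ℂˣ) : ℂ)) v) :
    ∃ s : (σ → ℂ) → ℂˣ, ∀ v, PolyReg (fun w => ((s w / F v w : ℂˣ) : ℂ)) v := by
  classical
  -- the open sets with a frame are described by ideals, so that there is a maximal one
  let W : Ideal (MvPolynomial σ ℂ) → Set (σ → ℂ) := fun 𝔞 => {v | ∃ f ∈ 𝔞, eval v f ≠ 0}
  let S : Set (Ideal (MvPolynomial σ ℂ)) := {𝔞 | ∃ s : (σ → ℂ) → ℂˣ, ∀ v ∈ W 𝔞,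
    PolyReg (fun w => ((s w / F v w : ℂˣ) : ℂ)) v}
  have hS : S.Nonempty := ⟨⊥, 1, fun v hv => by
    obtain ⟨f, hf, h⟩ := hv
    rw [Ideal.mem_bot.1 hf, map_zero] at h
    exact absurd rfl h⟩
  obtain ⟨𝔞, ⟨s, hs⟩, hmax⟩ := (wellFounded_gt (α := Ideal (MvPolynomial σ ℂ))).has_min S hS
  refine ⟨s, fun u => hs u ?_⟩
  by_contra hu
  obtain ⟨q, hqu, hq⟩ := hF u
  have hsu : ∀ v ∈ W 𝔞 ∩ {v | eval v q ≠ 0}, PolyReg (fun w => ((s w / F u w : ℂˣ) : ℂ)) v := by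
    rintro v ⟨hv, hv2⟩
    refine ((hs v hv).mul ((hq v hv2).inv (Units.ne_zero _))).congr (R := 1) (by simp) fun w _ => ?_
    rw [← Units.val_inv_eq_inv_val, ← Units.val_mul, inv_div, div_mul_div_cancel]
  obtain ⟨A, B, hA, hB, hAB⟩ := exists_global_fraction hsu fun v _ => Units.ne_zero _
  obtain ⟨A₁, A₂, rfl, hA₂, hA₁⟩ := exists_split hA u
  obtain ⟨B₁, B₂, rfl, hB₂, hB₁⟩ := exists_split hB u
  have hA₁W : ∀ v ∈ W 𝔞, eval v A₁ ≠ 0 := fun v hv =>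
    eval_ne_zero_of_prime_factors (left_ne_zero_of_mul hA) (dvd_mul_right _ _) hqu hA₁
      (fun v h1 h2 => (hAB v ⟨h1, h2⟩).1) hv
  have hB₁W : ∀ v ∈ W 𝔞, eval v B₁ ≠ 0 := fun v hv =>
    eval_ne_zero_of_prime_factors (left_ne_zero_of_mul hB) (dvd_mul_right _ _) hqu hB₁
      (fun v h1 h2 => (hAB v ⟨h1, h2⟩).2.1) hv
  -- the frame times `B₁ / A₁` extends by `F u` times `A₂ / B₂` to the locus where `q'` is nonzero
  let q' := q * (A₂ * B₂)
  have hq'u : eval u q' ≠ 0 := by simp only [q', map_mul]; exact mul_ne_zero hqu (mul_ne_zero hA₂ hB₂)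
  let s' : (σ → ℂ) → ℂˣ := fun v => if v ∈ W 𝔞 then s v * (toUnit (eval v B₁) / toUnit (eval v A₁))
    else F u v * (toUnit (eval v A₂) / toUnit (eval v B₂))
  have hs'W : ∀ v ∈ W 𝔞, (s' v : ℂ) = s v * (eval v B₁ / eval v A₁) := by
    intro v hv
    simp only [s', if_pos hv, Units.val_mul, Units.val_div_eq_div_val]
    rw [toUnit_val (hA₁W v hv), toUnit_val (hB₁W v hv)]
  have hs'q : ∀ v, eval v q' ≠ 0 → (s' v : ℂ) = F u v * (eval v A₂ / eval v B₂) := by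
    intro v hv
    simp only [q', map_mul] at hv
    have h1 := left_ne_zero_of_mul hv
    have h2 := left_ne_zero_of_mul (right_ne_zero_of_mul hv)
    have h3 := right_ne_zero_of_mul (right_ne_zero_of_mul hv)
    by_cases hvW : v ∈ W 𝔞
    · rw [hs'W v hvW]
      have h4 := (hAB v ⟨hvW, h1⟩).2.2
      have h5 := hA₁W v hvW
      have h6 := hB₁W v hvW
      have h7 := (F u v).ne_zero
      rw [Units.val_div_eq_div_val, map_mul, map_mul, div_eq_div_iff h7 (mul_ne_zero h6 h3)] at h4
      field_simp
      linear_combination h4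
    · simp only [s', if_neg hvW, Units.val_mul, Units.val_div_eq_div_val]
      rw [toUnit_val h2, toUnit_val h3]
  refine hmax (𝔞 ⊔ Ideal.span {q'}) ⟨s', ?_⟩ (lt_of_le_of_ne le_sup_left fun h => hu ⟨q', ?_, hq'u⟩)
  · rintro v ⟨g, hg, hgv⟩
    have hor : v ∈ W 𝔞 ∨ eval v q' ≠ 0 := by
      obtain ⟨f, hf, z, hz, rfl⟩ := Submodule.mem_sup.1 hg
      obtain ⟨c, rfl⟩ := Ideal.mem_span_singleton'.1 hz
      by_contra! hno
      have h1 : eval v f = 0 := by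
        by_contra h; exact hno.1 ⟨f, hf, h⟩
      rw [map_add, map_mul, h1, hno.2, mul_zero, add_zero] at hgv
      exact hgv rfl
    rcases hor with hv | hv
    · obtain ⟨f, hf, hfv⟩ := hv
      refine ((hs v ⟨f, hf, hfv⟩).mul (polyReg_div B₁ (hA₁W v ⟨f, hf, hfv⟩))).congr hfv
        fun w hw => ?_
      rw [Units.val_div_eq_div_val, Units.val_div_eq_div_val, hs'W w ⟨f, hf, hw⟩]
      ring
    · have h1 := hv
      simp only [q', map_mul] at h1
      refine ((hq v (left_ne_zero_of_mul h1)).mul (polyReg_div A₂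
        (right_ne_zero_of_mul (right_ne_zero_of_mul h1)))).congr hv fun w hw => ?_
      rw [Units.val_div_eq_div_val, Units.val_div_eq_div_val, hs'q w hw]
      ring
  · rw [h]
    exact Ideal.mem_sup_right (Ideal.mem_span_singleton_self _)

end Affine

/-! ### The Picard group -/

section Exchange

variable {n r d : ℕ} {τ : TorusSequence n r d}

/-- Any two bases are joined by exchanges that keep their common elements. -/
theorem exchange_induction (huni : τ.IsUnimodular) (P : τ.Bases → τ.Bases → Prop)
    (refl : ∀ I, P I I)
    (step : ∀ I K J i j, Exch I K i j → i ∉ J.1 → P K J → P I J) (I J : τ.Bases) : P I J := by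
  generalize hN : (I.1 \ J.1).card = N
  induction N generalizing I with
  | zero =>
    have h1 : I.1 ⊆ J.1 := by
      rw [Finset.card_eq_zero, Finset.sdiff_eq_empty_iff_subset] at hN; exact hN
    have : I = J := Bases.ext (Finset.eq_of_subset_of_card_le h1 (by rw [I.card, J.card]))
    rw [this]; exact refl J
  | succ N ih =>
    have h1 : ∃ j ∈ J.1, j ∉ I.1 := by
      by_contra! h
      have : J.1 = I.1 := Finset.eq_of_subset_of_card_le h (by rw [I.card, J.card])
      rw [this, Finset.sdiff_self, Finset.card_empty] at hN
      omega
    obtain ⟨j, hjJ, hjI⟩ := h1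
    have h2 : ∃ i ∈ I.1, i ∉ J.1 ∧ rho I i j ≠ 0 := by
      by_contra! h
      have := J.eq_zero (f := circ I j) (fun k hk => ?_) (a_mulVec_circ hjI)
      · have h3 := congrFun this j
        rw [circ_notMem hjI, if_pos rfl] at h3
        exact one_ne_zero h3
      · by_cases hkI : k ∈ I.1
        · rw [circ_mem hkI, h k hkI hk, neg_zero]
        · rw [circ_notMem hkI, if_neg]; rintro rfl; exact hk hjJ
    obtain ⟨i, hiI, hiJ, hρ⟩ := h2
    obtain ⟨K, hK⟩ := exists_exch huni hiI hjI hρ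
    refine step I K J i j hK hiJ (ih K ?_)
    have h3 : K.1 \ J.1 = (I.1 \ J.1).erase i := by
      rw [hK.eq, Finset.insert_sdiff_of_mem _ hjJ, Finset.erase_sdiff_comm]
    rw [h3, Finset.card_erase_of_mem (Finset.mem_sdiff.2 ⟨hiI, hiJ⟩), hN]
    rfl

end Exchange

section Picard

variable {n r d : ℕ} {τ : TorusSequence n r d} {η : Fin r → ℤ} [hN : Nondeg τ η]

theorem regularAt_param_iff_polyReg {I : τ.Bases} {u : Idx I → ℂ} {f : ToricSpace τ η → ℂ} :
    RegularAt f (param I u) ↔ PolyReg (fun v => f (param I v)) u := regularAt_param_iff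

/-- A line bundle is trivial on each chart. -/
theorem exists_chart_frame (L : lineBundles (ToricSpace τ η)) (I : τ.Bases) :
    ∃ s : ToricSpace τ η → ℂˣ, ∀ x ∈ chartSet η I, UnitRegularAt (s / L.1 x) x := by
  obtain ⟨s, hs⟩ := exists_affine_frame (σ := Idx I)
    (fun u w => L.1 (param I u) (param I w)) fun u => by
      obtain ⟨Q, h0, h⟩ := eventually_param_iff.1 (L.2 (param I u))
      exact ⟨Q, h0, fun v hv => regularAt_param_iff_polyReg.1 (h v hv)⟩
  refine ⟨fun x => s (coord I x), fun x hx => ?_⟩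
  rw [← param_coord hx]
  refine regularAt_param_iff_polyReg.2 ((hs (coord I x)).congr (R := 1) (by simp) fun w _ => ?_)
  rw [Pi.div_apply, coord_param]

/-- Two frames over charts that are joined by an edge differ by a Laurent monomial. -/
theorem TorusSequence.IsEdge.exists_laurent {I J : τ.Bases} {i j : Fin n} (h : IsEdge η I J i j)
    {s t : ToricSpace τ η → ℂˣ}
    (hst : ∀ x, x ∈ chartSet η I → x ∈ chartSet η J → UnitRegularAt (s / t) x) :
    ∃ (κ : Idx I) (c : ℂ) (m : ℤ),
      ((chartWt η I κ).1 = alpha I i ∨ (chartWt η I κ).1 = -alpha I i) ∧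
      ∀ x, x ∈ chartSet η I → x ∈ chartSet η J → coord I x κ ≠ 0 ∧
        ((s x / t x : ℂˣ) : ℂ) = c * coord I x κ ^ m := by
  obtain ⟨κ, -, -, -, hchart, hwt⟩ := h.exists_curve
  obtain ⟨c, m, -, hcm⟩ := exists_laurent_monomial (κ := κ)
    (g := fun v => (((s / t : ToricSpace τ η → ℂˣ) (param I v) : ℂˣ) : ℂ))
    (fun v hv => regularAt_param_iff_polyReg.1 (hst _ (param_mem I v)
      ((hchart _ (param_mem I v)).2 (by rwa [coord_param])))) (fun v _ => Units.ne_zero _)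
  refine ⟨κ, c, m, hwt, fun x hx hx2 => ?_⟩
  have h0 := (hchart x hx).1 hx2
  have h1 := hcm _ h0
  simp only [param_coord hx] at h1
  exact ⟨h0, h1⟩

theorem slicePoly_ne_zero (I : τ.Bases) (k : Fin n ⊕ Fin n) : slicePoly η I k ≠ 0 := by
  classical
  have hq : ∀ k, quadric I k ≠ 0 := by
    intro k h
    obtain ⟨i, hi, hρ⟩ := exists_rho_ne_zero I (hN.ne_zero k)
    have h1 := eval_quadric I k (Sum.elim (Pi.single ⟨i, hi⟩ 1) (Pi.single ⟨i, hi⟩ 1))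
    rw [h, map_zero, Fintype.sum_eq_single (⟨i, hi⟩ : I.1) (fun i' h' => by simp [h'])] at h1
    simp at h1
    exact hρ (by exact_mod_cast h1.symm)
  rcases k with k | k <;> simp only [slicePoly] <;> split_ifs <;>
    first
    | exact MvPolynomial.X_ne_zero _
    | exact one_ne_zero
    | exact hq k

variable (η) in
/-- The intersection of all charts is dense. -/
theorem exists_generic (I : τ.Bases) : ∃ R : MvPolynomial (Idx I) ℂ, R ≠ 0 ∧
    ∀ v, R.eval v ≠ 0 → ∀ J, (param I v : ToricSpace τ η) ∈ chartSet η J := by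
  classical
  have := Fintype.ofFinite τ.Bases
  refine ⟨∏ J : τ.Bases, ∏ k ∈ J.1ᶜ, slicePoly η I (sel η J k), ?_, fun v hv J => ?_⟩
  · exact Finset.prod_ne_zero_iff.2 fun J _ => Finset.prod_ne_zero_iff.2 fun k _ =>
      slicePoly_ne_zero I _
  · rw [map_prod] at hv
    have h1 := Finset.prod_ne_zero_iff.1 hv J (Finset.mem_univ J)
    rw [map_prod] at h1
    exact ⟨slice I v, rfl, fun k hk => Finset.prod_ne_zero_iff.1 h1 k (by simpa using hk)⟩

/-- Two frames that agree on the intersection of all charts agree. -/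
theorem eq_of_eq_generic {I J : τ.Bases} {s t : ToricSpace τ η → ℂˣ}
    (hst : ∀ x, x ∈ chartSet η I → x ∈ chartSet η J → UnitRegularAt (s / t) x)
    (h : ∀ x, (∀ K, x ∈ chartSet η K) → s x = t x) {x : ToricSpace τ η}
    (hxI : x ∈ chartSet η I) (hxJ : x ∈ chartSet η J) : s x = t x := by
  obtain ⟨R, hR, hRc⟩ := exists_generic η I
  obtain ⟨A, B, -, -, hAB⟩ := exists_global_fraction
    (W := {v | (param I v : ToricSpace τ η) ∈ chartSet η J})
    (g := fun v => (((s / t : ToricSpace τ η → ℂˣ) (param I v) : ℂˣ) : ℂ))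
    (fun v hv => regularAt_param_iff_polyReg.1 (hst _ (param_mem I v) hv))
    (fun v _ => Units.ne_zero _)
  have h1 : A = B := eq_of_eval_eq hR fun v hv => by
    obtain ⟨-, h2, h3⟩ := hAB v (hRc v hv J)
    rw [Pi.div_apply, h _ (hRc v hv), div_self', Units.val_one, eq_div_iff h2, one_mul] at h3
    exact h3.symm
  have hx : (param I (coord I x) : ToricSpace τ η) ∈ chartSet η J := by rwa [param_coord hxI]
  obtain ⟨-, h2, h3⟩ := hAB _ hx
  rw [h1, div_self h2, param_coord hxI, Pi.div_apply] at h3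
  exact div_eq_one.1 (Units.ext h3)

theorem unitRegularAt_const {X : Type} [SpaceWithFunctions X] (c : ℂˣ) (x : X) :
    UnitRegularAt (fun _ => c) x := regularAt_const _ x

theorem fibreW_dotProduct {I : τ.Bases} (w : Fin n → ℤ) {k : Fin n} (hk : k ∈ I.1) :
    (fibreW η I w).1 ⬝ᵥ τ.aVec k = w k := by
  rw [← transpose_a_mulVec, transpose_a_fibreW, Pi.sub_apply, slack_mem hk, sub_zero]

/-- The frames of a line bundle over the charts, restricted to the orbit of a generic point, differ
by characters of `H`, and these characters come from a character `w` of `T`. -/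
theorem exists_weight {s : τ.Bases → ToricSpace τ η → ℂˣ}
    (hs : ∀ I J x, x ∈ chartSet η I → x ∈ chartSet η J → UnitRegularAt (s I / s J) x)
    {x : ToricSpace τ η} (hx : ∀ K, x ∈ chartSet η K) :
    ∃ (w : Fin n → ℤ) (ω : Torus d → ℂˣ), ∀ (I : τ.Bases) (h : Torus d),
      s I (((h, 1) : BigTorus d) • x) / s I x = torusChar (fibreW η I w).1 h * ω h := by
  set q : τ.Bases → Torus d → ℂˣ := fun I h => s I (((h, 1) : BigTorus d) • x) / s I x with hq
  let Q : τ.Bases → τ.Bases → Prop := fun I J => ∃ χ : Fin d → ℤ,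
    (∀ k ∈ I.1, k ∈ J.1 → χ ⬝ᵥ τ.aVec k = 0) ∧ ∀ h, q I h = torusChar χ h * q J h
  have htrans : ∀ I K J i j, Exch I K i j → i ∉ J.1 → Q I K → Q K J → Q I J := by
    rintro I K J i j hE hi ⟨χ, h1, h2⟩ ⟨χ₂, h3, h4⟩
    refine ⟨χ + χ₂, fun k hk hkJ => ?_, fun h => by rw [h2, h4, torusChar_add, mul_assoc]⟩
    have hkK : k ∈ K.1 := by
      rw [hE.eq]
      exact Finset.mem_insert_of_mem (Finset.mem_erase.2 ⟨fun h => hi (h ▸ hkJ), hk⟩)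
    rw [add_dotProduct, h1 k hk hkK, h3 k hkK hkJ, add_zero]
  have hline := line_induction hN.uni hN.gen Q (fun I J i j hE => by
      obtain ⟨κ, c, m, hwt, hcm⟩ := hE.exists_laurent (hs I J)
      refine ⟨m • (chartWt η I κ).1, fun k hk hkJ => ?_, fun h => ?_⟩
      · have hik : i ≠ k := by rintro rfl; exact hE.1.notMem_right hkJ
        rw [smul_dotProduct]
        rcases hwt with hwt | hwt
        · rw [hwt, alpha_dotProduct_aVec hk, if_neg hik, smul_zero]
        · rw [hwt, neg_dotProduct, alpha_dotProduct_aVec hk, if_neg hik, neg_zero, smul_zero]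
      · have h1 := (hcm x (hx I) (hx J)).2
        have h0 := (hcm x (hx I) (hx J)).1
        have h2 := (hcm _ (smul_mem_chartSet (hx I) (h, 1)) (smul_mem_chartSet (hx J) (h, 1))).2
        rw [coord_smul (hx I), mul_zpow, mul_left_comm, ← h1, bigChar, one_zpow, mul_one,
          ← Units.val_zpow_eq_zpow_val, ← Units.val_mul, ← torusChar_zsmul] at h2
        have h3 := Units.ext h2
        rw [div_eq_iff_eq_mul] at h3
        change s I _ / s I x = _ * (s J _ / s J x)
        rw [h3]
        ext
        push_cast
        field_simp)
    (fun I K J i k j h1 h2 _ _ h3 h4 => htrans I K J i k h1 h2.notMem_right h3 h4)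
  have hall : ∀ I J, Q I J := exchange_induction hN.uni Q
    (fun I => ⟨0, fun k _ _ => zero_dotProduct _, fun h => by rw [torusChar_zero, one_mul]⟩)
    (fun I K J i j hE hi h => htrans I K J i j hE hi (hline I K i j hE) h)
  obtain ⟨I₀⟩ : Nonempty τ.Bases := by
    obtain ⟨I, -⟩ := exists_mem_chartSet x
    exact ⟨I⟩
  choose χ hχ₁ hχ₂ using hall
  choose B hB using fun i => exists_bases_mem hN.uni (hN.ne_zero i)
  let w : Fin n → ℤ := fun i => χ (B i) I₀ ⬝ᵥ τ.aVec i
  refine ⟨w, q I₀, fun I h => ?_⟩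
  have hw : (fibreW η I w).1 = χ I I₀ := by
    refine I.ext_dotProduct fun i hi => ?_
    rw [fibreW_dotProduct w hi]
    have h1 : χ I I₀ = χ I (B i) + χ (B i) I₀ := torusChar_injective fun h => by
      have h2 := hχ₂ I (B i) h
      rw [hχ₂ I I₀, hχ₂ (B i) I₀, ← mul_assoc] at h2
      rw [torusChar_add]
      exact mul_right_cancel h2
    rw [h1, add_dotProduct, hχ₁ I (B i) i hi (hB i), zero_add]
  rw [hw]
  exact hχ₂ I I₀ h

/-- Every line bundle comes from a character of `S`. -/
theorem picHom_surjective : Function.Surjective (picHom τ η) := by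
  intro l
  obtain ⟨L, rfl⟩ : ∃ L, picMk L = l := QuotientGroup.mk_surjective l
  choose s₀ hs₀ using exists_chart_frame L
  have hs₀r : ∀ I J x, x ∈ chartSet η I → x ∈ chartSet η J → UnitRegularAt (s₀ I / s₀ J) x := by
    intro I J x hI hJ
    have := (hs₀ I x hI).mul (hs₀ J x hJ).inv
    rwa [inv_div, div_mul_div_cancel] at this
  obtain ⟨I₀, -⟩ := exists_bases_superset hN.uni (S := ∅) linearIndependent_empty_type
  obtain ⟨R, hR, hRc⟩ := exists_generic η I₀
  obtain ⟨v, hv⟩ := exists_eval_ne_zero hR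
  set x : ToricSpace τ η := param I₀ v
  have hx : ∀ K, x ∈ chartSet η K := hRc v hv
  obtain ⟨w, ω, hw⟩ := exists_weight hs₀r hx
  set θ := τ.b *ᵥ w with hθ
  -- the frames of the tensor product with the bundle of `θ`, normalized at the generic point
  let s : τ.Bases → ToricSpace τ η → ℂˣ := fun I =>
    (s₀ I * frame I θ) * fun _ => (s₀ I x * frame I θ x)⁻¹
  have hsr : ∀ I J y, y ∈ chartSet η I → y ∈ chartSet η J → UnitRegularAt (s I / s J) y := by
    intro I J y hI hJ
    have := ((hs₀r I J y hI hJ).mul (unitRegularAt_frame hI hJ θ)).mul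
      (unitRegularAt_const ((s₀ I x * frame I θ x)⁻¹ / (s₀ J x * frame J θ x)⁻¹) y)
    rw [div_mul_div_comm] at this
    have h2 : s I / s J = (s₀ I * frame I θ) / (s₀ J * frame J θ) *
        fun _ => (s₀ I x * frame I θ x)⁻¹ / (s₀ J x * frame J θ x)⁻¹ := by
      funext y; exact (div_mul_div_comm _ _ _ _).symm
    rwa [h2]
  have hsx : ∀ I (h : Torus d), s I (((h, 1) : BigTorus d) • x) = ω h * eqCocyc w (h, 1) x := by
    intro I h
    have h1 := hw I h
    have h2 := eqCocyc_eq w (h, 1) (hx I)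
    rw [bigChar, one_zpow, mul_one] at h2
    change s₀ I _ * frame I θ _ * (s₀ I x * frame I θ x)⁻¹ = _
    have h3 : torusChar (fibreW η I w).1 ((h, 1) : BigTorus d).1 * ω h = _ := h1.symm
    rw [h2, mul_left_comm, ← mul_assoc, h3, div_mul_div_comm, div_eq_mul_inv]
  have hedge : ∀ I J i j, IsEdge η I J i j → ∀ y, (∀ K, y ∈ chartSet η K) → s I y = s J y := by
    intro I J i j hE y hy
    obtain ⟨κ, c, m, -, hcm⟩ := hE.exists_laurent (hsr I J)
    have h1 : ∀ h : Torus d, c * (torusChar (m • (chartWt η I κ).1) h *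
        coord I x κ ^ m) = 1 := by
      intro h
      have h2 := (hcm _ (smul_mem_chartSet (hx I) (h, 1)) (smul_mem_chartSet (hx J) (h, 1))).2
      rw [hsx, hsx, div_self', coord_smul (hx I), mul_zpow, bigChar, one_zpow, mul_one,
        ← Units.val_zpow_eq_zpow_val, ← torusChar_zsmul] at h2
      rw [← h2, Units.val_one]
    have h2 := h1 1
    rw [torusChar_one, Units.val_one, one_mul] at h2
    have h3 : m • (chartWt η I κ).1 = 0 := torusChar_injective fun h => by
      have h4 := h1 h
      rw [mul_left_comm, h2, mul_one] at h4
      rw [torusChar_zero]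
      exact Units.ext h4
    have hm : m = 0 := (smul_eq_zero.1 h3).resolve_right (chartWt_fst_ne_zero I κ)
    rw [hm, zpow_zero, mul_one] at h2
    have h5 := (hcm y (hy I) (hy J)).2
    rw [hm, zpow_zero, mul_one, h2] at h5
    exact div_eq_one.1 (Units.ext h5)
  have hline := line_induction hN.uni hN.gen
    (fun I J => ∀ y, (∀ K, y ∈ chartSet η K) → s I y = s J y) hedge
    (fun I K J i k j _ _ _ _ h1 h2 y hy => (h1 y hy).trans (h2 y hy))
  have hall : ∀ I J, ∀ y, (∀ K, y ∈ chartSet η K) → s I y = s J y :=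
    exchange_induction hN.uni _ (fun _ _ _ => rfl)
      (fun I K J i j hE _ h y hy => (hline I K i j hE y hy).trans (h y hy))
  have htriv : L * lineB τ η θ ∈ trivialBundles (ToricSpace τ η) := by
    refine ⟨fun y => s (chIdx y) y, fun y => ?_⟩
    have h1 := ((hs₀ (chIdx y) y (mem_chIdx y)).mul
      (unitRegularAt_const ((s₀ (chIdx y) x * frame (chIdx y) θ x)⁻¹) y))
    refine regularAt_congr _ _ _ h1 ?_
    filter_upwards [(isOpen_chartSet (chIdx y)).mem_nhds (mem_chIdx y)] with z hz
    have h2 := eq_of_eq_generic (hsr (chIdx z) (chIdx y)) (hall _ _) (mem_chIdx z) hz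
    congr 1
    change _ = s (chIdx z) z / (L.1 y z * frame (chIdx y) θ z)
    rw [h2]
    change s₀ (chIdx y) z / L.1 y z * _ = (s₀ (chIdx y) z * frame (chIdx y) θ z) * _ / _
    rw [div_eq_mul_inv, div_eq_mul_inv, mul_inv]
    generalize (s₀ (chIdx y) x * frame (chIdx y) θ x)⁻¹ = C
    ext
    push_cast
    field_simp
  refine ⟨-θ, ?_⟩
  rw [map_neg, neg_eq_iff_add_eq_zero]
  have h1 : (QuotientGroup.mk (L * lineB τ η θ) : lineBundles (ToricSpace τ η) ⧸ trivialBundles _) =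
    1 := (QuotientGroup.eq_one_iff _).2 htriv
  rw [add_comm]
  exact h1

variable (τ η) in
/-- The isomorphism of the characters of `S` with the Picard group. -/
def picEquiv : (Fin r → ℤ) ≃+ Pic (ToricSpace τ η) :=
  AddEquiv.ofBijective (picHom τ η) ⟨picHom_injective, picHom_surjective⟩

end Picard

/-! ### The ample cone -/

section General

variable {X : Type} [SpaceWithFunctions X]

theorem regularAt_pow {f : X → ℂ} {x : X} (hf : RegularAt f x) (m : ℕ) :
    RegularAt (fun y => f y ^ m) x := by
  induction m with
  | zero => simpa using regularAt_const 1 x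
  | succ m ih => simpa [pow_succ] using regularAt_mul _ _ x ih hf

theorem IsAmpleBundle.of_picMk_eq {L L₂ : lineBundles X} (h : picMk L = picMk L₂)
    (hL : IsAmpleBundle L) : IsAmpleBundle L₂ := by
  obtain ⟨φ, hφ⟩ : L⁻¹ * L₂ ∈ trivialBundles X := QuotientGroup.eq.1 h
  intro U x hU hx
  obtain ⟨m, hm, g, hg, h0, h1⟩ := hL U x hU hx
  refine ⟨m, hm, fun y => g y * (φ y : ℂ) ^ m, fun z => ?_,
    mul_ne_zero h0 (pow_ne_zero _ (Units.ne_zero _)), fun y hy => h1 y (left_ne_zero_of_mul hy)⟩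
  refine regularAt_congr _ _ z (regularAt_mul _ _ z (hg z) (regularAt_pow (hφ z) m))
    (Eventually.of_forall fun y => ?_)
  change g y / (L.1 z y : ℂ) ^ m * ((φ y / ((L.1 z y)⁻¹ * L₂.1 z y) : ℂˣ) : ℂ) ^ m =
    g y * (φ y : ℂ) ^ m / (L₂.1 z y : ℂ) ^ m
  push_cast
  have h2 := (L.1 z y).ne_zero
  have h3 := (L₂.1 z y).ne_zero
  simp only [div_pow, mul_pow, inv_pow]
  field_simp

end General

section Ample

variable {n r d : ℕ} {τ : TorusSequence n r d} {η : Fin r → ℤ} [hN : Nondeg τ η]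

/-- An ample bundle has positive degree on the curve of each edge: a section that is nonzero at `p_I`
and vanishes off the chart of `I` vanishes at the other fixed point of the curve. -/
theorem slack_mul_pos_of_isAmpleBundle {θ : Fin r → ℤ} (hθ : IsAmpleBundle (lineB τ η θ))
    (I : τ.Bases) {j : Fin n} (hj : j ∉ I.1) : 0 < slack I θ j * slack I η j := by
  refine slack_of_edges (η := η) (p := fun x y => 0 < x * y) θ (fun x y h => by simpa using h)
    (fun x y x₂ y₂ h h₂ h3 => ?_) (fun J I j i hE => ?_) I hj
  · rcases mul_pos_iff.1 h3 with h4 | h4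
    · have h5 := pos_of_mul_pos_left h h4.1.le
      have h6 := pos_of_mul_pos_left h₂ h4.2.le
      exact mul_pos (add_pos h5 h6) (add_pos h4.1 h4.2)
    · have h5 := neg_of_mul_pos_left h h4.1.le
      have h6 := neg_of_mul_pos_left h₂ h4.2.le
      exact mul_pos_of_neg_of_neg (add_neg h5 h6) (add_neg h4.1 h4.2)
  · obtain ⟨m, hm, g, hg, h0, h1⟩ := hθ (chartSet η I) (param I 0) (isOpen_chartSet I) (param_mem I 0)
    have hIJ : I ≠ J := by
      rintro rfl
      exact hE.1.notMem hE.1.mem_right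
    have h2 : g (param J 0) = 0 := by
      by_contra h3
      exact hIJ (eq_of_param_zero_mem (h1 _ h3)).symm
    obtain ⟨A, B, hA, hB, h3, hA0, hB0, -⟩ := hE.symm.exists_section θ m g (fun K x hx => by
      refine regularAt_congr _ _ x (regularAt_mul _ _ x (hg x)
        (regularAt_pow (unitRegularAt_frame (mem_chIdx x) hx θ) m)) (Eventually.of_forall fun y => ?_)
      change g y / (frame (chIdx x) θ y : ℂ) ^ m * ((frame (chIdx x) θ y / frame K θ y : ℂˣ) : ℂ) ^ m
        = g y / ((frame K θ y ^ (m : ℤ) : ℂˣ) : ℂ)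
      push_cast
      rw [zpow_natCast]
      have h2 := (frame (chIdx x) θ y).ne_zero
      have h3 := (frame K θ y).ne_zero
      simp only [div_pow]
      field_simp)
    by_contra hle
    have hsg := sg_mul_slack_self_pos (η := η) J i hE.1.notMem
    have h4 : sg η J i * slack J θ i ≤ 0 := by
      by_contra h5
      refine hle ?_
      have h6 := mul_pos (not_le.1 h5) hsg
      have h7 : sg η J i * sg η J i = 1 := by unfold sg; split_ifs <;> rfl
      calc (0 : ℤ) < _ := h6
        _ = (sg η J i * sg η J i) * (slack J θ i * slack J η i) := by ring
        _ = _ := by rw [h7, one_mul]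
    refine h0 (hA0.1 (eq_zero_of_eq_zpow_mul hA hB.continuous.continuousAt h3 ?_ 0))
    rcases h4.lt_or_eq with h5 | h5
    · exact Or.inl (mul_neg_of_pos_of_neg (by exact_mod_cast hm) h5)
    · exact Or.inr ⟨by rw [h5, mul_zero], hB0.2 h2⟩

theorem frame_proj_pow_mul {I K : τ.Bases} {z : Level τ η} (hI : InChart η I z.1)
    (hK : InChart η K z.1) (θ : Fin r → ℤ) (N : ℕ) :
    ((frame I θ (proj z) : ℂˣ) : ℂ) ^ N / ((frame K θ (proj z) : ℂˣ) : ℂ) ^ N =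
      (mono η I θ z.1 : ℂ) ^ N * ((mono η K (-θ) z.1 : ℂˣ) : ℂ) ^ N := by
  rw [frame_proj hI, frame_proj hK, mono_neg]
  have h1 := (mono η K θ z.1).ne_zero
  have h2 := (trivU θ z).ne_zero
  push_cast
  simp only [mul_pow, inv_pow]
  field_simp

theorem levelRegularAt_mono_pow {K : τ.Bases} {z : Level τ η} (hK : InChart η K z.1)
    (θ : Fin r → ℤ) (N : ℕ) :
    LevelRegularAt (fun w => ((mono η K θ w.1 : ℂˣ) : ℂ) ^ N) z := by
  induction N with
  | zero => exact ⟨1, 1, by simp, fun w _ => by simp⟩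
  | succ m ih =>
    simp only [pow_succ]
    exact ih.mul (levelRegularAt_mono hK θ)

open Classical in
/-- If all exponents of the frame monomials of weight `θ` are positive, a principal open subset
`Q ≠ 0` of a chart is cut out by the section `Q · f ^ N`, where `f` is the frame over the chart: for
large `N` it extends by zero. -/
theorem isAmpleBundle_lineB {θ : Fin r → ℤ}
    (hθ : ∀ (I : τ.Bases), ∀ k ∉ I.1, 0 < sg η I k * slack I θ k) :
    IsAmpleBundle (lineB τ η θ) := by
  intro U x hU hx
  obtain ⟨I, u, rfl⟩ := exists_param x
  obtain ⟨Q, h0, hQ⟩ := eventually_param_iff.1 (hU.mem_nhds hx)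
  obtain ⟨N, hN0, G, hG, hG0⟩ : ∃ N : ℕ, 0 < N ∧ ∃ G : MvPolynomial (Fin n ⊕ Fin n) ℂ,
      (∀ z, InChart η I z → G.eval z =
        Q.eval (fun κ => normPt η I z κ.incl) * (mono η I θ z : ℂ) ^ N) ∧
      ∀ z, ¬ InChart η I z → G.eval z = 0 := by
    obtain ⟨N₀, hN₀⟩ := exists_clear (hθ I) Q
    exact ⟨N₀ + 1, by omega, hN₀ (N₀ + 1) (by omega)⟩
  let g : ToricSpace τ η → ℂ := fun y =>
    if y ∈ chartSet η I then Q.eval (coord I y) * ((frame I θ y : ℂˣ) : ℂ) ^ N else 0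
  have hg : ∀ y, y ∈ chartSet η I → g y = Q.eval (coord I y) * ((frame I θ y : ℂˣ) : ℂ) ^ N :=
    fun y hy => if_pos hy
  have hg0 : ∀ y, y ∉ chartSet η I → g y = 0 := fun y hy => if_neg hy
  refine ⟨N, hN0, g, fun y => ?_, ?_, fun y hy => ?_⟩
  · obtain ⟨z, rfl⟩ := proj_surjective y
    have hK := inChart_chIdx z
    generalize hKdef : chIdx (proj z) = K at hK
    have h1 : LevelRegularAt (fun w : Level τ η => G.eval w.1 *
        ((mono η K (-θ) w.1 : ℂˣ) : ℂ) ^ N) z := by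
      exact LevelRegularAt.mul ⟨G, 1, by simp, fun w _ => by simp⟩ (levelRegularAt_mono_pow hK _ _)
    refine toricRegularAt_proj.2 (h1.congr (isOpen_chartSet K) (proj_mem_chartSet.2 hK)
      fun w hw => ?_)
    change _ = g (proj w) / ((frame (chIdx (proj z)) θ (proj w) : ℂˣ) : ℂ) ^ N
    rw [hKdef]
    have hKw := proj_mem_chartSet.1 hw
    by_cases hI : InChart η I w.1
    · have hc : coord I (proj w) = fun κ => normPt η I w.1 κ.incl :=
        funext fun κ => coord_proj hI κ
      rw [hg _ (proj_mem_chartSet.2 hI), mul_div_assoc, frame_proj_pow_mul hI hKw, ← mul_assoc,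
        hG _ hI, hc]
    · rw [hg0 _ fun h => hI (proj_mem_chartSet.1 h), zero_div, hG0 _ hI, zero_mul]
  · rw [hg _ (param_mem I u), coord_param]
    exact mul_ne_zero h0 (pow_ne_zero _ (Units.ne_zero _))
  · have hyI : y ∈ chartSet η I := by
      by_contra h
      exact hy (hg0 y h)
    rw [hg y hyI] at hy
    rw [← param_coord hyI]
    exact hQ _ (left_ne_zero_of_mul hy)

/-- The bundle of `θ` is ample if and only if `θ` has the same signs as `η` on all circuit vectors. -/
theorem isAmpleBundle_lineB_iff {θ : Fin r → ℤ} : IsAmpleBundle (lineB τ η θ) ↔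
    ∀ (I : τ.Bases), ∀ j ∉ I.1, 0 < (θ ⬝ᵥ bet I j) * (η ⬝ᵥ bet I j) := by
  constructor
  · intro h I j hj
    simpa only [slack_notMem hj] using slack_mul_pos_of_isAmpleBundle h I hj
  · intro h
    refine isAmpleBundle_lineB fun I k hk => ?_
    have h1 := h I k hk
    rw [slack_notMem hk, sg]
    split_ifs with h2
    · have := pos_of_mul_pos_left h1 h2.le
      omega
    · have := neg_of_mul_pos_left h1 (not_lt.1 h2)
      omega

end Ample

section Cone

/-- An open set that is stable under positive scaling is contained in the convex cone generated by
its integral points: a large multiple of a point is a convex combination of its floor and of the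
translates of the floor by `e + 1` along the coordinate axes. -/
theorem mem_hull_integral {e : ℕ} {C : Set (Fin e → ℝ)} (hC : IsOpen C)
    (hs : ∀ c : ℝ, 0 < c → ∀ x ∈ C, c • x ∈ C) {V : Type*} [AddCommGroup V] [Module ℝ V]
    (f : (Fin e → ℝ) →ₗ[ℝ] V) {x : Fin e → ℝ} (hx : x ∈ C) :
    f x ∈ ConvexCone.hull ℝ {v | ∃ y : Fin e → ℤ, realPt y ∈ C ∧ v = f (realPt y)} := by
  obtain ⟨ε, hε, hb⟩ := Metric.isOpen_iff.1 hC x hx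
  obtain ⟨N, hN⟩ := exists_nat_gt ((e + 3) / ε)
  have hN0 : (0 : ℝ) < N := lt_trans (by positivity) hN
  rw [div_lt_iff₀ hε] at hN
  have near : ∀ y : Fin e → ℝ, (∀ i, |y i - N * x i| ≤ e + 2) → y ∈ C := by
    intro y hy
    have h1 : (N : ℝ)⁻¹ • y ∈ C := by
      refine hb (Metric.mem_ball.2 ((dist_pi_lt_iff hε).2 fun i => ?_))
      rw [Real.dist_eq, Pi.smul_apply, smul_eq_mul]
      have h2 : (N : ℝ)⁻¹ * y i - x i = (y i - N * x i) / N := by field_simp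
      rw [h2, abs_div, abs_of_pos hN0, div_lt_iff₀ hN0]
      linarith [hy i]
    have h2 := hs N hN0 _ h1
    rwa [smul_inv_smul₀ hN0.ne'] at h2
  let q : Option (Fin e) → Fin e → ℤ := fun o => o.elim (fun i => ⌊N * x i⌋)
    fun k i => ⌊N * x i⌋ + if i = k then (e + 1 : ℤ) else 0
  let t : Fin e → ℝ := fun k => Int.fract (N * x k) / (e + 1)
  let w : Option (Fin e) → ℝ := fun o => o.elim (1 - ∑ k, t k) t
  have ht : ∀ k, 0 ≤ t k := fun k => div_nonneg (Int.fract_nonneg _) (by positivity)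
  have ht1 : ∑ k, t k ≤ 1 := by
    have h1 : ∀ k ∈ Finset.univ, t k ≤ 1 / (e + 1 : ℝ) := fun k _ => by
      simp only [t]; gcongr; exact (Int.fract_lt_one _).le
    refine (Finset.sum_le_card_nsmul _ _ _ h1).trans ?_
    simp only [Finset.card_univ, Fintype.card_fin, nsmul_eq_mul]
    rw [mul_one_div, div_le_one (by positivity)]; linarith
  have hq : ∀ o, realPt (q o) ∈ C := by
    refine fun o => near _ fun i => ?_
    have h1 := Int.floor_le (N * x i)
    have h2 := Int.lt_floor_add_one (N * x i)
    rcases o with _ | k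
    · simp only [realPt, q, Option.elim]
      rw [abs_le]; constructor <;> linarith [(Nat.cast_nonneg e : (0 : ℝ) ≤ e)]
    · simp only [realPt, q, Option.elim]
      rw [abs_le]
      split_ifs <;> push_cast <;> constructor <;> linarith [(Nat.cast_nonneg e : (0 : ℝ) ≤ e)]
  have hsum : (N : ℝ) • x = ∑ o, w o • realPt (q o) := by
    funext i
    have h1 : (∑ o, w o • realPt (q o)) i = (1 - ∑ k, t k) * (⌊N * x i⌋ : ℝ) +
        ∑ k, t k * ((⌊N * x i⌋ : ℝ) + if i = k then (e + 1 : ℝ) else 0) := by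
      rw [Fintype.sum_option, Pi.add_apply, Finset.sum_apply]
      simp [w, q, realPt]
    rw [h1, Finset.sum_congr rfl fun k _ => mul_add _ _ _, Finset.sum_add_distrib, ← Finset.sum_mul]
    simp only [mul_ite, mul_zero, Finset.sum_ite_eq, Finset.mem_univ, if_true, Pi.smul_apply,
      smul_eq_mul, t]
    rw [div_mul_cancel₀ _ (by positivity)]
    linarith [Int.floor_add_fract (N * x i)]
  have h1 : f ((N : ℝ) • x) ∈ ConvexCone.hull ℝ
      {v | ∃ y : Fin e → ℤ, realPt y ∈ C ∧ v = f (realPt y)} := by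
    rw [hsum, map_sum]
    simp only [map_smul]
    refine (ConvexCone.convex _).sum_mem (fun o _ => ?_) ?_ fun o _ =>
      ConvexCone.subset_hull ⟨q o, hq o, rfl⟩
    · rcases o with _ | k
      · exact sub_nonneg.2 ht1
      · exact ht k
    · rw [Fintype.sum_option]; simp [w]
  have h2 := ConvexCone.smul_mem _ (inv_pos.2 hN0) h1
  rwa [map_smul, inv_smul_smul₀ hN0.ne'] at h2

/-- The real extension of a homomorphism as a linear map. -/
def realExtLin {e : ℕ} {P : Type} [AddCommGroup P] (κ : (Fin e → ℤ) →+ P) :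
    (Fin e → ℝ) →ₗ[ℝ] ℝ ⊗[ℤ] P :=
  ∑ i, (LinearMap.proj i).smulRight ((1 : ℝ) ⊗ₜ[ℤ] κ (Pi.single i 1))

theorem realExtLin_apply {e : ℕ} {P : Type} [AddCommGroup P] (κ : (Fin e → ℤ) →+ P)
    (x : Fin e → ℝ) : realExtLin κ x = realExt κ x := by
  simp [realExtLin, realExt, TensorProduct.smul_tmul']

theorem realExt_realPt {e : ℕ} {P : Type} [AddCommGroup P] (κ : (Fin e → ℤ) →+ P)
    (y : Fin e → ℤ) : realExt κ (realPt y) = (1 : ℝ) ⊗ₜ[ℤ] κ y := by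
  have h1 : y = ∑ i, y i • (Pi.single i 1 : Fin e → ℤ) := by
    funext k
    simp [Finset.sum_apply, Pi.single_apply]
  conv_rhs => rw [h1, map_sum, TensorProduct.tmul_sum]
  refine Finset.sum_congr rfl fun i _ => ?_
  rw [map_zsmul, TensorProduct.tmul_smul, TensorProduct.smul_tmul']
  simp [realPt]

end Cone

section AmpleCone

variable {n r d : ℕ} {τ : TorusSequence n r d} {η : Fin r → ℤ} [hN : Nondeg τ η]

theorem mem_cell_dual_iff {x : Fin r → ℝ} : x ∈ cell τ.dual η ↔
    ∀ (I : τ.Bases), ∀ j ∉ I.1, 0 < realPairing x (bet I j) * ((η ⬝ᵥ bet I j : ℤ) : ℝ) := by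
  constructor
  · intro h I j hj
    have := h I.compl j (Bases.mem_compl.2 hj)
    rwa [alpha_compl hj] at this
  · intro h J j hj
    obtain ⟨I, rfl⟩ := (gale τ).surjective J
    have hj' : j ∉ I.1 := Bases.mem_compl.1 hj
    change 0 < realPairing x (alpha I.compl j) * ((η ⬝ᵥ alpha I.compl j : ℤ) : ℝ)
    rw [alpha_compl hj']
    exact h I j hj'

theorem isOpen_cell (ξ : Fin d → ℤ) : IsOpen (cell τ ξ) := by
  have h : cell τ ξ = ⋂ (I : τ.Bases), ⋂ (i : I.1),
      {x | 0 < realPairing x (alpha I i) * ((ξ ⬝ᵥ alpha I i : ℤ) : ℝ)} := by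
    ext x
    simp only [cell, Set.mem_ofPred_eq, Set.mem_iInter, Subtype.forall]
  rw [h]
  refine isOpen_iInter_of_finite fun I => isOpen_iInter_of_finite fun i => ?_
  refine isOpen_lt continuous_const ?_
  unfold realPairing
  fun_prop

variable (τ η) in
/-- The ample cone is the chamber of the dual.  One inclusion holds as the chamber is open, hence
generated by integral points; the other as the inequalities hold for ample bundles. -/
theorem mem_ampleCone_iff (x : Fin r → ℝ) : x ∈ cell τ.dual η ↔
    realExt (picEquiv τ η).toAddMonoidHom x ∈ ampleCone (ToricSpace τ η) := by
  constructor
  · intro hx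
    have h1 := mem_hull_integral (isOpen_cell (τ := τ.dual) η) (fun c hc y hy I i hi => by
      have := mul_pos hc (hy I i hi)
      rwa [← mul_assoc, ← realPairing_smul] at this)
      (realExtLin (picEquiv τ η).toAddMonoidHom) hx
    rw [realExtLin_apply] at h1
    refine ConvexCone.hull_min ?_ h1
    rintro _ ⟨y, hy, rfl⟩
    refine ConvexCone.subset_hull ⟨lineB τ η y, isAmpleBundle_lineB_iff.2 fun I j hj => ?_, ?_⟩
    · have := mem_cell_dual_iff.1 hy I j hj
      rw [realPairing_realPt] at this
      exact_mod_cast this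
    · rw [realExtLin_apply, realExt_realPt]; rfl
  · intro h
    refine mem_cell_dual_iff.2 fun I j hj => ?_
    let φ : Pic (ToricSpace τ η) →ₗ[ℤ] ℝ := (AddMonoidHom.mk' (fun l =>
      (((picEquiv τ η).symm l ⬝ᵥ bet I j : ℤ) : ℝ) * ((η ⬝ᵥ bet I j : ℤ) : ℝ)) (fun l m => by
        rw [map_add, add_dotProduct]; push_cast; ring)).toIntLinearMap
    have h1 : ∀ v ∈ ampleCone (ToricSpace τ η), 0 < φ.liftBaseChange ℝ v := by
      let K : ConvexCone ℝ (ℝ ⊗[ℤ] Pic (ToricSpace τ η)) :=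
        { carrier := {v | 0 < φ.liftBaseChange ℝ v}
          smul_mem' := fun c hc v hv => by
            change 0 < φ.liftBaseChange ℝ (c • v)
            rw [map_smul]; exact mul_pos hc hv
          add_mem' := fun v hv w hw => by
            change 0 < φ.liftBaseChange ℝ (v + w)
            rw [map_add]; exact add_pos hv hw }
      refine ConvexCone.hull_min (C := K) ?_
      rintro _ ⟨L, hL, rfl⟩
      change 0 < φ.liftBaseChange ℝ _
      rw [LinearMap.liftBaseChange_tmul, one_smul]
      obtain ⟨θ, hθ⟩ := (picEquiv τ η).surjective (picMk L)
      have hθ2 := isAmpleBundle_lineB_iff.1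
        (hL.of_picMk_eq (L₂ := lineB τ η θ) hθ.symm) I j hj
      change 0 < (((picEquiv τ η).symm (picMk L) ⬝ᵥ bet I j : ℤ) : ℝ) * ((η ⬝ᵥ bet I j : ℤ) : ℝ)
      rw [← hθ, AddEquiv.symm_apply_apply]
      exact_mod_cast hθ2
    have h2 := h1 _ h
    rw [realExt, map_sum] at h2
    convert h2 using 1
    rw [realPairing, Finset.sum_mul]
    refine Finset.sum_congr rfl fun i _ => ?_
    rw [LinearMap.liftBaseChange_tmul, smul_eq_mul]
    change _ = x i * ((((picEquiv τ η).symm (picEquiv τ η (Pi.single i 1)) ⬝ᵥ bet I j : ℤ) : ℝ) *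
      ((η ⬝ᵥ bet I j : ℤ) : ℝ))
    rw [AddEquiv.symm_apply_apply, single_one_dotProduct, mul_assoc]

end AmpleCone

/-! ### The dual pair -/

section DualPair

variable {n r d : ℕ} {τ : TorusSequence n r d} {η : Fin r → ℤ} [hN : Nondeg τ η]

variable (τ η) in
/-- The standard identifications, given by the charts and by the bundles of the characters. -/
def toricMarking : ToricMarking τ η where
  pt := fixedEquiv τ η
  mem_chart_iff := mem_chart_iff_eq_fixedEquiv
  bundle := bundleHom τ η
  isAssociated := isAssociated_bundleHom
  pic := picEquiv τ η
  pic_apply w := (forget_bundleHom w).symm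

theorem isAdmissible_data {ξ : Fin d → ℤ} (hξ : τ.dual.IsGeneric ξ)
    {ι : (Fin r → ℤ) →+ (Fin n → ℤ)} (hι : ∀ l, τ.b *ᵥ ι l = l) :
    ((toricMarking τ η).data ξ ι).IsAdmissible where
  algebraic := isAlgebraicAction
  finite := Finite.of_equiv _ (fixedEquiv τ η)
  chamber := ⟨realPt ξ, realPt_mem_rootComplement hξ, rfl⟩
  isSection l := by
    obtain ⟨θ, rfl⟩ := (picEquiv τ η).surjective l
    change forget d (bundleHom τ η (ι ((picEquiv τ η).symm (picEquiv τ η θ)))) = _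
    rw [AddEquiv.symm_apply_apply, forget_bundleHom, hι]
    rfl

/-- A functional on the Picard group is determined by its values on the basis given by the characters
of `S`. -/
theorem functional_eq_iff {y : Fin r → ℤ} {θ : Pic (ToricSpace τ η) →+ ℤ} :
    θ = (toricMarking τ η).functional y ↔ (fun i => θ (picEquiv τ η (Pi.single i 1))) = y := by
  have key : ∀ x : Fin r → ℤ, (toricMarking τ η).functional y (picEquiv τ η x) = x ⬝ᵥ y := by
    intro x
    change (picEquiv τ η).symm (picEquiv τ η x) ⬝ᵥ y = _
    rw [AddEquiv.symm_apply_apply]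
  constructor
  · rintro rfl
    funext i
    rw [key, single_one_dotProduct]
  · rintro rfl
    ext l
    obtain ⟨x, rfl⟩ := (picEquiv τ η).surjective l
    rw [key]
    have h1 : x = ∑ i, x i • (Pi.single i 1 : Fin r → ℤ) := by
      funext k
      simp [Finset.sum_apply, Pi.single_apply]
    conv_lhs => rw [h1]
    simp only [map_sum, map_zsmul, smul_eq_mul, dotProduct]

theorem neg_functional (y : Fin r → ℤ) :
    -(toricMarking τ η).functional y = (toricMarking τ η).functional (-y) := by
  ext l
  change -(_ ⬝ᵥ y) = _ ⬝ᵥ (-y)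
  rw [dotProduct_neg]

variable {ξ : Fin d → ℤ} [hN₂ : Nondeg τ.dual ξ]

/-- The equivariant roots of `X` at `p_I`, namely `± α^I_i`, are the Kähler roots of the dual. -/
theorem rootMult_eq_count (ι₂ : (Fin d → ℤ) →+ (Fin n → ℤ)) (I : τ.Bases)
    (θ : Pic (ToricSpace τ.dual ξ) →+ ℤ) :
    rootMult d (param I 0 : ToricSpace τ η)
      (fun i => θ (picEquiv τ.dual ξ (Pi.single i 1))) =
    @Multiset.count _ (Classical.decEq _) θ
      (((toricMarking τ.dual ξ).data η ι₂).Ψ (fixedEquiv τ.dual ξ I.compl)) := by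
  classical
  set α : Fin d → ℤ := fun i => θ (picEquiv τ.dual ξ (Pi.single i 1)) with hα
  rw [rootMult_param]
  have h1 : ((toricMarking τ.dual ξ).data η ι₂).Ψ (fixedEquiv τ.dual ξ I.compl) =
      ∑ i ∈ I.1, {(toricMarking τ.dual ξ).functional (alpha I i),
        (toricMarking τ.dual ξ).functional (-alpha I i)} := by
    change ∑ j ∈ (((fixedEquiv τ.dual ξ).symm (fixedEquiv τ.dual ξ I.compl)).1)ᶜ,
      ({(toricMarking τ.dual ξ).functional (τ.dual.beta
          ((fixedEquiv τ.dual ξ).symm (fixedEquiv τ.dual ξ I.compl)).1 j),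
        -(toricMarking τ.dual ξ).functional (τ.dual.beta
          ((fixedEquiv τ.dual ξ).symm (fixedEquiv τ.dual ξ I.compl)).1 j)} : Multiset _) = _
    rw [Equiv.symm_apply_apply]
    have h2 : (I.compl.1)ᶜ = I.1 := compl_compl I.1
    rw [h2]
    refine Finset.sum_congr rfl fun i hi => ?_
    have h3 : i ∉ I.compl.1 := by rw [Bases.mem_compl]; exact not_not.2 hi
    rw [neg_functional, beta_eq_bet (τ := τ.dual) hN₂.uni h3, bet_compl hi]
  rw [h1]
  have h2 : ∀ κ : Idx I, (chartWt η I κ).1 = α ↔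
      θ = (toricMarking τ.dual ξ).functional (chartWt η I κ).1 := fun κ =>
    ⟨fun h => functional_eq_iff.2 h.symm, fun h => (functional_eq_iff.1 h).symm⟩
  have h3 : Nat.card {κ : Idx I // (chartWt η I κ).1 = α} =
      ∑ κ : Idx I, if (chartWt η I κ).1 = α then 1 else 0 := by
    rw [Nat.card_eq_fintype_card, Fintype.card_subtype, Finset.card_filter]
  rw [h3, Fintype.sum_sum_type, Multiset.count_sum', ← Finset.sum_coe_sort I.1,
    ← Finset.sum_add_distrib]
  refine Finset.sum_congr rfl fun i _ => ?_
  rw [Multiset.insert_eq_cons, Multiset.count_cons, Multiset.count_singleton, add_comm]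
  congr 1
  · exact if_congr (h2 (Sum.inr i)) rfl rfl
  · exact if_congr (h2 (Sum.inl i)) rfl rfl

/-- The two `H`-weights are opposite because the two vertices attached to `I` are orthogonal to each
other, as are the characters `w` and `v`. -/
theorem fibreW_fst_dotProduct (I : τ.Bases) {w v : Fin n → ℤ} (h : w ⬝ᵥ v = 0) :
    (fibreW η I w).1 ⬝ᵥ (τ.a *ᵥ v) =
      -((fibreW (τ := τ.dual) ξ I.compl v).1 ⬝ᵥ (τ.b *ᵥ w)) := by
  set s := slack I (τ.b *ᵥ w) with hs
  set s₂ := slack (τ := τ.dual) I.compl (τ.a *ᵥ v) with hs₂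
  have h1 : τ.aᵀ *ᵥ (fibreW η I w).1 = w - s := transpose_a_fibreW I w
  have h2 : τ.bᵀ *ᵥ (fibreW (τ := τ.dual) ξ I.compl v).1 = v - s₂ :=
    transpose_a_fibreW (τ := τ.dual) I.compl v
  have h3 : s ⬝ᵥ s₂ = 0 := by
    refine Finset.sum_eq_zero fun k _ => ?_
    by_cases hk : k ∈ I.1
    · rw [hs, slack_mem hk, zero_mul]
    · rw [hs₂, slack_mem (τ := τ.dual) (Bases.mem_compl.2 hk), mul_zero]
  have h4 : s ⬝ᵥ v = (fibreW (τ := τ.dual) ξ I.compl v).1 ⬝ᵥ (τ.b *ᵥ w) := by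
    have h5 : τ.b *ᵥ s = τ.b *ᵥ w := b_mulVec_slack I _
    rw [dotProduct_comm _ (τ.b *ᵥ w), ← h5, τ.dotProduct_b_mulVec, h2, dotProduct_sub, h3, sub_zero]
  rw [← h4, dotProduct_comm, τ.dotProduct_a_mulVec, h1, dotProduct_sub, dotProduct_comm v, h,
    zero_sub, dotProduct_comm]

/-- Both sides are the sum of the exponents of the frame monomial of weight `b w`. -/
theorem fibreW_snd_eq (hη : τ.dual.dual.IsGeneric η) (I : τ.Bases) (w : Fin n → ℤ) :
    (fibreW η I w).2 = -((wtDetNeg r (cell τ.dual η)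
      (param I.compl 0 : ToricSpace τ.dual ξ)).1 ⬝ᵥ (τ.b *ᵥ w)) := by
  classical
  have h0 := wtDetNeg_param (τ := τ.dual) (η := ξ) hη I.compl
  rw [h0, Prod.fst_sum, sum_dotProduct, ← Finset.sum_neg_distrib]
  change ∑ k, sg η I k * slack I (τ.b *ᵥ w) k = _
  rw [Finset.sum_coe_sort I.compl.1 (fun i => -(-(sg η (Bases.compl (τ := τ.dual) I.compl) i •
    alpha I.compl i) ⬝ᵥ (τ.b *ᵥ w)))]
  have hc : (I.compl).1 = I.1ᶜ := rfl
  rw [hc, ← Finset.sum_subset (Finset.subset_univ I.1ᶜ) fun k _ hk => by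
    rw [slack_mem (by simpa using hk), mul_zero]]
  refine Finset.sum_congr rfl fun k hk => ?_
  have hk' : k ∉ I.1 := by simpa using hk
  rw [slack_notMem hk', alpha_compl hk', compl_compl_bases, neg_dotProduct, neg_neg,
    smul_dotProduct, smul_eq_mul, dotProduct_comm]
  rfl

/-- The `𝕊`-weight of the repelling part, shifted by `d`, is a signed sum of the entries `rho I i k`
with `i ∈ I` and `k ∉ I`.  For the dual sequence this matrix is replaced by its negative transpose,
with the same signs. -/
theorem wtDetNeg_snd_add (hξ : τ.dual.IsGeneric ξ) (I : τ.Bases) :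
    (wtDetNeg d (cell τ ξ) (param I 0 : ToricSpace τ η)).2 + d =
      ∑ i ∈ I.1, ∑ k ∈ I.1ᶜ, sg ξ I.compl i * (sg η I k * rho I i k) := by
  rw [wtDetNeg_param hξ I, Prod.snd_sum]
  have h1 : ∑ i : I.1, (-(sg ξ I.compl i * monoDeg η I (τ.bVec i)) - 1) =
      ∑ i ∈ I.1, -(sg ξ I.compl i * monoDeg η I (τ.bVec i)) - d := by
    rw [Finset.sum_sub_distrib, Finset.sum_coe_sort I.1
      (fun i => -(sg ξ I.compl i * monoDeg η I (τ.bVec i)))]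
    simp [I.card]
  refine (congrArg (· + (d : ℤ)) h1).trans ?_
  rw [sub_add_cancel]
  refine Finset.sum_congr rfl fun i hi => ?_
  rw [monoDeg, ← Finset.sum_subset (Finset.subset_univ I.1ᶜ) fun k _ hk => by
    rw [slack_mem (by simpa using hk), mul_zero], Finset.mul_sum, ← Finset.sum_neg_distrib]
  refine Finset.sum_congr rfl fun k hk => ?_
  have hki : k ≠ i := by rintro rfl; simp [hi] at hk
  rw [slack_bVec_eq, Pi.sub_apply, Pi.single_eq_of_ne hki]
  ring

theorem wtDetNeg_snd_dual (hη : τ.dual.dual.IsGeneric η) (hξ : τ.dual.IsGeneric ξ) (I : τ.Bases) :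
    (wtDetNeg d (cell τ ξ) (param I 0 : ToricSpace τ η)).2 + d =
      -((wtDetNeg r (cell τ.dual η) (param I.compl 0 : ToricSpace τ.dual ξ)).2 + r) := by
  rw [wtDetNeg_snd_add hξ, wtDetNeg_snd_add (τ := τ.dual) (ξ := η) (hN₂ := hN) hη, Finset.sum_comm]
  have hc : (I.compl).1 = I.1ᶜ := rfl
  rw [hc, compl_compl, ← Finset.sum_neg_distrib]
  refine Finset.sum_congr rfl fun k hk => ?_
  rw [← Finset.sum_neg_distrib]
  refine Finset.sum_congr rfl fun i hi => ?_
  have hk' : k ∉ I.1 := by simpa using hk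
  rw [rho_compl hk', circ_mem hi, compl_compl_bases]
  have h : ∀ x y z : ℤ, x * (y * z) = -(y * (x * -z)) := fun x y z => by ring
  exact h _ _ _

/-- The data on `X` and on the dual of `X` form a dual pair. -/
theorem isDualPair (hη : τ.dual.dual.IsGeneric η) (hξ : τ.dual.IsGeneric ξ)
    {ι : (Fin r → ℤ) →+ (Fin n → ℤ)} (hι : ∀ l, τ.b *ᵥ ι l = l)
    {ι₂ : (Fin d → ℤ) →+ (Fin n → ℤ)} (hι₂ : ∀ m, τ.a *ᵥ ι₂ m = m)
    (hcompat : ∀ l m, ι l ⬝ᵥ ι₂ m = 0) :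
    IsDualPair ((toricMarking τ η).data ξ ι) ((toricMarking τ.dual ξ).data η ι₂)
      (((toricMarking τ η).pt.symm.trans (gale τ)).trans (toricMarking τ.dual ξ).pt)
      (toricMarking τ.dual ξ).pic (toricMarking τ η).pic := by
  have hC : ((toricMarking τ η).data ξ ι).C = cell τ ξ := connectedComponentIn_eq_cell hξ
  have hC₂ : ((toricMarking τ.dual ξ).data η ι₂).C = cell τ.dual η :=
    connectedComponentIn_eq_cell (τ := τ.dual) (η := ξ) hη
  have hσ : ∀ I : τ.Bases, (((toricMarking τ η).pt.symm.trans (gale τ)).trans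
      (toricMarking τ.dual ξ).pt) (fixedEquiv τ η I) = fixedEquiv τ.dual ξ I.compl := by
    intro I
    change fixedEquiv τ.dual ξ (Bases.compl ((fixedEquiv τ η).symm (fixedEquiv τ η I))) = _
    rw [Equiv.symm_apply_apply]
  refine
    { admissible := isAdmissible_data hξ hι
      admissible_dual := isAdmissible_data (τ := τ.dual) hη hι₂
      order_reversing := ?_
      chamber_eq := ?_
      chamber_eq_dual := ?_
      roots_eq := ?_
      roots_eq_dual := ?_
      wt_H := ?_
      wt_S := ?_
      wt_S_dual := ?_
      wt_S_det := ?_ }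
  · intro p q
    obtain ⟨I, rfl⟩ := (fixedEquiv τ η).surjective p
    obtain ⟨J, rfl⟩ := (fixedEquiv τ η).surjective q
    rw [hσ, hσ, hC, hC₂]
    rw [fixedLE_iff hξ (realPt_mem_cell hN.uni hξ) subset_rfl]
    refine (reflTransGen_feas_compl_iff hN.uni hN.gen hξ).trans ?_
    exact (fixedLE_iff (τ := τ.dual) (η := ξ) hη (realPt_mem_cell (τ := τ.dual) hN₂.uni hη)
      subset_rfl).symm
  · intro x
    rw [hC]
    exact mem_ampleCone_iff τ.dual ξ x
  · intro x
    rw [hC₂]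
    exact mem_ampleCone_iff τ η x
  · intro p θ
    obtain ⟨I, rfl⟩ := (fixedEquiv τ η).surjective p
    rw [hσ]
    exact rootMult_eq_count ι₂ I θ
  · intro p θ
    obtain ⟨I, rfl⟩ := (fixedEquiv τ η).surjective p
    rw [hσ]
    have h1 := rootMult_eq_count (τ := τ.dual) (η := ξ) (ξ := η) (hN₂ := hN) ι I.compl θ
    rw [compl_compl_bases] at h1
    exact h1
  · intro p l m
    obtain ⟨I, rfl⟩ := (fixedEquiv τ η).surjective p
    obtain ⟨l, rfl⟩ := (picEquiv τ η).surjective l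
    obtain ⟨m, rfl⟩ := (picEquiv τ.dual ξ).surjective m
    rw [hσ]
    change (fibreWt d (bundleHom τ η (ι ((picEquiv τ η).symm (picEquiv τ η l)))) (param I 0)).1 ⬝ᵥ
      (picEquiv τ.dual ξ).symm (picEquiv τ.dual ξ m) =
      -((fibreWt r (bundleHom τ.dual ξ (ι₂ ((picEquiv τ.dual ξ).symm (picEquiv τ.dual ξ m))))
        (param I.compl 0)).1 ⬝ᵥ (picEquiv τ η).symm (picEquiv τ η l))
    rw [AddEquiv.symm_apply_apply, AddEquiv.symm_apply_apply, fibreWt_bundleHom, fibreWt_bundleHom]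
    have h1 := fibreW_fst_dotProduct (η := η) (ξ := ξ) I (hcompat l m)
    rwa [hι, hι₂] at h1
  · intro p l
    obtain ⟨I, rfl⟩ := (fixedEquiv τ η).surjective p
    obtain ⟨l, rfl⟩ := (picEquiv τ η).surjective l
    rw [hσ, hC₂]
    change (fibreWt d (bundleHom τ η (ι ((picEquiv τ η).symm (picEquiv τ η l)))) (param I 0)).2 =
      -((wtDetNeg r (cell τ.dual η) (param I.compl 0 : ToricSpace τ.dual ξ)).1 ⬝ᵥ
        (picEquiv τ η).symm (picEquiv τ η l))
    rw [AddEquiv.symm_apply_apply, fibreWt_bundleHom, fibreW_snd_eq (ξ := ξ) hη, hι]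
  · intro p m
    obtain ⟨I, rfl⟩ := (fixedEquiv τ η).surjective p
    obtain ⟨m, rfl⟩ := (picEquiv τ.dual ξ).surjective m
    rw [hσ, hC]
    change (fibreWt r (bundleHom τ.dual ξ (ι₂ ((picEquiv τ.dual ξ).symm (picEquiv τ.dual ξ m))))
        (param I.compl 0)).2 =
      -((wtDetNeg d (cell τ ξ) (param I 0 : ToricSpace τ η)).1 ⬝ᵥ
        (picEquiv τ.dual ξ).symm (picEquiv τ.dual ξ m))
    rw [AddEquiv.symm_apply_apply, fibreWt_bundleHom]
    have h1 := fibreW_snd_eq (τ := τ.dual) (η := ξ) (ξ := η) (hN₂ := hN) hξ I.compl (ι₂ m)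
    rw [compl_compl_bases] at h1
    refine h1.trans ?_
    change -(_ ⬝ᵥ (τ.a *ᵥ ι₂ m)) = _
    rw [hι₂]
    rfl
  · intro p
    obtain ⟨I, rfl⟩ := (fixedEquiv τ η).surjective p
    rw [hσ, hC, hC₂]
    change ((wtDetNeg d (cell τ ξ) (param I 0 : ToricSpace τ η)).2 : ℚ) +
      (dimAt (param I 0 : ToricSpace τ η) : ℚ) / 2 =
      -(((wtDetNeg r (cell τ.dual η) (param I.compl 0 : ToricSpace τ.dual ξ)).2 : ℚ) +
        (dimAt (param I.compl 0 : ToricSpace τ.dual ξ) : ℚ) / 2)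
    have h1 := wtDetNeg_snd_dual hη hξ I (η := η)
    rw [dimAt_param, dimAt_param]
    push_cast
    rw [mul_div_cancel_left₀ _ (two_ne_zero), mul_div_cancel_left₀ _ (two_ne_zero)]
    exact_mod_cast h1

end DualPair

end ToricDual

end

theorem mainTheorem12 {n r d : ℕ} (hn : 1 ≤ n)
    -- the exact sequence of tori, unimodular and with nonzero `a_i`, `b_i`
    (τ : TorusSequence n r d) (ha : ∀ i, τ.aVec i ≠ 0) (hb : ∀ i, τ.bVec i ≠ 0)
    (huni : τ.IsUnimodular)
    -- the generic parameters
    (η : Fin r → ℤ) (hη : τ.IsGeneric η) (ξ : Fin d → ℤ) (hξ : τ.dual.IsGeneric ξ)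
    -- the compatible splittings
    (ι : (Fin r → ℤ) →+ (Fin n → ℤ)) (hι : ∀ l, τ.b *ᵥ ι l = l)
    (ι₂ : (Fin d → ℤ) →+ (Fin n → ℤ)) (hι₂ : ∀ m, τ.a *ᵥ ι₂ m = m)
    (hcompat : ∀ l m, ι l ⬝ᵥ ι₂ m = 0) :
    ∃ (M : ToricMarking τ η) (M₂ : ToricMarking τ.dual ξ) (gale : τ.Bases ≃ τ.dual.Bases),
      (∀ I, (gale I).1 = (I.1)ᶜ) ∧
      IsDualPair (M.data ξ ι) (M₂.data η ι₂)
        ((M.pt.symm.trans gale).trans M₂.pt) M₂.pic M.pic := by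
  have : Nondeg τ η := ⟨huni, ha, hη⟩
  have : Nondeg τ.dual ξ := ⟨huni.dual, hb, hξ⟩
  exact ⟨toricMarking τ η, toricMarking τ.dual ξ, TorusSequence.gale τ, fun _ => rfl,
    isDualPair hη hξ hι hι₂ hcompat⟩
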